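/- Let $0<\gamma<1$. Functions on $\mathbb T^3$ are identified with functions on $\mathbb R^3$ that are $2\pi$-periodic in each coordinate. For a scalar function put $|g|_{0,\gamma}=\sup|g|+\sup_{x\ne y}|g(x)-g(y)|/|x-y|^{\gamma}$, and for a vector-valued function let $|w|_{0,\gamma}=\max_k|w_k|_{0,\gamma}$. Call $\Theta>0$ a Schauder constant for $\gamma$ if $$|\partial_i\partial_j\phi|_{0,\gamma}\le\Theta\,|\nabla^2\phi|_{0,\gamma}\qquad\text{for all } i,j \text{ and all } \phi\in C^{2,\gamma}(\mathbb T^3)\text{ with }\int_{\mathbb T^3}\phi=0 .$$ Such constants exist. For a Schauder constant $\Theta$ put $$Q_c=\sqrt{\Big(\frac{2}{3\Theta}+\frac{32}{9}\Big)^2+\frac{4}{27\Theta^2}+\frac{2}{81\Theta^3}}-\frac{2}{3\Theta}-\frac{32}{9}.$$ **Theorem.** Let $\Theta$ be a Schauder constant for $\gamma$. Then $Q_c>0$. Let $v_0$ be a divergence-free $C^1$ vector field on $\mathbb T^3$ whose vorticity $\omega_0=\nabla\times v_0$ is in $C^{0,\gamma}(\mathbb T^3)$. Then there are vector fields $\xi^{(s)}$,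 $s\ge1$, on $\mathbb T^3$ such that the following holds. (i) For every $s\ge1$, $\xi^{(s)}$ is the unique $C^1$ vector field on $\mathbb T^3$ that satisfies Cauchy's recurrence relations $$s\,\nabla\times\xi^{(s)}=\omega_0\,\delta^s_1-\sum_{k=1}^{3}\sum_{0<n<s}n\,\nabla\xi^{(n)}_k\times\nabla\xi^{(s-n)}_k,$$ $$\nabla\cdot\xi^{(s)}=\sum_{1\le i<j\le3}\ \sum_{0<n<s}\Big((\partial_j\xi^{(n)}_i)\,\partial_i\xi^{(s-n)}_j-(\partial_i\xi^{(n)}_i)\,\partial_j\xi^{(s-n)}_j\Big)-\sum_{i,j,k}\ \sum_{\substack{l+m+n=s\\ l,m,n\ge1}}\varepsilon_{ijk}\,(\partial_i\xi^{(l)}_1)(\partial_j\xi^{(m)}_2)\,\partial_k\xi^{(n)}_3$$ and has the mean value of $v_0$ if $s=1$ and mean value zero if $s\ge2$; so the $\xi^{(s)}$ are determined recursively. (ii) The radius of convergence $\tau$ of the power series $\sum_{s\ge1}\xi^{(s)}t^s$, as a series with coefficients in $C^{1,\gamma}(\mathbb T^3)$, satisfies $$\tau\ \ge\ t_c:=\frac{Q_c}{2\,|\omega_0|_{0,\gamma}}\qquad(t_c=\infty\text{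 if }\omega_0=0).$$ (iii) Let $(v,p)$ be a classical space-periodic solution of the incompressible Euler equations $\partial_tv+(v\cdot\nabla)v=-\nabla p$, $\nabla\cdot v=0$ on $[0,T)\times\mathbb R^3$ (that is, $v$ is $C^1$ in $(t,x)$, and $v(t,\cdot)$ and $p(t,\cdot)$ are $2\pi$-periodic in each coordinate, with $p(t,\cdot)$ of class $C^1$) with $v(0,\cdot)=v_0$, and let $\xi(q,t)$ be the displacement of the fluid particle starting at $q$: $\dot\xi(q,t)=v(t,q+\xi(q,t))$, $\xi(q,0)=0$. Then $$\xi(q,t)=\sum_{s=1}^\infty\xi^{(s)}(q)\,t^s\qquad\text{for all }q\text{ and all }0\le t<\min(T,t_c).$$ -/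

import Mathlib

open scoped NNReal ENNReal

namespace EulerLagrange

noncomputable section

/-- The space `ℝ³` with its Euclidean norm. -/
abbrev E3 := EuclideanSpace ℝ (Fin 3)

/-- The `i`-th coordinate vector of `ℝ³`. -/
def basisVec (i : Fin 3) : E3 := EuclideanSpace.single i 1

/-- `f` is `2π`-periodic in each of the three coordinates, that is, a function on the torus `𝕋³`. -/
def Periodic3 {F : Type*} (f : E3 → F) : Prop :=
  ∀ (q : E3) (i : Fin 3), f (q + (2 * Real.pi) • basisVec i) = f q

/-- The periodicity box `[0, 2π]³`. -/
def box : Set E3 := {q | ∀ i, q i ∈ Set.Icc 0 (2 * Real.pi)}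

/-- The partial derivative `∂g/∂q_i` of a scalar function. -/
def pd (i : Fin 3) (g : E3 → ℝ) (q : E3) : ℝ := fderiv ℝ g q (basisVec i)

/-- The `k`-th component of a vector field. -/
def comp (f : E3 → E3) (k : Fin 3) (q : E3) : ℝ := f q k

/-- The gradient of a scalar function, as the triple of its partial derivatives. -/
def grad (g : E3 → ℝ) (q : E3) : Fin 3 → ℝ := fun i => pd i g q

/-- The Laplacian of a scalar function. -/
def laplacian (g : E3 → ℝ) (q : E3) : ℝ := ∑ i, pd i (pd i g) q

/-- The divergence of a vector field. -/
def divergence (f : E3 → E3) (q : E3) : ℝ := ∑ i, pd i (comp f i) q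

/-- The curl of a vector field. -/
def curl (f : E3 → E3) (q : E3) : Fin 3 → ℝ :=
  ![pd 1 (comp f 2) q - pd 2 (comp f 1) q,
    pd 2 (comp f 0) q - pd 0 (comp f 2) q,
    pd 0 (comp f 1) q - pd 1 (comp f 0) q]

/-! ### Hölder norms -/

/-- The norm of `C^{0,γ}` of a scalar function: supremum norm plus Hölder seminorm. -/
def norm0 (γ : ℝ≥0) (g : E3 → ℝ) : ℝ≥0∞ := (⨆ q, ‖g q‖ₑ) + eHolderNorm γ g

/-- The norm of `C^{0,γ}` of a vector-valued function: the maximum over the components. -/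
def vecNorm0 (γ : ℝ≥0) (w : E3 → Fin 3 → ℝ) : ℝ≥0∞ := ⨆ k, norm0 γ (fun q => w q k)

/-- The norm of `C^{1,γ}` of a vector field. -/
def vecNorm1 (γ : ℝ≥0) (f : E3 → E3) : ℝ≥0∞ :=
  ⨆ k, ((⨆ q, ‖comp f k q‖ₑ) + ⨆ i, norm0 γ (pd i (comp f k)))

/-- `φ` is a function of class `C^{2,γ}` on the torus. -/
def IsC2Holder (γ : ℝ≥0) (φ : E3 → ℝ) : Prop :=
  Periodic3 φ ∧ ContDiff ℝ 2 φ ∧ ∀ i j, MemHolder γ (pd i (pd j φ))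

/-- `Θ` is an admissible constant in the Schauder inequality
`|∂_i ∂_j φ|_{0,γ} ≤ Θ |Δφ|_{0,γ}` for the `φ ∈ C^{2,γ}(𝕋³)` of zero mean. -/
def IsSchauderConstant (γ Θ : ℝ≥0) : Prop :=
  0 < Θ ∧ ∀ φ : E3 → ℝ, IsC2Holder γ φ → ∫ q in box, φ q = 0 →
    ∀ i j, norm0 γ (pd i (pd j φ)) ≤ Θ * norm0 γ (laplacian φ)

/-- The explicit constant `Q_c` as a function of `Θ`. -/
def Qc (Θ : ℝ) : ℝ :=
  Real.sqrt ((2 / (3 * Θ) + 32 / 9) ^ 2 + 4 / (27 * Θ ^ 2) + 2 / (81 * Θ ^ 3))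
    - 2 / (3 * Θ) - 32 / 9

/-! ### Cauchy's recurrence relations -/

/-- The quadratic sum in the relation for the curl of the `s`-th coefficient:
the sum over `k` and `0 < n < s` of `n ∇ξ_k^{(n)} × ∇ξ_k^{(s-n)}`. -/
def curlTerm (ξ : ℕ → E3 → E3) (s : ℕ) (q : E3) : Fin 3 → ℝ :=
  ∑ k : Fin 3, ∑ n ∈ Finset.Ioo 0 s,
    (n : ℝ) • crossProduct (grad (comp (ξ n) k) q) (grad (comp (ξ (s - n)) k) q)

/-- The quadratic sum in the relation for the divergence of the `s`-th coefficient. -/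
def divQuadratic (ξ : ℕ → E3 → E3) (s : ℕ) (q : E3) : ℝ :=
  ∑ i : Fin 3, ∑ j ∈ Finset.Ioi i, ∑ n ∈ Finset.Ioo 0 s,
    (pd j (comp (ξ n) i) q * pd i (comp (ξ (s - n)) j) q
      - pd i (comp (ξ n) i) q * pd j (comp (ξ (s - n)) j) q)

/-- The cubic sum in the relation for the divergence of the `s`-th coefficient, over the triples
of positive integers with sum `s`. The sum over indices weighted with the unit antisymmetric
tensor is written as a signed sum over permutations. -/
def divCubic (ξ : ℕ → E3 → E3) (s : ℕ) (q : E3) : ℝ :=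
  ∑ n ∈ (Finset.Nat.antidiagonalTuple 3 s).filter (fun n => ∀ k, 0 < n k),
    ∑ σ : Equiv.Perm (Fin 3), ((Equiv.Perm.sign σ : ℤ) : ℝ) *
      ∏ k : Fin 3, pd (σ k) (comp (ξ (n k)) k) q

/-- The `C¹` field `f` on the torus solves the `s`-th recurrence relations (for its curl and its
divergence) whose right-hand sides are formed with the fields `ξ n`, `0 < n < s`.
The mean value, which curl and divergence leave free, is that of the initial
velocity for `s = 1` and zero for `s ≥ 2` (conservation of momentum). -/
structure SolvesRecurrence (v₀ : E3 → E3) (ξ : ℕ → E3 → E3) (s : ℕ) (f : E3 → E3) : Prop where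
  periodic : Periodic3 f
  contDiff : ContDiff ℝ 1 f
  curl_eq : ∀ q, (s : ℝ) • curl f q = (if s = 1 then curl v₀ q else 0) - curlTerm ξ s q
  div_eq : ∀ q, divergence f q = divQuadratic ξ s q - divCubic ξ s q
  mean_eq : ∫ q in box, f q = if s = 1 then ∫ q in box, v₀ q else 0

/-- The radius of convergence of the power series `∑ ξ s * t ^ s` with coefficients in the space
`C^{1,γ}(𝕋³)`. -/
def timeRadius (γ : ℝ≥0) (ξ : ℕ → E3 → E3) : ℝ≥0∞ :=
  ⨆ (r : ℝ≥0) (_ : ∑' s, vecNorm1 γ (ξ s) * (r : ℝ≥0∞) ^ s ≠ ⊤), (r : ℝ≥0∞)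

/-! ### Euler flows -/

/-- `(v, p)` is a classical space-periodic solution of the incompressible Euler equations
`∂_t v + (v · ∇) v = -∇p`, `∇ · v = 0` on the time interval `[0, T)`. -/
structure IsEulerFlow (T : ℝ) (v : ℝ → E3 → E3) (p : ℝ → E3 → ℝ) : Prop where
  periodic_velocity : ∀ t ∈ Set.Ico 0 T, Periodic3 (v t)
  periodic_pressure : ∀ t ∈ Set.Ico 0 T, Periodic3 (p t)
  contDiff_velocity :
    ContDiffOn ℝ 1 (fun z : ℝ × E3 => v z.1 z.2) (Set.Ico 0 T ×ˢ Set.univ)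
  contDiff_pressure : ∀ t ∈ Set.Ico 0 T, ContDiff ℝ 1 (p t)
  momentum : ∀ t ∈ Set.Ico 0 T, ∀ x, HasDerivWithinAt (fun τ => v τ x)
    (-(fderiv ℝ (v t) x (v t x)) - gradient (p t) x) (Set.Ico 0 T) t
  incompressible : ∀ t ∈ Set.Ico 0 T, ∀ x, divergence (v t) x = 0

/-- `d t q` is the displacement at time `t` of the fluid particle that starts at `q`: the position
`q + d t q` moves with the velocity `v`. -/
structure IsDisplacement (T : ℝ) (v : ℝ → E3 → E3) (d : ℝ → E3 → E3) : Prop where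
  initial : ∀ q, d 0 q = 0
  trajectory : ∀ t ∈ Set.Ico 0 T, ∀ q,
    HasDerivWithinAt (fun τ => d τ q) (v t (q + d t q)) (Set.Ico 0 T) t

end

end EulerLagrange

open EulerLagrange

/-!
# Time analyticity of Lagrangian trajectories of the Euler equations

**Schauder constants.** Average a function against a smooth kernel dilated to the scale `r`. With
`moll` the mollifier and `newton` the matching kernel, the derivative in `r` of the average
against `moll` is the Laplacian of `2 * r` times the average against `newton`. Integration over
`r` in `[0, 1]` gives a function, `potential g`, with Laplacian (mollification of `g`) `- g`
(`laplacian_potential`). Its second derivatives are integrals over the scales of `r⁻¹` times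
averages against kernels of zero mean, and these are bounded on Hölder spaces
(`exists_singular_bound`). The mollifier at unit scale is bounded below on a period cell, so
mollification contracts the periodic functions of zero mean in the supremum norm, and a Neumann
series removes the error (`exists_sub_avg_eq`). This solves the Poisson equation on the torus with
a Schauder estimate (`exists_poisson`, `exists_isSchauderConstant`), for which neither Fourier
series nor a fundamental solution on the whole space is needed.

**The recurrence relations.** Their right-hand sides are sums of null Lagrangians: they have zero
mean, and the one for the curl is divergence free. Hence the curl and the divergence can be
prescribed simultaneously, with the Schauder bound (`exists_hodge`, `exists_solvesRecurrence`);
the solution is unique because a periodic harmonic function is constant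
(`eq_zero_of_curl_div_mean`). Antisymmetry of the cross product replaces the weight `n` by `s / 2`
(`curlTerm_symm`). With this the Hölder norms `a s` of the gradients of the coefficients satisfy
`a s ≤ 2 Θ |ω₀| δ + 12 Θ ∑ a a + 6 Θ ∑ a a a`, the sums being Cauchy products. Therefore
`∑ a s * t ^ s` is bounded by every `x ≥ 0` with `2 Θ |ω₀| t + 12 Θ x² + 6 Θ x³ ≤ x`
(`tsum_le_of_cubic_majorant`). Such an `x` exists as long as `2 |ω₀| t` does not exceed the
maximum of `x / Θ - 12 x² - 6 x³`, and that maximum is `Q_c` (`Qc_eq_cubic`, `tsum_gradNorm_le`,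
`le_timeRadius`).

**The Euler flow.** Let `X` be the identity plus the sum of the series. The divergence relations
say that `X` has Jacobian determinant `1` (`gradTriple_position`), and the curl relations that it
keeps Cauchy's invariants (`sum_crossComp_position`). Testing with `cos q₀` shows `1 ≤ Θ`
(`IsSchauderConstant.one_le`), so the gradient of the displacement is at most `1 / 20` and `X` is
a measure-preserving diffeomorphism (`exists_inverse`). The time derivative of Cauchy's invariants
shows that the acceleration of `X`, pushed forward by `X`, is curl free, and it has zero mean; so
it is orthogonal in `L²` to divergence-free fields, like the pressure gradient
(`integral_eulerian_orthogonal`). For a classical solution `v`, the field `v ∘ X - ∂ₜX` is the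
pull-back of a divergence-free field, hence its energy satisfies a Grönwall inequality with zero
initial value, and `∂ₜX = v ∘ X` (`defect_eq_zero`). No a priori regularity of the trajectories in
time is used, and no analyticity of the flow of `v`. Uniqueness for ordinary differential
equations identifies `X` with the flow (`displacement_eq_series`).
-/

namespace EulerLagrange

noncomputable section

open MeasureTheory Filter Set Topology

/-! ### Partial derivatives -/

lemma fderiv_apply_eq_sum (g : E3 → ℝ) (q v : E3) :
    fderiv ℝ g q v = ∑ i, v i * pd i g q := by
  have hv : v = ∑ i, v i • basisVec i := by
    ext j
    simp [basisVec, Pi.single_apply]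
  conv_lhs => rw [hv]
  simp [pd]

lemma fderiv_eq_sum (g : E3 → ℝ) (q : E3) :
    fderiv ℝ g q = ∑ i, pd i g q • (EuclideanSpace.proj i : E3 →L[ℝ] ℝ) := by
  ext v
  rw [fderiv_apply_eq_sum]
  simp [mul_comm]

lemma pd_eq_of_hasFDerivAt {g : E3 → ℝ} {c : Fin 3 → ℝ} {q : E3}
    (h : HasFDerivAt g (∑ i, c i • (EuclideanSpace.proj i : E3 →L[ℝ] ℝ)) q) (i : Fin 3) :
    pd i g q = c i := by
  rw [pd, h.fderiv]
  simp [basisVec]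

lemma contDiff_succ_of_pd {n : ℕ} {g : E3 → ℝ} (hg : Differentiable ℝ g)
    (h : ∀ i, ContDiff ℝ n (pd i g)) : ContDiff ℝ (n + 1) g := by
  rw [contDiff_succ_iff_fderiv]
  refine ⟨hg, by simp, ?_⟩
  have : fderiv ℝ g = fun q => ∑ i, pd i g q • (EuclideanSpace.proj i : E3 →L[ℝ] ℝ) :=
    funext (fderiv_eq_sum g)
  rw [this]
  exact ContDiff.sum fun i _ => (h i).smul contDiff_const

lemma ContDiff.pd_succ {n : ℕ} {g : E3 → ℝ} (hg : ContDiff ℝ (n + 1) g) (i : Fin 3) :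
    ContDiff ℝ n (pd i g) :=
  (hg.fderiv_right le_rfl).clm_apply contDiff_const

lemma continuous_pd {g : E3 → ℝ} (hg : ContDiff ℝ 1 g) (i : Fin 3) : Continuous (pd i g) :=
  (hg.continuous_fderiv one_ne_zero).clm_apply continuous_const

lemma contDiff_pd {g : E3 → ℝ} (hg : ContDiff ℝ 2 g) (i : Fin 3) : ContDiff ℝ 1 (pd i g) :=
  ContDiff.pd_succ (n := 1) (by simpa [one_add_one_eq_two] using hg) i

lemma differentiable_of_contDiff_one {g : E3 → ℝ} (hg : ContDiff ℝ 1 g) : Differentiable ℝ g :=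
  hg.differentiable one_ne_zero

lemma pd_add {f g : E3 → ℝ} (hf : Differentiable ℝ f) (hg : Differentiable ℝ g) (i : Fin 3)
    (q : E3) : pd i (fun x => f x + g x) q = pd i f q + pd i g q := by
  simp only [pd]
  rw [fderiv_fun_add (hf q) (hg q)]; rfl

lemma pd_sub {f g : E3 → ℝ} (hf : Differentiable ℝ f) (hg : Differentiable ℝ g) (i : Fin 3)
    (q : E3) : pd i (fun x => f x - g x) q = pd i f q - pd i g q := by
  simp only [pd]
  rw [fderiv_fun_sub (hf q) (hg q)]; rfl

lemma pd_neg (f : E3 → ℝ) (i : Fin 3) (q : E3) : pd i (fun x => -f x) q = -pd i f q := by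
  simp only [pd]
  rw [fderiv_fun_neg]; rfl

lemma pd_mul {f g : E3 → ℝ} (hf : Differentiable ℝ f) (hg : Differentiable ℝ g) (i : Fin 3)
    (q : E3) : pd i (fun x => f x * g x) q = f q * pd i g q + g q * pd i f q := by
  simp only [pd]
  rw [fderiv_fun_mul (hf q) (hg q)]; rfl

lemma pd_const (c : ℝ) (i : Fin 3) (q : E3) : pd i (fun _ => c) q = 0 := by
  simp [pd]

lemma pd_sum {ι : Type*} (s : Finset ι) {f : ι → E3 → ℝ} (hf : ∀ k ∈ s, Differentiable ℝ (f k))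
    (i : Fin 3) (q : E3) : pd i (fun x => ∑ k ∈ s, f k x) q = ∑ k ∈ s, pd i (f k) q := by
  simp only [pd]
  rw [fderiv_fun_sum fun k hk => hf k hk q]
  simp

/-- Mixed partial derivatives of a `C²` function commute. -/
lemma pd_pd_comm {g : E3 → ℝ} (hg : ContDiff ℝ 2 g) (i j : Fin 3) (q : E3) :
    pd i (pd j g) q = pd j (pd i g) q := by
  have hd : Differentiable ℝ (fderiv ℝ g) :=
    (hg.fderiv_right (m := 1) (by norm_num)).differentiable one_ne_zero
  have key : ∀ a b : Fin 3,
      pd a (pd b g) q = fderiv ℝ (fderiv ℝ g) q (basisVec a) (basisVec b) := by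
    intro a b
    have : pd b g = fun x => fderiv ℝ g x (basisVec b) := rfl
    rw [pd, this, fderiv_clm_apply (hd q) (differentiableAt_const _)]
    simp
  rw [key, key]
  exact second_derivative_symmetric (f := g)
    (fun x => (hg.differentiable two_ne_zero x).hasFDerivAt) (hd q).hasFDerivAt _ _

/-- The derivative along a coordinate direction is the partial derivative. -/
lemma hasDerivAt_line {g : E3 → ℝ} (hg : Differentiable ℝ g) (i : Fin 3) (q : E3) (h : ℝ) :
    HasDerivAt (fun h : ℝ => g (q + h • basisVec i)) (pd i g (q + h • basisVec i)) h := by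
  have h1 : HasDerivAt (fun h : ℝ => q + h • basisVec i) (basisVec i) h := by
    simpa using ((hasDerivAt_id h).smul_const (basisVec i)).const_add q
  exact (hg _).hasFDerivAt.comp_hasDerivAt h h1

lemma contDiff_comp {n : ℕ∞} {f : E3 → E3} (hf : ContDiff ℝ n f) (k : Fin 3) :
    ContDiff ℝ n (comp f k) :=
  contDiff_euclidean.1 hf k

lemma contDiff_of_comp {n : ℕ∞} {f : E3 → E3} (hf : ∀ k, ContDiff ℝ n (comp f k)) :
    ContDiff ℝ n f :=
  contDiff_euclidean.2 hf

/-! ### Periodic functions -/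

lemma Periodic3.pd {g : E3 → ℝ} (hg : Periodic3 g) (i : Fin 3) : Periodic3 (pd i g) := by
  intro q j
  have : (fun x => g (x + (2 * Real.pi) • basisVec j)) = g := funext fun x => hg x j
  simp only [EulerLagrange.pd]
  conv_rhs => rw [← this]
  rw [fderiv_comp_add_right]

lemma Periodic3.comp {f : E3 → E3} (hf : Periodic3 f) (k : Fin 3) : Periodic3 (comp f k) :=
  fun q i => by simp only [EulerLagrange.comp, hf q i]

lemma Periodic3.add_right {F : Type*} {f : E3 → F} (hf : Periodic3 f) (h : E3) :
    Periodic3 (fun q => f (q + h)) := fun q i => by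
  simp only
  rw [add_right_comm, hf]

/-- The basis `2π e_i` of the lattice of periods. -/
def latticeBasis : Module.Basis (Fin 3) ℝ E3 :=
  (EuclideanSpace.basisFun (Fin 3) ℝ).toBasis.isUnitSMul (w := fun _ => 2 * Real.pi)
    (fun _ => (by positivity : (2 * Real.pi) ≠ 0).isUnit)

lemma latticeBasis_apply (i : Fin 3) : latticeBasis i = (2 * Real.pi) • basisVec i := by
  simp [latticeBasis, Module.Basis.isUnitSMul_apply, basisVec]

lemma latticeBasis_repr (q : E3) (i : Fin 3) : latticeBasis.repr q i = q i / (2 * Real.pi) := by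
  have h : q = ∑ j, (q j / (2 * Real.pi)) • latticeBasis j := by
    ext k
    have : (2 * Real.pi) ≠ 0 := by positivity
    simp [latticeBasis_apply, basisVec, Pi.single_apply]
    try field_simp
  conv_lhs => rw [h]
  rw [Module.Basis.repr_sum_self]

/-- The group of periods. -/
abbrev periodLattice : AddSubgroup E3 := (Submodule.span ℤ (Set.range latticeBasis)).toAddSubgroup

/-- A function that commutes with the translations by the periods `2π e_i` commutes with all
lattice translations. -/
lemma equivariant_lattice {Y : E3 → E3}
    (hY : ∀ q i, Y (q + (2 * Real.pi) • basisVec i) = Y q + (2 * Real.pi) • basisVec i)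
    {g : E3} (hg : g ∈ periodLattice) : ∀ q, Y (q + g) = Y q + g := by
  refine Submodule.span_induction (p := fun g _ => ∀ q, Y (q + g) = Y q + g) ?_ ?_ ?_ ?_ hg
  · rintro _ ⟨i, rfl⟩ q
    rw [latticeBasis_apply, hY]
  · simp
  · intro x y _ _ hx hy q
    rw [← add_assoc, hy, hx, add_assoc]
  · intro a x _ hx
    have hnat : ∀ (n : ℕ) q, Y (q + n • x) = Y q + n • x := by
      intro n
      induction n with
      | zero => simp
      | succ n ih => intro q; rw [succ_nsmul, ← add_assoc, hx, ih, add_assoc]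
    intro q
    obtain ⟨n, rfl | rfl⟩ := a.eq_nat_or_neg
    · simpa using hnat n q
    · have h1 := hnat n (q + (-(n : ℤ)) • x)
      have h2 : q + (-(n : ℤ)) • x + n • x = q := by simp
      rw [h2] at h1
      rw [h1]
      simp

lemma Periodic3.add_lattice {F : Type*} {f : E3 → F} (hf : Periodic3 f) {g : E3}
    (hg : g ∈ periodLattice) : ∀ q, f (q + g) = f q := by
  refine Submodule.span_induction (p := fun g _ => ∀ q, f (q + g) = f q) ?_ ?_ ?_ ?_ hg
  · rintro _ ⟨i, rfl⟩ q
    rw [latticeBasis_apply, hf]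
  · simp
  · intro x y _ _ hx hy q
    rw [← add_assoc, hy, hx]
  · intro a x _ hx
    have hnat : ∀ (n : ℕ) q, f (q + n • x) = f q := by
      intro n
      induction n with
      | zero => simp
      | succ n ih => intro q; rw [succ_nsmul, ← add_assoc, hx, ih]
    intro q
    obtain ⟨n, rfl | rfl⟩ := a.eq_nat_or_neg
    · simpa using hnat n q
    · have h1 := hnat n (q + (-(n : ℤ)) • x)
      have h2 : q + (-(n : ℤ)) • x + n • x = q := by simp
      rw [h2] at h1
      rw [h1]

instance : Countable periodLattice :=
  inferInstanceAs (Countable (Submodule.span ℤ (Set.range latticeBasis)))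

lemma fundamentalDomain_subset_box : ZSpan.fundamentalDomain latticeBasis ⊆ box := by
  intro q hq i
  have h := (ZSpan.mem_fundamentalDomain _).1 hq i
  rw [latticeBasis_repr] at h
  have hp : (0 : ℝ) < 2 * Real.pi := by positivity
  exact ⟨by simpa using (le_div_iff₀ hp).1 h.1, by simpa using ((div_lt_iff₀ hp).1 h.2).le⟩

lemma box_ae_eq_fundamentalDomain : box =ᵐ[volume] ZSpan.fundamentalDomain latticeBasis := by
  refine EventuallyLE.antisymm ?_ (Eventually.of_forall fundamentalDomain_subset_box)
  rw [ae_le_set]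
  have hsub : box \ ZSpan.fundamentalDomain latticeBasis ⊆
      ⋃ i : Fin 3, {q : E3 | q i = 2 * Real.pi} := by
    rintro q ⟨hq, hq'⟩
    by_contra hcon
    simp only [mem_iUnion, mem_ofPred_eq, not_exists] at hcon
    refine hq' ((ZSpan.mem_fundamentalDomain _).2 fun i => ?_)
    have hp : (0 : ℝ) < 2 * Real.pi := by positivity
    rw [latticeBasis_repr]
    exact ⟨div_nonneg (hq i).1 hp.le, (div_lt_one hp).2 (lt_of_le_of_ne (hq i).2 (hcon i))⟩
  refine measure_mono_null hsub (measure_iUnion_null fun i => ?_)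
  have h := (PiLp.volume_preserving_ofLp (Fin 3)).measure_preimage
    (s := {x : Fin 3 → ℝ | x i = 2 * Real.pi})
    (measurableSet_eq_fun (measurable_pi_apply i) measurable_const).nullMeasurableSet
  have h0 : (volume : Measure (Fin 3 → ℝ)) {x | x i = 2 * Real.pi} = 0 :=
    Measure.pi_hyperplane (fun _ : Fin 3 => (volume : Measure ℝ)) i (2 * Real.pi)
  rw [h0] at h
  exact h

/-- Every point is a lattice translate of a point of the box. -/
lemma exists_lattice_add_mem_box (q : E3) : ∃ g ∈ periodLattice, q + g ∈ box := by
  refine ⟨-(ZSpan.floor latticeBasis q : E3), neg_mem (ZSpan.floor latticeBasis q).2, ?_⟩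
  have := ZSpan.fract_mem_fundamentalDomain latticeBasis q
  rw [ZSpan.fract_apply, sub_eq_add_neg] at this
  exact fundamentalDomain_subset_box this

lemma box_eq_preimage : box = (EuclideanSpace.equiv (Fin 3) ℝ).toHomeomorph ⁻¹'
    (Set.pi univ fun _ : Fin 3 => Icc 0 (2 * Real.pi)) := by
  ext q
  simp only [box, Set.mem_preimage, Set.mem_univ_pi, Set.mem_ofPred_eq]
  rfl

lemma isCompact_box : IsCompact box := by
  rw [box_eq_preimage, Homeomorph.isCompact_preimage]
  exact isCompact_univ_pi fun _ => isCompact_Icc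

lemma measurableSet_box : MeasurableSet box := isCompact_box.measurableSet

lemma volume_box_lt_top : volume box < ⊤ := isCompact_box.measure_lt_top

instance : IsFiniteMeasure (volume.restrict box) := ⟨by
  rw [Measure.restrict_apply_univ]; exact volume_box_lt_top⟩

lemma volume_box_pos : 0 < volume.real box := by
  refine ENNReal.toReal_pos ?_ volume_box_lt_top.ne
  rw [measure_congr box_ae_eq_fundamentalDomain]
  exact ZSpan.measure_fundamentalDomain_ne_zero latticeBasis

lemma zero_mem_box : (0 : E3) ∈ box := fun i => by simp; positivity

lemma integrableOn_box {F : Type*} [NormedAddCommGroup F] {f : E3 → F} (hf : Continuous f) :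
    IntegrableOn f box :=
  hf.continuousOn.integrableOn_compact isCompact_box

/-- Invariance of the integral over the torus under measure-preserving maps of `ℝ³` that commute
with the period translations. -/
lemma setIntegral_box_comp {F : Type*} [NormedAddCommGroup F] [NormedSpace ℝ F] {f : E3 → F}
    (hf : Periodic3 f) {Y : E3 → E3} (hY : MeasurePreserving Y) (hYe : MeasurableEmbedding Y)
    (hYp : ∀ q i, Y (q + (2 * Real.pi) • basisVec i) = Y q + (2 * Real.pi) • basisVec i) :
    ∫ q in box, f (Y q) = ∫ q in box, f q := by
  have hD : IsAddFundamentalDomain periodLattice (ZSpan.fundamentalDomain latticeBasis)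
    (volume : Measure E3) := ZSpan.isAddFundamentalDomain' latticeBasis volume
  have hD' : IsAddFundamentalDomain periodLattice (Y ⁻¹' (ZSpan.fundamentalDomain latticeBasis))
      (volume : Measure E3) := by
    refine hD.preimage_of_equiv hY.quasiMeasurePreserving (e := id) Function.bijective_id ?_
    intro g q
    change Y ((g : E3) + q) = (g : E3) + Y q
    rw [add_comm, equivariant_lattice hYp g.2, add_comm]
  rw [setIntegral_congr_set box_ae_eq_fundamentalDomain,
    setIntegral_congr_set (f := f) box_ae_eq_fundamentalDomain]
  rw [← hY.setIntegral_preimage_emb hYe f]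
  refine hD.setIntegral_eq hD' (f := fun q => f (Y q)) fun g q => ?_
  change f (Y ((g : E3) + q)) = f (Y q)
  rw [add_comm, equivariant_lattice hYp g.2, hf.add_lattice g.2]

lemma setIntegral_box_add_right {F : Type*} [NormedAddCommGroup F] [NormedSpace ℝ F] {f : E3 → F}
    (hf : Periodic3 f) (h : E3) : ∫ q in box, f (q + h) = ∫ q in box, f q :=
  setIntegral_box_comp hf (measurePreserving_add_right volume h)
    (MeasurableEquiv.addRight h).measurableEmbedding (fun q i => by abel)

lemma Periodic3.exists_bound {F : Type*} [NormedAddCommGroup F] {f : E3 → F} (hf : Periodic3 f)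
    (hc : Continuous f) : ∃ M, 0 ≤ M ∧ ∀ q, ‖f q‖ ≤ M := by
  obtain ⟨M, hM⟩ := isCompact_box.exists_bound_of_continuousOn hc.continuousOn
  refine ⟨M, (norm_nonneg _).trans (hM 0 zero_mem_box), fun q => ?_⟩
  obtain ⟨g, hg, hq⟩ := exists_lattice_add_mem_box q
  rw [← hf.add_lattice hg]
  exact hM _ hq

lemma abs_integral_box_le {f : E3 → ℝ} {M : ℝ} (h : ∀ q, |f q| ≤ M) :
    |∫ q in box, f q| ≤ M * volume.real box := by
  simpa using norm_setIntegral_le_of_norm_le_const (f := f) volume_box_lt_top fun q _ => h q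

/-- Partial derivatives have zero mean over the torus. -/
lemma integral_pd_eq_zero {f : E3 → ℝ} (hf : ContDiff ℝ 1 f) (hp : Periodic3 f) (i : Fin 3) :
    ∫ q in box, pd i f q = 0 := by
  obtain ⟨M, -, hM⟩ := (hp.pd i).exists_bound (continuous_pd hf i)
  -- the mean over a translated torus does not depend on the translation; differentiate it
  have key := hasDerivAt_integral_of_dominated_loc_of_deriv_le (μ := volume.restrict box)
    (F := fun (h : ℝ) q => f (q + h • basisVec i))
    (F' := fun (h : ℝ) q => pd i f (q + h • basisVec i)) (x₀ := 0) (s := univ) (bound := fun _ => M)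
    univ_mem
    (Eventually.of_forall fun h => ((hf.continuous.comp (by fun_prop)).aestronglyMeasurable))
    (integrableOn_box (hf.continuous.comp (by fun_prop)))
    (((continuous_pd hf i).comp (by fun_prop)).aestronglyMeasurable)
    (Eventually.of_forall fun q h _ => hM _) (integrable_const _)
    (Eventually.of_forall fun q h _ => hasDerivAt_line (differentiable_of_contDiff_one hf) i q h)
  have h1 : (fun h : ℝ => ∫ q in box, f (q + h • basisVec i)) = fun _ => ∫ q in box, f q :=
    funext fun h => setIntegral_box_add_right hp _
  have h2 := key.2
  rw [h1] at h2
  simpa using h2.unique (hasDerivAt_const _ _)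

/-- Integration by parts on the torus. -/
lemma integral_mul_pd {f g : E3 → ℝ} (hf : ContDiff ℝ 1 f) (hfp : Periodic3 f)
    (hg : ContDiff ℝ 1 g) (hgp : Periodic3 g) (i : Fin 3) :
    ∫ q in box, f q * pd i g q = -∫ q in box, pd i f q * g q := by
  have h := integral_pd_eq_zero (hf.mul hg)
    (fun q j => by simp only [hfp q j, hgp q j]) i
  have h1 : ∀ q, pd i (fun x => f x * g x) q = f q * pd i g q + pd i f q * g q := fun q => by
    rw [mul_comm (pd i f q)]
    exact pd_mul (differentiable_of_contDiff_one hf) (differentiable_of_contDiff_one hg) i q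
  simp only [h1] at h
  rw [integral_add] at h
  · linarith
  · exact integrableOn_box (hf.continuous.mul (continuous_pd hg i))
  · exact integrableOn_box ((continuous_pd hf i).mul hg.continuous)

lemma Periodic3.eq_zero_of_ae {f : E3 → ℝ} (hp : Periodic3 f) (hf : Continuous f)
    (h : f =ᵐ[volume.restrict box] 0) : f = 0 := by
  have hb : box ⊆ closure (interior box) := by
    rw [box_eq_preimage, ← Homeomorph.preimage_interior, ← Homeomorph.preimage_closure]
    refine preimage_mono ?_
    rw [interior_pi_set finite_univ, closure_pi_set]
    refine Set.pi_mono fun i _ => ?_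
    rw [interior_Icc, closure_Ioo (by positivity)]
  have h2 : EqOn f 0 box :=
    Measure.eqOn_of_ae_eq (μ := volume) h hf.continuousOn continuousOn_const hb
  ext q
  obtain ⟨g, hg, hq⟩ := exists_lattice_add_mem_box q
  rw [← hp.add_lattice hg]
  exact h2 hq

lemma Periodic3.eq_zero_of_integral_sq {f : E3 → ℝ} (hp : Periodic3 f) (hf : Continuous f)
    (h : ∫ q in box, f q ^ 2 = 0) : f = 0 := by
  rw [integral_eq_zero_iff_of_nonneg (fun q => sq_nonneg _) (integrableOn_box (hf.pow 2))] at h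
  refine hp.eq_zero_of_ae hf (h.mono fun q hq => ?_)
  simpa using hq

/-! ### Hölder norms -/

lemma eHolderNorm_le_of_forall {γ C : ℝ≥0} {g : E3 → ℝ}
    (h : ∀ x y, |g x - g y| ≤ C * dist x y ^ (γ : ℝ)) : eHolderNorm γ g ≤ C := by
  refine HolderWith.eHolderNorm_le fun x y => ?_
  rw [edist_dist, edist_dist, Real.dist_eq, ← ENNReal.ofReal_coe_nnreal,
    ENNReal.ofReal_rpow_of_nonneg dist_nonneg γ.coe_nonneg, ← ENNReal.ofReal_mul C.coe_nonneg]
  exact ENNReal.ofReal_le_ofReal (h x y)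

lemma norm0_le_ofReal {γ : ℝ≥0} {g : E3 → ℝ} {M H : ℝ} (hM : ∀ x, |g x| ≤ M) (hH0 : 0 ≤ H)
    (hH : ∀ x y, |g x - g y| ≤ H * dist x y ^ (γ : ℝ)) : norm0 γ g ≤ ENNReal.ofReal (M + H) := by
  rw [norm0, ENNReal.ofReal_add ((abs_nonneg _).trans (hM 0)) hH0]
  refine add_le_add (iSup_le fun q => ?_) ?_
  · rw [Real.enorm_eq_ofReal_abs]
    exact ENNReal.ofReal_le_ofReal (hM q)
  · lift H to ℝ≥0 using hH0
    rw [ENNReal.ofReal_coe_nnreal]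
    exact eHolderNorm_le_of_forall hH

lemma norm0_bounds {γ : ℝ≥0} {g : E3 → ℝ} (h : norm0 γ g ≠ ⊤) :
    ∃ M H : ℝ, 0 ≤ M ∧ 0 ≤ H ∧ (∀ x, |g x| ≤ M) ∧
      (∀ x y, |g x - g y| ≤ H * dist x y ^ (γ : ℝ)) ∧ norm0 γ g = ENNReal.ofReal (M + H) := by
  obtain ⟨h1, h2⟩ := ENNReal.add_ne_top.1 h
  have hm := eHolderNorm_ne_top.1 h2
  refine ⟨(⨆ q, ‖g q‖ₑ).toReal, nnHolderNorm γ g, ENNReal.toReal_nonneg, NNReal.coe_nonneg _,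
    fun x => ?_, fun x y => ?_, ?_⟩
  · have := ENNReal.toReal_mono h1 (le_iSup (fun q => ‖g q‖ₑ) x)
    simpa using this
  · have := hm.holderWith.dist_le x y
    simpa [Real.dist_eq] using this
  · rw [ENNReal.ofReal_add ENNReal.toReal_nonneg (NNReal.coe_nonneg _), ENNReal.ofReal_toReal h1,
      ENNReal.ofReal_coe_nnreal, hm.coe_nnHolderNorm_eq_eHolderNorm]
    rfl

lemma enorm_le_norm0 (γ : ℝ≥0) (g : E3 → ℝ) (q : E3) : ‖g q‖ₑ ≤ norm0 γ g :=
  (le_iSup (fun q => ‖g q‖ₑ) q).trans le_self_add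

lemma abs_le_of_norm0_le {γ : ℝ≥0} {g : E3 → ℝ} {A : ℝ} (hA : 0 ≤ A)
    (h : norm0 γ g ≤ ENNReal.ofReal A) (q : E3) : |g q| ≤ A := by
  have := (enorm_le_norm0 γ g q).trans h
  rwa [Real.enorm_eq_ofReal_abs, ENNReal.ofReal_le_ofReal_iff hA] at this

lemma memHolder_of_norm0 {γ : ℝ≥0} {g : E3 → ℝ} (h : norm0 γ g ≠ ⊤) : MemHolder γ g :=
  eHolderNorm_ne_top.1 (ENNReal.add_ne_top.1 h).2

lemma continuous_of_norm0 {γ : ℝ≥0} (hγ : 0 < γ) {g : E3 → ℝ} (h : norm0 γ g ≠ ⊤) :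
    Continuous g := by
  obtain ⟨C, hC⟩ := memHolder_of_norm0 h
  exact hC.continuous hγ

lemma norm0_ne_top_of_memHolder {γ : ℝ≥0} (hγ : 0 < γ) {g : E3 → ℝ} (hg : Periodic3 g)
    (h : MemHolder γ g) : norm0 γ g ≠ ⊤ := by
  obtain ⟨C, hC⟩ := h
  obtain ⟨M, hM0, hM⟩ := hg.exists_bound (hC.continuous hγ)
  refine ne_top_of_le_ne_top ENNReal.ofReal_ne_top
    (norm0_le_ofReal (M := M) (H := C) (fun x => hM x) C.2 fun x y => ?_)
  simpa [Real.dist_eq] using hC.dist_le x y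

lemma norm0_add_le (γ : ℝ≥0) (f g : E3 → ℝ) :
    norm0 γ (fun q => f q + g q) ≤ norm0 γ f + norm0 γ g := by
  simp only [norm0]
  rw [add_add_add_comm]
  refine add_le_add (iSup_le fun q => ?_) eHolderNorm_add_le
  exact (enorm_add_le _ _).trans
    (add_le_add (le_iSup (fun q => ‖f q‖ₑ) q) (le_iSup (fun q => ‖g q‖ₑ) q))

lemma norm0_const_mul_le (γ : ℝ≥0) (c : ℝ) (f : E3 → ℝ) :
    norm0 γ (fun q => c * f q) ≤ ‖c‖ₑ * norm0 γ f := by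
  simp only [norm0, mul_add]
  refine add_le_add (iSup_le fun q => ?_) ?_
  · rw [enorm_mul]
    exact mul_le_mul_right (le_iSup (fun q => ‖f q‖ₑ) q) _
  · have h := eHolderNorm_smul (r := γ) (f := f) c
    have h2 : c • f = fun q => c * f q := rfl
    rw [h2] at h
    rw [h]
    rfl

lemma norm0_zero (γ : ℝ≥0) : norm0 γ (fun _ => (0 : ℝ)) = 0 := by
  have : eHolderNorm γ (fun _ : E3 => (0 : ℝ)) = 0 := eHolderNorm_const (X := E3) γ (0 : ℝ)
  simp [norm0, this]

lemma norm0_neg_le (γ : ℝ≥0) (f : E3 → ℝ) : norm0 γ (fun q => -f q) ≤ norm0 γ f := by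
  simpa using norm0_const_mul_le γ (-1) f

lemma norm0_sub_le (γ : ℝ≥0) (f g : E3 → ℝ) :
    norm0 γ (fun q => f q - g q) ≤ norm0 γ f + norm0 γ g := by
  simp only [sub_eq_add_neg]
  exact (norm0_add_le γ f fun q => -g q).trans (add_le_add_right (norm0_neg_le γ g) _)

lemma norm0_sum_le (γ : ℝ≥0) {ι : Type*} (s : Finset ι) (f : ι → E3 → ℝ) :
    norm0 γ (fun q => ∑ k ∈ s, f k q) ≤ ∑ k ∈ s, norm0 γ (f k) := by
  classical
  induction s using Finset.induction_on with
  | empty => simp [norm0_zero]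
  | insert a s ha ih =>
    simp only [Finset.sum_insert ha]
    exact (norm0_add_le γ _ _).trans (add_le_add_right ih _)

/-- The `C^{0,γ}` norm is submultiplicative. -/
lemma norm0_mul_le (γ : ℝ≥0) (f g : E3 → ℝ) :
    norm0 γ (fun q => f q * g q) ≤ norm0 γ f * norm0 γ g := by
  rcases eq_or_ne (norm0 γ f) 0 with hf0 | hf0
  · have : ∀ q, f q = 0 := fun q => by
      have := enorm_le_norm0 γ f q
      rw [hf0] at this
      simpa using this
    simp [this, norm0_zero]
  rcases eq_or_ne (norm0 γ g) 0 with hg0 | hg0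
  · have : ∀ q, g q = 0 := fun q => by
      have := enorm_le_norm0 γ g q
      rw [hg0] at this
      simpa using this
    simp [this, norm0_zero]
  rcases eq_or_ne (norm0 γ f) ⊤ with hf | hf
  · rw [hf, ENNReal.top_mul hg0]; exact le_top
  rcases eq_or_ne (norm0 γ g) ⊤ with hg | hg
  · rw [hg, ENNReal.mul_top hf0]; exact le_top
  obtain ⟨M, H, hM0, hH0, hM, hH, e1⟩ := norm0_bounds hf
  obtain ⟨M', H', hM0', hH0', hM', hH', e2⟩ := norm0_bounds hg
  rw [e1, e2, ← ENNReal.ofReal_mul (by positivity)]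
  refine (norm0_le_ofReal (M := M * M') (H := M * H' + M' * H) ?_ (by positivity) ?_).trans
    (ENNReal.ofReal_le_ofReal (by nlinarith [mul_nonneg hH0 hH0']))
  · intro x
    rw [abs_mul]
    exact mul_le_mul (hM x) (hM' x) (abs_nonneg _) hM0
  · intro x y
    have e : f x * g x - f y * g y = f x * (g x - g y) + g y * (f x - f y) := by ring
    rw [e]
    refine (abs_add_le _ _).trans ?_
    rw [abs_mul, abs_mul]
    have h1 := mul_le_mul (hM x) (hH' x y) (abs_nonneg _) hM0
    have h2 := mul_le_mul (hM' y) (hH x y) (abs_nonneg _) hM0'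
    nlinarith

/-- A bounded function with a Lipschitz bound is Hölder continuous. -/
lemma norm0_ne_top_of_lipschitz {γ : ℝ≥0} (hγ : γ < 1) {g : E3 → ℝ} {M L : ℝ}
    (hM : ∀ x, |g x| ≤ M) (hL0 : 0 ≤ L) (hL : ∀ x y, |g x - g y| ≤ L * dist x y) :
    norm0 γ g ≠ ⊤ := by
  have hM0 : 0 ≤ M := (abs_nonneg _).trans (hM 0)
  refine ne_top_of_le_ne_top ENNReal.ofReal_ne_top
    (norm0_le_ofReal (M := M) (H := L + 2 * M) hM (by positivity) fun x y => ?_)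
  rcases le_total (dist x y) 1 with h | h
  · refine (hL x y).trans ?_
    have h1 : dist x y ≤ dist x y ^ (γ : ℝ) := by
      simpa using Real.rpow_le_rpow_of_exponent_ge' dist_nonneg h γ.2
        (show (γ : ℝ) ≤ 1 by exact_mod_cast hγ.le)
    have : 0 ≤ dist x y ^ (γ : ℝ) := by positivity
    nlinarith
  · have h1 : 1 ≤ dist x y ^ (γ : ℝ) := Real.one_le_rpow h γ.2
    have h2 : |g x - g y| ≤ 2 * M := by
      refine (abs_sub _ _).trans ?_
      linarith [hM x, hM y]
    nlinarith

lemma Periodic3.exists_lipschitz {g : E3 → ℝ} (hg : Periodic3 g) (hc : ContDiff ℝ 1 g) :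
    ∃ L, 0 ≤ L ∧ ∀ x y, |g x - g y| ≤ L * dist x y := by
  have hp : Periodic3 (fderiv ℝ g) := by
    intro q j
    have : (fun x => g (x + (2 * Real.pi) • basisVec j)) = g := funext fun x => hg x j
    conv_rhs => rw [← this]
    rw [fderiv_comp_add_right]
  obtain ⟨L, hL0, hL⟩ := hp.exists_bound (hc.continuous_fderiv one_ne_zero)
  refine ⟨L, hL0, fun x y => ?_⟩
  have := convex_univ.norm_image_sub_le_of_norm_fderiv_le (𝕜 := ℝ) (f := g) (C := L)
    (fun x _ => hc.differentiable one_ne_zero x) (fun x _ => hL x) (mem_univ y) (mem_univ x)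
  simpa [dist_eq_norm] using this

lemma Periodic3.norm0_ne_top {γ : ℝ≥0} (hγ : γ < 1) {g : E3 → ℝ} (hg : Periodic3 g)
    (hc : ContDiff ℝ 1 g) : norm0 γ g ≠ ⊤ := by
  obtain ⟨L, hL0, hL⟩ := hg.exists_lipschitz hc
  obtain ⟨M, -, hM⟩ := hg.exists_bound hc.continuous
  exact norm0_ne_top_of_lipschitz hγ (fun x => hM x) hL0 hL

/-! ### Averages against dilated kernels -/

/-- A smooth compactly supported kernel on `ℝ³`. -/
structure IsKernel (κ : E3 → ℝ) : Prop where
  contDiff : ContDiff ℝ (⊤ : ℕ∞) κ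
  compact : HasCompactSupport κ

/-- The average of `g` against the kernel `κ` at the scale `r`. -/
def avg (κ : E3 → ℝ) (r : ℝ) (g : E3 → ℝ) (x : E3) : ℝ := ∫ z, κ z * g (x + r • z)

namespace IsKernel

variable {κ : E3 → ℝ}

lemma continuous (hκ : IsKernel κ) : Continuous κ := hκ.contDiff.continuous

lemma pd (hκ : IsKernel κ) (i : Fin 3) : IsKernel (pd i κ) where
  contDiff := (hκ.contDiff.fderiv_right (m := (⊤ : ℕ∞)) (by simp)).clm_apply contDiff_const
  compact := by
    have := hκ.compact.fderiv (𝕜 := ℝ)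
    exact this.comp_left (g := fun L : E3 →L[ℝ] ℝ => L (basisVec i)) rfl

lemma const_mul (hκ : IsKernel κ) (c : ℝ) : IsKernel (fun z => c * κ z) where
  contDiff := contDiff_const.mul hκ.contDiff
  compact := hκ.compact.mul_left

lemma integrable (hκ : IsKernel κ) : Integrable κ :=
  hκ.continuous.integrable_of_hasCompactSupport hκ.compact

lemma integrable_mul (hκ : IsKernel κ) {f : E3 → ℝ} (hf : Continuous f) :
    Integrable (fun z => κ z * f z) :=
  (hκ.continuous.mul hf).integrable_of_hasCompactSupport hκ.compact.mul_right

lemma integrable_abs_mul (hκ : IsKernel κ) {f : E3 → ℝ} (hf : Continuous f) :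
    Integrable (fun z => |κ z| * f z) :=
  (hκ.continuous.abs.mul hf).integrable_of_hasCompactSupport (hκ.compact.abs.mul_right)

end IsKernel

section avg

variable {κ : E3 → ℝ} {g : E3 → ℝ}

lemma abs_avg_le (hκ : IsKernel κ) {M : ℝ} (hM : ∀ x, |g x| ≤ M) (r : ℝ) (x : E3) :
    |avg κ r g x| ≤ (∫ z, |κ z|) * M := by
  have h := norm_integral_le_of_norm_le (μ := volume) (f := fun z => κ z * g (x + r • z))
    (g := fun z => |κ z| * M) (hκ.integrable.abs.mul_const M)
    (Eventually.of_forall fun z => by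
      rw [Real.norm_eq_abs, abs_mul]
      exact mul_le_mul_of_nonneg_left (hM _) (abs_nonneg _))
  rw [integral_mul_const] at h
  exact h

/-- Averages against a kernel of zero mean gain a power of the scale on Hölder functions. -/
lemma abs_avg_le_of_holder (hκ : IsKernel κ) (h0 : ∫ z, κ z = 0) {H : ℝ} {γ : ℝ≥0}
    (hg : Continuous g)
    (hH : ∀ x y, |g x - g y| ≤ H * dist x y ^ (γ : ℝ)) {r : ℝ} (hr : 0 ≤ r) (x : E3) :
    |avg κ r g x| ≤ (∫ z, |κ z| * ‖z‖ ^ (γ : ℝ)) * (H * r ^ (γ : ℝ)) := by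
  have e : avg κ r g x = ∫ z, κ z * (g (x + r • z) - g x) := by
    simp only [mul_sub]
    rw [integral_sub (hκ.integrable_mul (f := fun z => g (x + r • z)) (hg.comp (by fun_prop)))
      (hκ.integrable.mul_const _), integral_mul_const, h0]
    simp [avg]
  rw [e, ← integral_mul_const]
  refine norm_integral_le_of_norm_le (μ := volume) (f := fun z => κ z * (g (x + r • z) - g x))
    ((hκ.integrable_abs_mul (f := fun z => ‖z‖ ^ (γ : ℝ)) ?_).mul_const _)
    (Eventually.of_forall fun z => ?_)
  · exact continuous_norm.rpow_const fun _ => Or.inr γ.coe_nonneg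
  · rw [Real.norm_eq_abs, abs_mul, mul_assoc]
    refine mul_le_mul_of_nonneg_left ((hH _ _).trans (le_of_eq ?_)) (abs_nonneg _)
    rw [dist_eq_norm, add_sub_cancel_left, norm_smul, Real.norm_of_nonneg hr,
      Real.mul_rpow hr (norm_nonneg _)]
    ring

lemma avg_periodic (hp : Periodic3 g) (κ : E3 → ℝ) (r : ℝ) : Periodic3 (avg κ r g) := by
  intro q i
  simp only [avg]
  refine integral_congr_ae (Eventually.of_forall fun z => ?_)
  simp only
  rw [add_right_comm, hp]

lemma continuous_avg_uncurry (hκ : IsKernel κ) (hg : Continuous g) :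
    Continuous fun p : ℝ × E3 => avg κ p.1 g p.2 := by
  refine continuous_parametric_integral_of_continuous (μ := (volume : Measure E3))
    (f := fun (p : ℝ × E3) (z : E3) => κ z * g (p.2 + p.1 • z)) ?_ hκ.compact.isCompact |>.congr ?_
  · exact (hκ.continuous.comp continuous_snd).mul (hg.comp (by fun_prop))
  · intro p
    refine setIntegral_eq_integral_of_forall_compl_eq_zero fun z hz => ?_
    rw [image_eq_zero_of_notMem_tsupport hz, zero_mul]

lemma continuous_avg (hκ : IsKernel κ) (hg : Continuous g) (r : ℝ) :
    Continuous (avg κ r g) :=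
  (continuous_avg_uncurry hκ hg).comp (by fun_prop : Continuous fun x : E3 => (r, x))

lemma continuous_avg_scale (hκ : IsKernel κ) (hg : Continuous g) (x : E3) :
    Continuous fun r => avg κ r g x :=
  (continuous_avg_uncurry hκ hg).comp (by fun_prop : Continuous fun r : ℝ => (r, x))

lemma avg_zero_scale (κ : E3 → ℝ) (x : E3) : avg κ 0 g x = (∫ z, κ z) * g x := by
  simp [avg, integral_mul_const]

lemma avg_eq_integral (κ g : E3 → ℝ) {r : ℝ} (hr : 0 < r) (x : E3) :
    avg κ r g x = ∫ y, (r ^ 3)⁻¹ * κ (r⁻¹ • (y - x)) * g y := by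
  have h1 := Measure.integral_comp_smul (μ := (volume : Measure E3))
    (fun y => κ (r⁻¹ • y) * g (x + y)) r
  have h2 := integral_add_right_eq_self (μ := (volume : Measure E3))
    (fun y => (r ^ 3)⁻¹ * κ (r⁻¹ • (y - x)) * g y) x
  rw [← h2]
  simp only [smul_smul, inv_mul_cancel₀ hr.ne', one_smul] at h1
  rw [avg, h1]
  simp only [finrank_euclideanSpace, Fintype.card_fin, smul_eq_mul]
  rw [← integral_const_mul, abs_of_pos (by positivity)]
  refine integral_congr_ae (Eventually.of_forall fun y => ?_)
  simp only
  rw [add_sub_cancel_right, add_comm y x]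
  ring

lemma pd_comp_smul {f : E3 → ℝ} (hf : Differentiable ℝ f) (c : ℝ) (i : Fin 3) (x : E3) :
    pd i (fun x => f (c • x)) x = c * pd i f (c • x) := by
  have h : HasFDerivAt (fun x => f (c • x))
      ((fderiv ℝ f (c • x)).comp (c • ContinuousLinearMap.id ℝ E3)) x :=
    (hf (c • x)).hasFDerivAt.comp x ((hasFDerivAt_id x).const_smul c)
  rw [pd, h.fderiv]
  simp [pd]

/-- Averages of continuous functions are differentiable; the derivative falls on the kernel. -/
lemma hasFDerivAt_avg (hκ : IsKernel κ) (hg : Continuous g) {r : ℝ} (hr : 0 < r) (x : E3) :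
    HasFDerivAt (avg κ r g)
      (∑ i, (-(r⁻¹ * avg (pd i κ) r g x)) • (EuclideanSpace.proj i : E3 →L[ℝ] ℝ)) x := by
  set K : E3 → ℝ := fun w => (r ^ 3)⁻¹ * κ ((-r⁻¹) • w) with hK
  have hKd : ContDiff ℝ 1 K :=
    contDiff_const.mul ((hκ.contDiff.of_le (by simp)).comp (contDiff_const_smul _))
  have hKc : HasCompactSupport K := by
    refine HasCompactSupport.mul_left ?_
    exact hκ.compact.comp_smul (neg_ne_zero.2 (inv_ne_zero hr.ne'))
  have e : avg κ r g = (convolution g K (ContinuousLinearMap.mul ℝ ℝ) volume) := by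
    ext x
    rw [avg_eq_integral κ g hr, convolution]
    refine integral_congr_ae (Eventually.of_forall fun y => ?_)
    simp only [hK, ContinuousLinearMap.mul_apply']
    rw [show (-r⁻¹) • (x - y) = r⁻¹ • (y - x) by rw [neg_smul, ← smul_neg, neg_sub]]
    ring
  have h := hKc.hasFDerivAt_convolution_right (ContinuousLinearMap.mul ℝ ℝ)
    hg.locallyIntegrable (μ := volume) hKd x
  rw [e]
  refine h.congr_fderiv ?_
  ext v
  rw [convolution_precompR_apply (ContinuousLinearMap.mul ℝ ℝ) hg.locallyIntegrable
    (hKc.fderiv ℝ) (hKd.continuous_fderiv one_ne_zero)]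
  have hv : ∀ a, fderiv ℝ K a v = ∑ i, v i * pd i K a := fun a => fderiv_apply_eq_sum K a v
  have hpd : ∀ i a, pd i K a = (r ^ 3)⁻¹ * (-r⁻¹ * pd i κ ((-r⁻¹) • a)) := by
    intro i a
    have hd : Differentiable ℝ κ := hκ.contDiff.differentiable (by simp)
    have h1 := pd_mul (f := fun _ => (r ^ 3)⁻¹) (g := fun w => κ ((-r⁻¹) • w))
      (differentiable_const _) (hd.comp (by fun_prop)) i a
    rw [pd_const, mul_zero, add_zero, pd_comp_smul hd] at h1
    exact h1
  simp only [convolution, ContinuousLinearMap.mul_apply', hv, hpd, sum_apply,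
    smul_apply, smul_eq_mul, PiLp.proj_apply, Finset.mul_sum]
  rw [integral_finsetSum]
  · refine Finset.sum_congr rfl fun i _ => ?_
    rw [avg_eq_integral _ g hr, ← integral_const_mul, ← integral_neg, ← integral_mul_const]
    refine integral_congr_ae (Eventually.of_forall fun y => ?_)
    simp only
    rw [show (-r⁻¹) • (x - y) = r⁻¹ • (y - x) by rw [neg_smul, ← smul_neg, neg_sub]]
    ring
  · intro i _
    refine Continuous.integrable_of_hasCompactSupport ?_ ?_
    · have := (hκ.pd i).continuous
      fun_prop
    · have h1 : HasCompactSupport fun y => pd i κ ((-r⁻¹) • (x - y)) := by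
        have h2 := ((hκ.pd i).compact.comp_smul (neg_ne_zero.2 (inv_ne_zero hr.ne')))
        exact h2.comp_homeomorph (Homeomorph.subLeft x)
      exact ((h1.mul_left (f := fun _ => -r⁻¹)).mul_left (f := fun _ => (r ^ 3)⁻¹)).mul_left
        |>.mul_left

lemma pd_avg (hκ : IsKernel κ) (hg : Continuous g) {r : ℝ} (hr : 0 < r) (i : Fin 3) (x : E3) :
    pd i (avg κ r g) x = -(r⁻¹ * avg (pd i κ) r g x) :=
  pd_eq_of_hasFDerivAt (hasFDerivAt_avg hκ hg hr x) i

lemma contDiff_avg (n : ℕ) : ∀ {κ : E3 → ℝ}, IsKernel κ → Continuous g → ∀ {r : ℝ}, 0 < r →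
    ContDiff ℝ n (avg κ r g) := by
  induction n with
  | zero =>
    intro κ hκ hg r hr
    simpa using (continuous_avg hκ hg r)
  | succ n ih =>
    intro κ hκ hg r hr
    push_cast
    refine contDiff_succ_of_pd (fun x => (hasFDerivAt_avg hκ hg hr x).differentiableAt) fun i => ?_
    have : pd i (avg κ r g) = fun x => -(r⁻¹ * avg (pd i κ) r g x) :=
      funext fun x => pd_avg hκ hg hr i x
    rw [this]
    exact (contDiff_const.mul (ih (hκ.pd i) hg hr)).neg

lemma IsKernel.integral_pd (hκ : IsKernel κ) (i : Fin 3) : ∫ z, EulerLagrange.pd i κ z = 0 := by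
  have h := pd_avg (g := fun _ => 1) hκ continuous_const one_pos i 0
  have h1 : avg κ 1 (fun _ => 1) = fun _ => ∫ z, κ z := by
    ext x; simp [avg]
  rw [h1, pd_const] at h
  simpa [avg] using h

/-- The derivative of an average of a `C¹` function may also be put on the function. -/
lemma pd_avg_of_contDiff (hκ : IsKernel κ) (hg : ContDiff ℝ 1 g) (hp : Periodic3 g) {r : ℝ}
    (hr : 0 < r) (i : Fin 3) (x : E3) : pd i (avg κ r g) x = avg κ r (pd i g) x := by
  obtain ⟨M, -, hM⟩ := (hp.pd i).exists_bound (continuous_pd hg i)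
  have hd : Differentiable ℝ (avg κ r g) :=
    fun x => (hasFDerivAt_avg hκ hg.continuous hr x).differentiableAt
  have h1 := hasDerivAt_line hd i x 0
  have hc : ∀ h : ℝ, Continuous fun z : E3 => g (x + h • basisVec i + r • z) := fun h =>
    hg.continuous.comp (by fun_prop)
  have key := hasDerivAt_integral_of_dominated_loc_of_deriv_le (μ := (volume : Measure E3))
    (F := fun (h : ℝ) z => κ z * g (x + h • basisVec i + r • z))
    (F' := fun (h : ℝ) z => κ z * pd i g (x + r • z + h • basisVec i)) (x₀ := 0) (s := univ)
    (bound := fun z => |κ z| * M)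
    univ_mem
    (Eventually.of_forall fun h => (hκ.continuous.mul (hc h)).aestronglyMeasurable)
    (hκ.integrable_mul (hc 0))
    ((hκ.continuous.mul ((continuous_pd hg i).comp (by fun_prop))).aestronglyMeasurable)
    (Eventually.of_forall fun z h _ => by
      rw [Real.norm_eq_abs, abs_mul]
      exact mul_le_mul_of_nonneg_left (hM _) (abs_nonneg _))
    (hκ.integrable.abs.mul_const M)
    (Eventually.of_forall fun z h _ => by
      have := (hasDerivAt_line (differentiable_of_contDiff_one hg) i (x + r • z) h).const_mul (κ z)
      simpa only [add_right_comm x] using this)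
  have h2 := h1.unique key.2
  simpa [avg] using h2

lemma integral_avg (hκ : IsKernel κ) (hg : Continuous g) (hp : Periodic3 g) (r : ℝ) :
    ∫ x in box, avg κ r g x = (∫ z, κ z) * ∫ x in box, g x := by
  obtain ⟨M, hM0, hM⟩ := hp.exists_bound hg
  simp only [avg]
  rw [integral_integral_swap]
  · have : ∀ z, ∫ x in box, κ z * g (x + r • z) = κ z * ∫ x in box, g x := fun z => by
      rw [integral_const_mul, setIntegral_box_add_right hp]
    simp only [this, integral_mul_const]
  · refine Integrable.mono' (g := fun p : E3 × E3 => |κ p.2| * M) ?_ ?_ ?_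
    · exact (hκ.integrable.abs.mul_const M).comp_snd _
    · exact ((hκ.continuous.comp continuous_snd).mul
        (hg.comp (by fun_prop))).aestronglyMeasurable
    · refine Eventually.of_forall fun p => ?_
      simp only [Function.uncurry, Real.norm_eq_abs, abs_mul]
      exact mul_le_mul_of_nonneg_left (hM _) (abs_nonneg _)

/-- Derivative of an average with respect to the scale. -/
lemma hasDerivAt_avg_scale (hκ : IsKernel κ) (hg : Continuous g) {M : ℝ} (hM : ∀ x, |g x| ≤ M)
    {r : ℝ} (hr : 0 < r) (x : E3) :
    HasDerivAt (fun r => avg κ r g x)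
      (-(r⁻¹ * avg (fun z => 3 * κ z + fderiv ℝ κ z z) r g x)) r := by
  set σ : E3 → ℝ := fun z => 3 * κ z + fderiv ℝ κ z z with hσ
  have hd : Differentiable ℝ κ := hκ.contDiff.differentiable (by simp)
  have hM0 : 0 ≤ M := (abs_nonneg _).trans (hM 0)
  have hσc : Continuous σ := (continuous_const.mul hκ.continuous).add
    ((hκ.contDiff.continuous_fderiv (by simp)).clm_apply continuous_id)
  have hσs : HasCompactSupport σ := by
    refine (hκ.compact.mul_left).add ?_
    exact (hκ.compact.fderiv ℝ).mono fun z hz => by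
      simp only [Function.mem_support] at hz ⊢
      exact fun h0 => hz (by rw [h0]; rfl)
  obtain ⟨B, hB⟩ := hσc.bounded_above_of_compact_support hσs
  have hB0 : 0 ≤ B := (norm_nonneg _).trans (hB 0)
  obtain ⟨R, hR⟩ := hσs.isCompact.isBounded.subset_closedBall (0 : E3)
  have hderiv : ∀ y, ∀ s ∈ Ioo (r / 2) (2 * r),
      HasDerivAt (fun s => (s ^ 3)⁻¹ * κ (s⁻¹ • (y - x)) * g y)
        (-((s ^ 4)⁻¹ * σ (s⁻¹ • (y - x)) * g y)) s := by
    intro y s hs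
    have hs0 : s ≠ 0 := by have := hs.1; intro h; linarith
    have h1 : HasDerivAt (fun s : ℝ => s⁻¹ • (y - x)) (-(s ^ 2)⁻¹ • (y - x)) s :=
      (hasDerivAt_inv hs0).smul_const _
    have h2 : HasDerivAt (fun s : ℝ => (s ^ 3)⁻¹) (-(3 * s ^ 2) / (s ^ 3) ^ 2) s := by
      simpa using! (hasDerivAt_pow 3 s).inv (pow_ne_zero 3 hs0)
    have h3 := (h2.mul ((hd (s⁻¹ • (y - x))).hasFDerivAt.comp_hasDerivAt s h1)).mul_const (g y)
    refine h3.congr_deriv ?_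
    simp only [hσ, map_smul, smul_eq_mul, Function.comp]
    field_simp
    ring
  have hmem : Ioo (r / 2) (2 * r) ∈ 𝓝 r := Ioo_mem_nhds (by linarith) (by linarith)
  have hcont : ∀ s : ℝ, Continuous fun y => (s ^ 3)⁻¹ * κ (s⁻¹ • (y - x)) * g y := fun s => by
    have := hκ.continuous
    fun_prop
  have hint : Integrable fun y => (r ^ 3)⁻¹ * κ (r⁻¹ • (y - x)) * g y := by
    refine (hcont r).integrable_of_hasCompactSupport ?_
    have h2 := (hκ.compact.comp_smul (inv_ne_zero hr.ne')).comp_homeomorph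
      (Homeomorph.subRight x)
    exact HasCompactSupport.mul_right (HasCompactSupport.mul_left h2)
  have key := hasDerivAt_integral_of_dominated_loc_of_deriv_le (μ := (volume : Measure E3))
    (F := fun (s : ℝ) y => (s ^ 3)⁻¹ * κ (s⁻¹ • (y - x)) * g y)
    (F' := fun (s : ℝ) y => -((s ^ 4)⁻¹ * σ (s⁻¹ • (y - x)) * g y)) (x₀ := r)
    (s := Ioo (r / 2) (2 * r))
    (bound := (Metric.closedBall x (2 * r * |R|)).indicator fun _ => ((r / 2) ^ 4)⁻¹ * B * M)
    hmem
    (Eventually.of_forall fun s => (hcont s).aestronglyMeasurable)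
    hint
    (by
      have : Continuous fun y => -((r ^ 4)⁻¹ * σ (r⁻¹ • (y - x)) * g y) := by fun_prop
      exact this.aestronglyMeasurable)
    (Eventually.of_forall fun y s hs => by
      have hs0 : 0 < s := by linarith [hs.1]
      by_cases hy : y ∈ Metric.closedBall x (2 * r * |R|)
      · rw [indicator_of_mem hy, norm_neg, norm_mul, norm_mul]
        refine mul_le_mul (mul_le_mul ?_ (hB _) (norm_nonneg _) (by positivity)) (hM y)
          (norm_nonneg _) (by positivity)
        rw [Real.norm_of_nonneg (by positivity)]
        exact inv_anti₀ (by positivity) (pow_le_pow_left₀ (by positivity) hs.1.le 4)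
      · rw [indicator_of_notMem hy]
        have : σ (s⁻¹ • (y - x)) = 0 := by
          refine image_eq_zero_of_notMem_tsupport fun hmem => hy ?_
          have h1 := hR hmem
          rw [mem_closedBall_zero_iff, norm_smul, Real.norm_of_nonneg (by positivity),
            inv_mul_le_iff₀ hs0] at h1
          rw [Metric.mem_closedBall, dist_eq_norm]
          refine h1.trans ?_
          have := le_abs_self R
          have := abs_nonneg R
          nlinarith [hs.2]
        simp [this])
    ((integrable_indicator_iff Metric.isClosed_closedBall.measurableSet).2
      (integrableOn_const (isCompact_closedBall x _).measure_lt_top.ne))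
    (Eventually.of_forall fun y s hs => hderiv y s hs)
  have e1 : ∀ᶠ s in 𝓝 r, avg κ s g x = ∫ y, (s ^ 3)⁻¹ * κ (s⁻¹ • (y - x)) * g y := by
    filter_upwards [lt_mem_nhds hr] with s hs
    exact avg_eq_integral κ g hs x
  refine (key.2.congr_of_eventuallyEq e1).congr_deriv ?_
  rw [avg_eq_integral _ g hr, ← integral_const_mul, ← integral_neg]
  refine integral_congr_ae (Eventually.of_forall fun y => ?_)
  simp only
  field_simp

end avg

/-! ### A mollifier and the matching Newtonian kernel -/

/-- A smooth nonincreasing cutoff, equal to `1` on `(-∞, 129]` and to `0` on `[130, ∞)`. -/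
def cutoff (s : ℝ) : ℝ := Real.smoothTransition (130 - s)

/-- A quarter of the primitive of the cutoff that vanishes on `[130, ∞)`. -/
def cutoffPrimitive (s : ℝ) : ℝ := (1 / 4) * ∫ u in s..130, cutoff u

lemma contDiff_cutoff : ContDiff ℝ (⊤ : ℕ∞) cutoff :=
  Real.smoothTransition.contDiff.comp (contDiff_const.sub contDiff_id)

lemma hasDerivAt_cutoffPrimitive (s : ℝ) :
    HasDerivAt cutoffPrimitive (-(1 / 4) * cutoff s) s := by
  have hc := contDiff_cutoff.continuous
  have := (intervalIntegral.integral_hasDerivAt_left (a := s) (b := 130)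
    (hc.intervalIntegrable _ _) (hc.stronglyMeasurableAtFilter _ _)
    hc.continuousAt).const_mul (1 / 4)
  exact this.congr_deriv (by ring)

lemma contDiff_cutoffPrimitive : ContDiff ℝ (⊤ : ℕ∞) cutoffPrimitive := by
  rw [contDiff_infty_iff_deriv]
  refine ⟨fun s => (hasDerivAt_cutoffPrimitive s).differentiableAt, ?_⟩
  rw [show deriv cutoffPrimitive = fun s => -(1 / 4) * cutoff s from
    funext fun s => (hasDerivAt_cutoffPrimitive s).deriv]
  exact contDiff_const.mul contDiff_cutoff

lemma cutoff_eq_zero {s : ℝ} (hs : 130 ≤ s) : cutoff s = 0 :=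
  Real.smoothTransition.zero_of_nonpos (by linarith)

lemma cutoffPrimitive_eq_zero {s : ℝ} (hs : 130 ≤ s) : cutoffPrimitive s = 0 := by
  rw [cutoffPrimitive, intervalIntegral.integral_symm,
    intervalIntegral.integral_congr (g := fun _ => (0 : ℝ))]
  · simp
  · intro u hu
    rw [uIcc_of_le hs] at hu
    exact cutoff_eq_zero hu.1

lemma hasCompactSupport_radial {f : ℝ → ℝ} (hf : ∀ s, 130 ≤ s → f s = 0) :
    HasCompactSupport fun z : E3 => f (‖z‖ ^ 2) := by
  refine HasCompactSupport.of_support_subset_isCompact (isCompact_closedBall (0 : E3) 12) ?_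
  intro z hz
  by_contra hcon
  rw [mem_closedBall_zero_iff, not_le] at hcon
  exact hz (hf _ (by nlinarith))

lemma isKernel_radial {f : ℝ → ℝ} (hf : ContDiff ℝ (⊤ : ℕ∞) f) (h0 : ∀ s, 130 ≤ s → f s = 0) :
    IsKernel fun z : E3 => f (‖z‖ ^ 2) where
  contDiff := hf.comp (contDiff_norm_sq ℝ)
  compact := hasCompactSupport_radial h0

/-- The normalization of the mollifier. -/
def mollConst : ℝ := (∫ z : E3, cutoff (‖z‖ ^ 2))⁻¹

/-- A radial mollifier that is constant on the periodicity box. -/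
def moll (z : E3) : ℝ := mollConst * cutoff (‖z‖ ^ 2)

/-- The Newtonian counterpart of the mollifier: its gradient at `z` is `-z/2` times the mollifier,
so that the averages against it form, over all scales, a fundamental solution. -/
def newton (z : E3) : ℝ := mollConst * cutoffPrimitive (‖z‖ ^ 2)

lemma isKernel_moll : IsKernel moll :=
  (isKernel_radial contDiff_cutoff fun _ => cutoff_eq_zero).const_mul _

lemma isKernel_newton : IsKernel newton :=
  (isKernel_radial contDiff_cutoffPrimitive fun _ => cutoffPrimitive_eq_zero).const_mul _

lemma cutoff_eq_one {z : E3} (hz : z ∈ box) : cutoff (‖z‖ ^ 2) = 1 := by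
  refine Real.smoothTransition.one_of_one_le ?_
  rw [EuclideanSpace.norm_sq_eq]
  have hp : Real.pi ^ 2 ≤ 10 := by nlinarith [Real.pi_lt_d2, Real.pi_pos]
  have : ∀ i, ‖z i‖ ^ 2 ≤ 40 := fun i => by
    have h1 := (hz i).1
    have h2 := (hz i).2
    rw [Real.norm_of_nonneg h1]
    nlinarith
  have hs : ∑ i, ‖z i‖ ^ 2 ≤ ∑ _i : Fin 3, (40 : ℝ) := Finset.sum_le_sum fun i _ => this i
  simp at hs
  simp
  linarith

lemma integral_cutoff_ge : volume.real box ≤ ∫ z : E3, cutoff (‖z‖ ^ 2) := by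
  have hi := (isKernel_radial contDiff_cutoff fun _ => cutoff_eq_zero).integrable
  calc volume.real box = ∫ z in box, cutoff (‖z‖ ^ 2) := by
        rw [setIntegral_congr_fun measurableSet_box (g := fun _ => (1 : ℝ))
          (fun z hz => cutoff_eq_one hz)]
        simp
    _ ≤ _ := setIntegral_le_integral hi
        (Eventually.of_forall fun z => Real.smoothTransition.nonneg _)

lemma mollConst_pos : 0 < mollConst :=
  inv_pos.2 (volume_box_pos.trans_le integral_cutoff_ge)

lemma integral_moll : ∫ z, moll z = 1 := by
  simp only [moll]
  rw [integral_const_mul]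
  exact inv_mul_cancel₀ (volume_box_pos.trans_le integral_cutoff_ge).ne'

lemma pd_newton (i : Fin 3) (z : E3) : pd i newton z = -(1 / 2) * (z i * moll z) := by
  have h1 : HasFDerivAt (fun z : E3 => ‖z‖ ^ 2) (2 • innerSL ℝ z) z :=
    (hasStrictFDerivAt_norm_sq z).hasFDerivAt
  have h2 := ((hasDerivAt_cutoffPrimitive (‖z‖ ^ 2)).comp_hasFDerivAt z h1).const_mul mollConst
  have h3 : HasFDerivAt newton _ z := h2
  rw [pd, h3.fderiv]
  simp [basisVec, moll, EuclideanSpace.inner_single_right]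
  ring

lemma sum_pd_pd_newton (z : E3) :
    2 * ∑ i, pd i (pd i newton) z = -(3 * moll z + fderiv ℝ moll z z) := by
  have hm : Differentiable ℝ moll := isKernel_moll.contDiff.differentiable (by simp)
  have hz : ∀ i : Fin 3, Differentiable ℝ fun z : E3 => z i := fun i => by fun_prop
  have h : ∀ i, pd i (pd i newton) z = -(1 / 2) * (z i * pd i moll z + moll z) := by
    intro i
    rw [show pd i newton = fun z => -(1 / 2) * (z i * moll z) from funext (pd_newton i),
      pd_mul (g := fun z => z i * moll z) (differentiable_const _) ((hz i).mul hm), pd_const,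
      pd_mul (hz i) hm]
    have : pd i (fun z : E3 => z i) z = 1 := by
      have h4 := (EuclideanSpace.proj i : E3 →L[ℝ] ℝ).hasFDerivAt (x := z)
      have h5 : HasFDerivAt (fun z : E3 => z i) (EuclideanSpace.proj i : E3 →L[ℝ] ℝ) z := h4
      rw [pd, h5.fderiv]
      simp [basisVec]
    rw [this]
    ring
  rw [fderiv_apply_eq_sum]
  simp only [h, Fin.sum_univ_three]
  ring

/-! ### Inversion of `1 - P`, `P` the averaging operator at unit scale -/

/-- Averaging at unit scale is a strict contraction on the functions of zero mean, since the
mollifier is bounded below by a positive constant on the periodicity box. -/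
lemma exists_contraction : ∃ θ : ℝ, 0 ≤ θ ∧ θ < 1 ∧ ∀ (g : E3 → ℝ) (M : ℝ), Continuous g →
    Periodic3 g → ∫ q in box, g q = 0 → (∀ x, |g x| ≤ M) → ∀ x, |avg moll 1 g x| ≤ θ * M := by
  have hle : ∀ z, box.indicator (fun _ => mollConst) z ≤ moll z := by
    intro z
    by_cases hz : z ∈ box
    · rw [indicator_of_mem hz, moll, cutoff_eq_one hz, mul_one]
    · rw [indicator_of_notMem hz]
      exact mul_nonneg mollConst_pos.le (Real.smoothTransition.nonneg _)
  have hbi : Integrable (box.indicator fun _ => mollConst) :=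
    (integrable_indicator_iff measurableSet_box).2 (integrableOn_const volume_box_lt_top.ne)
  have hint : ∫ z, (moll z - box.indicator (fun _ => mollConst) z) =
      1 - mollConst * volume.real box := by
    rw [integral_sub isKernel_moll.integrable hbi, integral_moll,
      integral_indicator measurableSet_box]
    simp [mul_comm]
  refine ⟨1 - mollConst * volume.real box, ?_, ?_, ?_⟩
  · rw [← hint]
    exact integral_nonneg fun z => sub_nonneg.2 (hle z)
  · linarith [mul_pos mollConst_pos volume_box_pos]
  · intro g M hg hp h0 hM x
    have e : avg moll 1 g x =
        ∫ z, (moll z - box.indicator (fun _ => mollConst) z) * g (x + z) := by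
      have h1 : ∀ z, box.indicator (fun _ => mollConst) z * g (x + z) =
          box.indicator (fun z => mollConst * g (x + z)) z := fun z => by
        by_cases hz : z ∈ box <;> simp [hz]
      simp only [sub_mul, h1]
      rw [integral_sub, integral_indicator measurableSet_box, integral_const_mul]
      · have h2 := setIntegral_box_add_right hp x
        simp only [add_comm _ x] at h2
        rw [h2, h0]
        simp [avg]
      · exact isKernel_moll.integrable_mul (f := fun z => g (x + z)) (hg.comp (by fun_prop))
      · refine (integrable_indicator_iff measurableSet_box).2 (integrableOn_box ?_)
        exact continuous_const.mul (hg.comp (by fun_prop))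
    rw [e, ← hint, ← integral_mul_const]
    refine norm_integral_le_of_norm_le (μ := (volume : Measure E3))
      (f := fun z => (moll z - box.indicator (fun _ => mollConst) z) * g (x + z))
      ((isKernel_moll.integrable.sub hbi).mul_const M) (Eventually.of_forall fun z => ?_)
    rw [norm_mul, Real.norm_of_nonneg (sub_nonneg.2 (hle z))]
    exact mul_le_mul_of_nonneg_left (hM _) (sub_nonneg.2 (hle z))

lemma avg_sub {κ f g : E3 → ℝ} (hκ : IsKernel κ) (hf : Continuous f) (hg : Continuous g) (r : ℝ)
    (x : E3) : avg κ r (fun q => f q - g q) x = avg κ r f x - avg κ r g x := by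
  simp only [avg, mul_sub]
  exact integral_sub (hκ.integrable_mul (f := fun z => f (x + r • z)) (hf.comp (by fun_prop)))
    (hκ.integrable_mul (f := fun z => g (x + r • z)) (hg.comp (by fun_prop)))

/-- The Neumann series for `G - P G = g`, in Hölder spaces of functions of zero mean. -/
lemma exists_sub_avg_eq : ∃ C : ℝ, 0 ≤ C ∧ ∀ (γ : ℝ≥0) (g : E3 → ℝ) (M H : ℝ), 0 < γ →
    Periodic3 g → ∫ q in box, g q = 0 → (∀ x, |g x| ≤ M) →
    0 ≤ H → (∀ x y, |g x - g y| ≤ H * dist x y ^ (γ : ℝ)) →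
    ∃ G : E3 → ℝ, Periodic3 G ∧ (∀ x, |G x| ≤ C * M) ∧
      (∀ x y, |G x - G y| ≤ C * H * dist x y ^ (γ : ℝ)) ∧ ∀ x, G x - avg moll 1 G x = g x := by
  obtain ⟨θ, hθ0, hθ1, hθ⟩ := exists_contraction
  have hC : 0 ≤ (1 - θ)⁻¹ := inv_nonneg.2 (by linarith)
  refine ⟨(1 - θ)⁻¹, hC, fun γ g M H hγ hp h0 hM hH0 hH => ?_⟩
  have hM0 : 0 ≤ M := (abs_nonneg _).trans (hM 0)
  have hcont : ∀ {f : E3 → ℝ} {K : ℝ}, 0 ≤ K → (∀ x y, |f x - f y| ≤ K * dist x y ^ (γ : ℝ)) →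
      Continuous f := by
    intro f K hK hf
    lift K to ℝ≥0 using hK
    have : HolderWith K γ f := fun x y => by
      rw [edist_dist, edist_dist, Real.dist_eq, ← ENNReal.ofReal_coe_nnreal,
        ENNReal.ofReal_rpow_of_nonneg dist_nonneg γ.coe_nonneg,
        ← ENNReal.ofReal_mul K.coe_nonneg]
      exact ENNReal.ofReal_le_ofReal (hf x y)
    exact this.continuous hγ
  set It : ℕ → E3 → ℝ := fun n => (avg moll 1)^[n] g with hIt
  have hsucc : ∀ n, It (n + 1) = avg moll 1 (It n) := fun n => Function.iterate_succ_apply' _ _ _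
  have hP : ∀ n, Periodic3 (It n) ∧ ∫ q in box, It n q = 0 ∧ (∀ x, |It n x| ≤ θ ^ n * M) ∧
      ∀ x y, |It n x - It n y| ≤ θ ^ n * H * dist x y ^ (γ : ℝ) := by
    intro n
    induction n with
    | zero => exact ⟨hp, h0, by simpa [hIt] using hM, by simpa [hIt] using hH⟩
    | succ n ih =>
      obtain ⟨i1, i2, i3, i4⟩ := ih
      have ic : Continuous (It n) := hcont (by positivity) i4
      rw [hsucc]
      refine ⟨avg_periodic i1 _ _, ?_, ?_, ?_⟩
      · rw [integral_avg isKernel_moll ic i1, i2, mul_zero]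
      · intro x
        refine (hθ _ _ ic i1 i2 i3 x).trans (le_of_eq (by ring))
      · intro x y
        have ics : Continuous fun q => It n (q + (x - y)) := ic.comp (by fun_prop)
        have h1 := hθ (fun q => It n (q + (x - y)) - It n q)
          (θ ^ n * H * dist x y ^ (γ : ℝ)) (ics.sub ic)
          (fun q i => by
            have := i1.add_right (x - y) q i
            simp only at this ⊢
            rw [this, i1])
          (by
            rw [integral_sub (integrableOn_box ics) (integrableOn_box ic),
              setIntegral_box_add_right i1, sub_self])
          (fun q => by
            refine (i4 _ _).trans (le_of_eq ?_)
            rw [dist_eq_norm, dist_eq_norm, add_sub_cancel_left]) y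
        rw [avg_sub isKernel_moll ics ic] at h1
        have h2 : avg moll 1 (fun q => It n (q + (x - y))) y = avg moll 1 (It n) x := by
          simp only [avg]
          refine integral_congr_ae (Eventually.of_forall fun z => ?_)
          simp only
          congr 2
          abel
        rw [h2] at h1
        exact h1.trans (le_of_eq (by ring))
  have hgeo : ∀ a : ℝ, HasSum (fun n => θ ^ n * a) ((1 - θ)⁻¹ * a) := fun a =>
    (hasSum_geometric_of_lt_one hθ0 hθ1).mul_right a
  have hsum : ∀ x, Summable fun n => It n x := fun x =>
    Summable.of_norm_bounded (hgeo M).summable fun n => (hP n).2.2.1 x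
  refine ⟨fun x => ∑' n, It n x, ?_, ?_, ?_, ?_⟩
  · intro q i
    simp only
    congr 1
    ext n
    rw [(hP n).1]
  · intro x
    exact tsum_of_norm_bounded (f := fun n => It n x) (hgeo M) fun n => (hP n).2.2.1 x
  · intro x y
    rw [← (hsum x).tsum_sub (hsum y), mul_assoc]
    refine tsum_of_norm_bounded (f := fun n => It n x - It n y) (hgeo _) fun n => ?_
    rw [← mul_assoc]
    exact (hP n).2.2.2 x y
  · intro x
    have hc : ∀ n, Continuous (It n) := fun n => hcont (by positivity) (hP n).2.2.2
    have h1 : HasSum (fun n => ∫ z, moll z * It n (x + (1 : ℝ) • z))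
        (∫ z, ∑' n, moll z * It n (x + (1 : ℝ) • z)) := by
      refine hasSum_integral_of_summable_integral_norm
        (fun n => isKernel_moll.integrable_mul ((hc n).comp (by fun_prop))) ?_
      refine Summable.of_nonneg_of_le (fun n => integral_nonneg fun z => norm_nonneg _)
        (fun n => ?_) (hgeo ((∫ z, |moll z|) * M)).summable
      have : ∫ z, ‖moll z * It n (x + (1 : ℝ) • z)‖ ≤ ∫ z, |moll z| * (θ ^ n * M) := by
        refine integral_mono_of_nonneg (Eventually.of_forall fun z => norm_nonneg _)
          (isKernel_moll.integrable.abs.mul_const _) (Eventually.of_forall fun z => ?_)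
        simp only [norm_mul, Real.norm_eq_abs]
        exact mul_le_mul_of_nonneg_left ((hP n).2.2.1 _) (abs_nonneg _)
      rw [integral_mul_const] at this
      linarith
    have h2 : avg moll 1 (fun x => ∑' n, It n x) x = ∑' n, It (n + 1) x := by
      have : ∀ n, It (n + 1) x = ∫ z, moll z * It n (x + (1 : ℝ) • z) := fun n => by
        rw [hsucc]; rfl
      simp only [this, h1.tsum_eq, avg, tsum_mul_left]
    rw [h2]
    simp only
    rw [(hsum x).tsum_eq_zero_add]
    simp [hIt]

/-! ### The Newtonian potential -/

/-- Differentiation under the integral over the scales: the derivative falls on the kernel and costs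
a factor `r⁻¹`, so it is enough that the differentiated averages have an integrable majorant. -/
lemma hasFDerivAt_scaleIntegral {κ g : E3 → ℝ} (hκ : IsKernel κ) (hg : Continuous g) {w b : ℝ → ℝ}
    (hw : ContinuousOn w (Ioi 0)) (hb : IntervalIntegrable b volume 0 1)
    (hbd : ∀ r ∈ Ioc (0 : ℝ) 1, ∀ x i, |w r * (r⁻¹ * avg (pd i κ) r g x)| ≤ b r)
    (hint : ∀ x, IntervalIntegrable (fun r => w r * avg κ r g x) volume 0 1) (x : E3) :
    HasFDerivAt (fun x => ∫ r in (0 : ℝ)..1, w r * avg κ r g x)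
      (∑ i, (-∫ r in (0 : ℝ)..1, w r * (r⁻¹ * avg (pd i κ) r g x)) •
        (EuclideanSpace.proj i : E3 →L[ℝ] ℝ)) x := by
  have hmeas : ∀ f : ℝ → ℝ, Continuous f →
      AEStronglyMeasurable (fun r => w r * f r) (volume.restrict (uIoc 0 1)) := by
    intro f hf
    rw [uIoc_of_le zero_le_one]
    exact ((hw.mono Ioc_subset_Ioi_self).mul hf.continuousOn).aestronglyMeasurable
      measurableSet_Ioc
  have hmeas' : ∀ i, AEStronglyMeasurable (fun r => w r * (r⁻¹ * avg (pd i κ) r g x))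
      (volume.restrict (uIoc 0 1)) := by
    intro i
    rw [uIoc_of_le zero_le_one]
    refine ContinuousOn.aestronglyMeasurable ?_ measurableSet_Ioc
    refine (hw.mono Ioc_subset_Ioi_self).mul (ContinuousOn.mul ?_
      (continuous_avg_scale (hκ.pd i) hg x).continuousOn)
    exact continuousOn_inv₀.mono fun r hr => hr.1.ne'
  have hii : ∀ i, IntervalIntegrable (fun r => w r * (r⁻¹ * avg (pd i κ) r g x)) volume 0 1 := by
    intro i
    refine hb.mono_fun (hmeas' i) ?_
    rw [uIoc_of_le zero_le_one]
    filter_upwards [ae_restrict_mem measurableSet_Ioc] with r hr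
    exact (hbd r hr x i).trans (le_abs_self _)
  have key := intervalIntegral.hasFDerivAt_integral_of_dominated_of_fderiv_le (𝕜 := ℝ)
    (μ := volume) (a := (0 : ℝ)) (b := 1) (s := univ) (x₀ := x)
    (F := fun x r => w r * avg κ r g x)
    (F' := fun x r => ∑ i, (-(w r * (r⁻¹ * avg (pd i κ) r g x))) •
        (EuclideanSpace.proj i : E3 →L[ℝ] ℝ))
    (bound := fun r => b r * ∑ i : Fin 3, ‖(EuclideanSpace.proj i : E3 →L[ℝ] ℝ)‖)
    univ_mem
    (Eventually.of_forall fun x => hmeas _ (continuous_avg_scale hκ hg x))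
    (hint x)
    (by
      refine Finset.aestronglyMeasurable_fun_sum _ fun i _ => ?_
      exact (hmeas' i).neg.smul_const _)
    (Eventually.of_forall fun r hr x _ => by
      rw [uIoc_of_le zero_le_one] at hr
      rw [Finset.mul_sum]
      refine (norm_sum_le _ _).trans (Finset.sum_le_sum fun i _ => ?_)
      rw [norm_smul, norm_neg]
      exact mul_le_mul_of_nonneg_right (hbd r hr x i) (norm_nonneg _))
    (hb.mul_const _)
    (Eventually.of_forall fun r hr x _ => by
      rw [uIoc_of_le zero_le_one] at hr
      have := (hasFDerivAt_avg hκ hg hr.1 x).const_mul (w r)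
      refine this.congr_fderiv ?_
      rw [Finset.smul_sum]
      refine Finset.sum_congr rfl fun i _ => ?_
      rw [smul_smul]
      congr 1
      ring)
  refine key.congr_fderiv ?_
  rw [intervalIntegral.integral_finsetSum]
  · refine Finset.sum_congr rfl fun i _ => ?_
    rw [intervalIntegral.integral_smul_const, intervalIntegral.integral_neg]
  · intro i _
    exact ⟨(hii i).1.neg.smul_const _, (hii i).2.neg.smul_const _⟩

section singular

variable {κ : E3 → ℝ}

/-- The weight `r⁻¹` is not integrable over the scales in `(0, 1]`; against a Hölder function, the
kernel of zero mean supplies the missing power `r ^ γ`. -/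
lemma intervalIntegrable_inv_mul_avg (hκ : IsKernel κ) (h0 : ∫ z, κ z = 0) {γ : ℝ≥0} (hγ : 0 < γ)
    {g : E3 → ℝ} {H : ℝ} (hg : Continuous g)
    (hH : ∀ x y, |g x - g y| ≤ H * dist x y ^ (γ : ℝ)) (x : E3) :
    (∀ r ∈ Ioc (0 : ℝ) 1, |r⁻¹ * avg κ r g x| ≤
      (∫ z, |κ z| * ‖z‖ ^ (γ : ℝ)) * H * r ^ ((γ : ℝ) - 1)) ∧
    IntervalIntegrable (fun r => r⁻¹ * avg κ r g x) volume 0 1 := by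
  have h1 : ∀ r ∈ Ioc (0 : ℝ) 1, |r⁻¹ * avg κ r g x| ≤
      (∫ z, |κ z| * ‖z‖ ^ (γ : ℝ)) * H * r ^ ((γ : ℝ) - 1) := by
    intro r hr
    rw [abs_mul, abs_of_pos (inv_pos.2 hr.1), Real.rpow_sub_one hr.1.ne']
    have := mul_le_mul_of_nonneg_left (abs_avg_le_of_holder hκ h0 hg hH hr.1.le x)
      (inv_pos.2 hr.1).le
    exact this.trans (le_of_eq (by ring))
  refine ⟨h1, ?_⟩
  have hγ' : (0 : ℝ) < γ := by exact_mod_cast hγ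
  have hb : IntervalIntegrable
      (fun r => (∫ z, |κ z| * ‖z‖ ^ (γ : ℝ)) * H * r ^ ((γ : ℝ) - 1)) volume 0 1 :=
    (intervalIntegral.intervalIntegrable_rpow' (by linarith)).const_mul _
  refine hb.mono_fun ?_ ?_
  · rw [uIoc_of_le zero_le_one]
    refine ContinuousOn.aestronglyMeasurable ?_ measurableSet_Ioc
    exact ContinuousOn.mul (continuousOn_inv₀.mono fun r hr => hr.1.ne')
      (continuous_avg_scale hκ hg x).continuousOn
  · rw [uIoc_of_le zero_le_one]
    filter_upwards [ae_restrict_mem measurableSet_Ioc] with r hr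
    exact (h1 r hr).trans (le_abs_self _)

/-- Averages at the scale `r` are Lipschitz with a constant of order `r ^ (γ - 1)`, since the
derivatives of the kernel have zero mean. -/
lemma lipschitz_avg_of_holder (hκ : IsKernel κ) :
    ∃ B : ℝ → ℝ, (∀ γ, 0 ≤ B γ) ∧ ∀ (γ : ℝ≥0) (g : E3 → ℝ) (H : ℝ), Continuous g →
      (∀ x y, |g x - g y| ≤ H * dist x y ^ (γ : ℝ)) → ∀ r : ℝ, 0 < r → ∀ x y,
      |avg κ r g x - avg κ r g y| ≤ B γ * H * r ^ ((γ : ℝ) - 1) * dist x y := by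
  refine ⟨fun γ => ∑ i : Fin 3, (∫ z, |pd i κ z| * ‖z‖ ^ γ) *
    ‖(EuclideanSpace.proj i : E3 →L[ℝ] ℝ)‖, fun γ => ?_, fun γ g H hg hH r hr x y => ?_⟩
  · refine Finset.sum_nonneg fun i _ => mul_nonneg (integral_nonneg fun z => ?_) (norm_nonneg _)
    positivity
  · have h := convex_univ.norm_image_sub_le_of_norm_hasFDerivWithin_le (𝕜 := ℝ)
      (f := avg κ r g) (x := y) (y := x)
      (C := (∑ i : Fin 3, (∫ z, |pd i κ z| * ‖z‖ ^ (γ : ℝ)) *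
        ‖(EuclideanSpace.proj i : E3 →L[ℝ] ℝ)‖) * H * r ^ ((γ : ℝ) - 1))
      (fun x _ => (hasFDerivAt_avg hκ hg hr x).hasFDerivWithinAt)
      (fun x _ => by
        refine (norm_sum_le _ _).trans ?_
        rw [Finset.sum_mul, Finset.sum_mul]
        refine Finset.sum_le_sum fun i _ => ?_
        have h2 := abs_avg_le_of_holder (hκ.pd i) (hκ.integral_pd i) hg hH hr.le x
        rw [norm_smul, Real.norm_eq_abs, abs_neg, abs_mul, abs_of_pos (inv_pos.2 hr),
          Real.rpow_sub_one hr.ne']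
        have h3 := mul_le_mul_of_nonneg_right (mul_le_mul_of_nonneg_left h2 (inv_pos.2 hr).le)
          (norm_nonneg (EuclideanSpace.proj i : E3 →L[ℝ] ℝ))
        exact h3.trans (le_of_eq (by ring)))
      (mem_univ y) (mem_univ x)
    simpa [dist_eq_norm] using h

/-- The borderline singular integrals over the scales are bounded on Hölder spaces. -/
lemma exists_singular_bound (hκ : IsKernel κ) (h0 : ∫ z, κ z = 0) {γ : ℝ≥0} (hγ : 0 < γ)
    (hγ1 : γ < 1) : ∃ C : ℝ, 0 ≤ C ∧ ∀ (g : E3 → ℝ) (H : ℝ), Continuous g → 0 ≤ H →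
      (∀ x y, |g x - g y| ≤ H * dist x y ^ (γ : ℝ)) →
      (∀ x, |∫ r in (0 : ℝ)..1, r⁻¹ * avg κ r g x| ≤ C * H) ∧
      ∀ x y, |(∫ r in (0 : ℝ)..1, r⁻¹ * avg κ r g x) - ∫ r in (0 : ℝ)..1, r⁻¹ * avg κ r g y| ≤
        C * H * dist x y ^ (γ : ℝ) := by
  obtain ⟨B, hB0, hB⟩ := lipschitz_avg_of_holder hκ
  have hγ' : (0 : ℝ) < γ := by exact_mod_cast hγ
  have hγ1' : (γ : ℝ) < 1 := by exact_mod_cast hγ1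
  obtain ⟨A, hA⟩ : ∃ A : ℝ, A = ∫ z, |κ z| * ‖z‖ ^ (γ : ℝ) := ⟨_, rfl⟩
  have hA0 : 0 ≤ A := hA ▸ integral_nonneg fun z => by positivity
  refine ⟨2 * A / γ + B γ / (1 - γ), ?_, fun g H hg hH0 hH => ?_⟩
  · have := hB0 γ
    have : 0 < 1 - (γ : ℝ) := by linarith
    positivity
  have hb : ∀ a b : ℝ, IntervalIntegrable (fun r : ℝ => r ^ ((γ : ℝ) - 1)) volume a b :=
    fun a b => intervalIntegral.intervalIntegrable_rpow' (by linarith)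
  have hval : ∀ d : ℝ, 0 ≤ d → ∫ r in (0 : ℝ)..d, r ^ ((γ : ℝ) - 1) = d ^ (γ : ℝ) / γ := by
    intro d _
    rw [integral_rpow (Or.inl (by linarith)), sub_add_cancel, Real.zero_rpow hγ'.ne', sub_zero]
  have hBp := div_nonneg (hB0 γ) (by linarith : (0 : ℝ) ≤ 1 - γ)
  have hbound : ∀ x, |∫ r in (0 : ℝ)..1, r⁻¹ * avg κ r g x| ≤ A / γ * H := by
    intro x
    have h := intervalIntegral.norm_integral_le_of_norm_le (μ := volume)
      (f := fun r => r⁻¹ * avg κ r g x) zero_le_one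
      (Eventually.of_forall fun r hr =>
        (intervalIntegrable_inv_mul_avg hκ h0 hγ hg hH x).1 r hr) ((hb 0 1).const_mul _)
    rw [← hA] at h
    rw [intervalIntegral.integral_const_mul, hval 1 zero_le_one, Real.one_rpow] at h
    exact h.trans (le_of_eq (by ring))
  refine ⟨fun x => (hbound x).trans ?_, fun x y => ?_⟩
  · refine mul_le_mul_of_nonneg_right ?_ hH0
    have : A / γ ≤ 2 * A / γ := by
      rw [mul_div_assoc]
      have : 0 ≤ A / γ := by positivity
      linarith
    linarith
  rcases le_or_gt 1 (dist x y) with hd | hd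
  · refine (abs_sub _ _).trans ?_
    have h1 : 1 ≤ dist x y ^ (γ : ℝ) := Real.one_le_rpow hd γ.coe_nonneg
    have h2 := hbound x
    have h3 := hbound y
    have h4 : 0 ≤ B γ / (1 - γ) * H := mul_nonneg hBp hH0
    have h5 : 0 ≤ A / γ * H := by positivity
    have h6 : (2 * A / γ + B γ / (1 - γ)) * H = 2 * (A / γ * H) + B γ / (1 - γ) * H := by ring
    rw [h6]
    refine le_trans ?_ (mul_le_mul_of_nonneg_left h1 (by linarith))
    linarith
  rcases eq_or_lt_of_le (dist_nonneg (x := x) (y := y)) with hd0 | hd0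
  · rw [dist_eq_zero.1 hd0.symm]
    simp only [sub_self, abs_zero]
    have : 0 < 1 - (γ : ℝ) := by linarith
    have := hB0 γ
    positivity
  set d := dist x y with hdd
  have hix := (intervalIntegrable_inv_mul_avg hκ h0 hγ hg hH x).2
  have hiy := (intervalIntegrable_inv_mul_avg hκ h0 hγ hg hH y).2
  rw [← intervalIntegral.integral_sub hix hiy]
  have hi := hix.sub hiy
  have hsub1 : uIcc (0 : ℝ) d ⊆ uIcc 0 1 := by
    rw [uIcc_of_le hd0.le, uIcc_of_le zero_le_one]; exact Icc_subset_Icc_right hd.le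
  have hsub2 : uIcc d 1 ⊆ uIcc (0 : ℝ) 1 := by
    rw [uIcc_of_le hd.le, uIcc_of_le zero_le_one]; exact Icc_subset_Icc_left hd0.le
  -- split the scales at the distance of the two points
  rw [← intervalIntegral.integral_add_adjacent_intervals (hi.mono_set hsub1) (hi.mono_set hsub2)]
  refine (abs_add_le _ _).trans ?_
  have h1 : |∫ r in (0 : ℝ)..d, (r⁻¹ * avg κ r g x - r⁻¹ * avg κ r g y)| ≤
      2 * A * H * (d ^ (γ : ℝ) / γ) := by
    rw [← hval d hd0.le, ← intervalIntegral.integral_const_mul]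
    refine intervalIntegral.norm_integral_le_of_norm_le (μ := volume)
      (f := fun r => r⁻¹ * avg κ r g x - r⁻¹ * avg κ r g y) hd0.le
      (Eventually.of_forall fun r hr => ?_) ((hb 0 d).const_mul _)
    have hr' : r ∈ Ioc (0 : ℝ) 1 := ⟨hr.1, hr.2.trans hd.le⟩
    refine (norm_sub_le _ _).trans ?_
    have e1 := (intervalIntegrable_inv_mul_avg hκ h0 hγ hg hH x).1 r hr'
    have e2 := (intervalIntegrable_inv_mul_avg hκ h0 hγ hg hH y).1 r hr'
    rw [← hA] at e1 e2
    rw [Real.norm_eq_abs, Real.norm_eq_abs]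
    linarith
  have h2 : |∫ r in d..1, (r⁻¹ * avg κ r g x - r⁻¹ * avg κ r g y)| ≤
      B γ * H * d * (d ^ ((γ : ℝ) - 1) / (1 - γ)) := by
    have hnot : (0 : ℝ) ∉ uIcc d 1 := by
      rw [uIcc_of_le hd.le]; exact fun h => absurd h.1 (not_le.2 hd0)
    have hb2 : IntervalIntegrable (fun r : ℝ => B γ * H * d * r ^ ((γ : ℝ) - 2)) volume d 1 :=
      (intervalIntegral.intervalIntegrable_rpow (Or.inr hnot)).const_mul _
    have h3 : ∫ r in d..1, r ^ ((γ : ℝ) - 2) ≤ d ^ ((γ : ℝ) - 1) / (1 - γ) := by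
      rw [integral_rpow (Or.inr ⟨by linarith, hnot⟩), show (γ : ℝ) - 2 + 1 = γ - 1 by ring,
        Real.one_rpow, ← neg_div_neg_eq, neg_sub, neg_sub]
      exact div_le_div_of_nonneg_right (by linarith) (by linarith)
    have h4 : |∫ r in d..1, (r⁻¹ * avg κ r g x - r⁻¹ * avg κ r g y)| ≤
        ∫ r in d..1, B γ * H * d * r ^ ((γ : ℝ) - 2) := by
      refine intervalIntegral.norm_integral_le_of_norm_le (μ := volume)
        (f := fun r => r⁻¹ * avg κ r g x - r⁻¹ * avg κ r g y) hd.le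
        (Eventually.of_forall fun r hr => ?_) hb2
      have hr0 : 0 < r := hd0.trans hr.1
      have e := hB γ g H hg hH r hr0 x y
      rw [← mul_sub, norm_mul, Real.norm_of_nonneg (inv_pos.2 hr0).le,
        show (γ : ℝ) - 2 = γ - 1 - 1 by ring, Real.rpow_sub_one hr0.ne' (γ - 1)]
      exact (mul_le_mul_of_nonneg_left e (inv_pos.2 hr0).le).trans (le_of_eq (by ring))
    refine h4.trans ?_
    rw [intervalIntegral.integral_const_mul]
    exact mul_le_mul_of_nonneg_left h3 (mul_nonneg (mul_nonneg (hB0 γ) hH0) hd0.le)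
  refine (add_le_add h1 h2).trans (le_of_eq ?_)
  rw [Real.rpow_sub_one hd0.ne']
  field_simp

end singular

/-- Superposition of the averages against the Newtonian kernel over the scales in `[0, 1]`. -/
def potential (g : E3 → ℝ) (x : E3) : ℝ := 2 * ∫ r in (0 : ℝ)..1, r * avg newton r g x

section potential

variable {g : E3 → ℝ} {γ : ℝ≥0} {M H : ℝ}

lemma hasFDerivAt_potential (hg : Continuous g) (hM : ∀ x, |g x| ≤ M) (x : E3) :
    HasFDerivAt (potential g)
      (∑ i, (-(2 * ∫ r in (0 : ℝ)..1, 1 * avg (pd i newton) r g x)) •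
        (EuclideanSpace.proj i : E3 →L[ℝ] ℝ)) x := by
  have hM0 : 0 ≤ M := (abs_nonneg _).trans (hM 0)
  have h := hasFDerivAt_scaleIntegral (w := fun r => r)
    (b := fun _ => ∑ i, (∫ z, |pd i newton z|) * M) isKernel_newton hg
    continuousOn_id intervalIntegrable_const (fun r hr x i => by
      rw [mul_inv_cancel_left₀ hr.1.ne']
      refine (abs_avg_le (isKernel_newton.pd i) hM r x).trans ?_
      refine Finset.single_le_sum (f := fun i => (∫ z, |pd i newton z|) * M) (fun i _ => ?_)
        (Finset.mem_univ i)
      exact mul_nonneg (integral_nonneg fun z => abs_nonneg _) hM0)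
    (fun x => (continuous_id.mul (continuous_avg_scale isKernel_newton hg x)).intervalIntegrable
      _ _) x
  refine (h.const_mul 2).congr_fderiv ?_
  rw [Finset.smul_sum]
  refine Finset.sum_congr rfl fun i _ => ?_
  rw [smul_smul]
  congr 1
  rw [mul_neg]
  congr 2
  refine intervalIntegral.integral_congr_ae (Eventually.of_forall fun r hr => ?_)
  rw [uIoc_of_le zero_le_one] at hr
  rw [mul_inv_cancel_left₀ hr.1.ne', one_mul]

lemma hasFDerivAt_pd_potential (hγ : 0 < γ) (hg : Continuous g) (hM : ∀ x, |g x| ≤ M)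
    (hH : ∀ x y, |g x - g y| ≤ H * dist x y ^ (γ : ℝ)) (j : Fin 3) (x : E3) :
    HasFDerivAt (pd j (potential g))
      (∑ i, (2 * ∫ r in (0 : ℝ)..1, r⁻¹ * avg (pd i (pd j newton)) r g x) •
        (EuclideanSpace.proj i : E3 →L[ℝ] ℝ)) x := by
  have e : pd j (potential g) =
      fun x => -2 * ∫ r in (0 : ℝ)..1, 1 * avg (pd j newton) r g x := by
    ext x
    rw [pd_eq_of_hasFDerivAt (hasFDerivAt_potential hg hM x)]
    ring
  have hk := isKernel_newton.pd j
  have hγ' : (0 : ℝ) < γ := by exact_mod_cast hγ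
  rw [e]
  have hH0 : 0 ≤ H := by
    have := (abs_nonneg _).trans (hH 0 (basisVec 0))
    have hd : dist (0 : E3) (basisVec 0) = 1 := by simp [basisVec]
    rw [hd, Real.one_rpow, mul_one] at this
    exact this
  have h := hasFDerivAt_scaleIntegral (w := fun _ => 1)
    (b := fun r => (∑ i, (∫ z, |pd i (pd j newton) z| * ‖z‖ ^ (γ : ℝ)) * H) * r ^ ((γ : ℝ) - 1))
    hk hg continuousOn_const
    ((intervalIntegral.intervalIntegrable_rpow' (by linarith)).const_mul _) (fun r hr x i => by
      rw [one_mul]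
      refine ((intervalIntegrable_inv_mul_avg (hk.pd i) (hk.integral_pd i) hγ hg hH x).1 r
        hr).trans ?_
      refine mul_le_mul_of_nonneg_right ?_ (Real.rpow_nonneg hr.1.le _)
      refine Finset.single_le_sum
        (f := fun i => (∫ z, |pd i (pd j newton) z| * ‖z‖ ^ (γ : ℝ)) * H) (fun i _ => ?_)
        (Finset.mem_univ i)
      exact mul_nonneg (integral_nonneg fun z => by positivity) hH0)
    (fun x => (continuous_const.mul (continuous_avg_scale hk hg x)).intervalIntegrable _ _) x
  refine (h.const_mul (-2)).congr_fderiv ?_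
  rw [Finset.smul_sum]
  refine Finset.sum_congr rfl fun i _ => ?_
  rw [smul_smul]
  congr 1
  simp

lemma pd_pd_potential (hγ : 0 < γ) (hg : Continuous g) (hM : ∀ x, |g x| ≤ M)
    (hH : ∀ x y, |g x - g y| ≤ H * dist x y ^ (γ : ℝ)) (i j : Fin 3) (x : E3) :
    pd i (pd j (potential g)) x = 2 * ∫ r in (0 : ℝ)..1, r⁻¹ * avg (pd i (pd j newton)) r g x :=
  pd_eq_of_hasFDerivAt (hasFDerivAt_pd_potential hγ hg hM hH j x) i

lemma avg_sum_kernel {ι : Type*} (s : Finset ι) {κ : ι → E3 → ℝ} (hκ : ∀ i ∈ s, IsKernel (κ i))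
    (hg : Continuous g) (r : ℝ) (x : E3) :
    avg (fun z => ∑ i ∈ s, κ i z) r g x = ∑ i ∈ s, avg (κ i) r g x := by
  simp only [avg, Finset.sum_mul]
  exact integral_finsetSum _ fun i hi => (hκ i hi).integrable_mul
    (f := fun z => g (x + r • z)) (hg.comp (by fun_prop))

/-- Up to the mollification at unit scale, the potential inverts the Laplacian. -/
lemma laplacian_potential (hγ : 0 < γ) (hg : Continuous g) (hM : ∀ x, |g x| ≤ M)
    (hH : ∀ x y, |g x - g y| ≤ H * dist x y ^ (γ : ℝ)) (x : E3) :
    laplacian (potential g) x = avg moll 1 g x - g x := by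
  have hk : ∀ i, IsKernel (pd i (pd i newton)) := fun i => (isKernel_newton.pd i).pd i
  have hint : ∀ i, IntervalIntegrable (fun r => r⁻¹ * avg (pd i (pd i newton)) r g x) volume 0 1 :=
    fun i => (intervalIntegrable_inv_mul_avg (hk i) ((isKernel_newton.pd i).integral_pd i) hγ hg hH
      x).2
  have hlap : laplacian (potential g) x =
      ∫ r in (0 : ℝ)..1, 2 * ∑ i, r⁻¹ * avg (pd i (pd i newton)) r g x := by
    rw [intervalIntegral.integral_const_mul, intervalIntegral.integral_finsetSum fun i _ => hint i,
      laplacian, Finset.mul_sum]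
    exact Finset.sum_congr rfl fun i _ => pd_pd_potential hγ hg hM hH i i x
  have hderiv : ∀ r ∈ Ioo (0 : ℝ) 1, HasDerivAt (fun r => avg moll r g x)
      (2 * ∑ i, r⁻¹ * avg (pd i (pd i newton)) r g x) r := by
    intro r hr
    refine (hasDerivAt_avg_scale isKernel_moll hg hM hr.1 x).congr_deriv ?_
    have e : (fun z => 3 * moll z + fderiv ℝ moll z z) =
        fun z => (-2) * ∑ i, pd i (pd i newton) z := funext fun z => by
      have := sum_pd_pd_newton z
      linarith
    have e2 : avg (fun z => (-2) * ∑ i, pd i (pd i newton) z) r g x =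
        -2 * avg (fun z => ∑ i, pd i (pd i newton) z) r g x := by
      simp only [avg, mul_assoc]
      exact integral_const_mul _ _
    rw [e, e2, avg_sum_kernel _ (fun i _ => hk i) hg, ← Finset.mul_sum]
    ring
  rw [hlap, intervalIntegral.integral_eq_sub_of_hasDerivAt_of_le zero_le_one
    (continuous_avg_scale isKernel_moll hg x).continuousOn hderiv, avg_zero_scale, integral_moll,
    one_mul]
  have := IntervalIntegrable.sum Finset.univ (f := fun i r => r⁻¹ * avg (pd i (pd i newton)) r g x)
    fun i _ => hint i
  refine IntervalIntegrable.const_mul ?_ 2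
  exact this

lemma potential_periodic (hp : Periodic3 g) : Periodic3 (potential g) := by
  intro q i
  simp only [potential]
  congr 2
  ext r
  rw [avg_periodic hp]

end potential

/-! ### The Poisson equation and Schauder constants -/

/-- Solvability of the Poisson equation on the torus, with the Schauder estimate. -/
lemma exists_poisson {γ : ℝ≥0} (hγ : 0 < γ) (hγ1 : γ < 1) : ∃ C : ℝ≥0, ∀ g : E3 → ℝ,
    Periodic3 g → norm0 γ g ≠ ⊤ → ∫ q in box, g q = 0 →
    ∃ φ : E3 → ℝ, IsC2Holder γ φ ∧ ∫ q in box, φ q = 0 ∧ (∀ x, laplacian φ x = g x) ∧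
      ∀ i j, norm0 γ (pd i (pd j φ)) ≤ C * norm0 γ g := by
  obtain ⟨C₁, hC₁, hG⟩ := exists_sub_avg_eq
  have hk : ∀ i j, IsKernel (pd i (pd j newton)) := fun i j => (isKernel_newton.pd j).pd i
  choose C₂ hC₂ hS using fun i j =>
    exists_singular_bound (hk i j) ((isKernel_newton.pd j).integral_pd i) hγ hγ1
  set D : ℝ := ∑ i, ∑ j, C₂ i j with hD
  have hD0 : 0 ≤ D := Finset.sum_nonneg fun i _ => Finset.sum_nonneg fun j _ => hC₂ i j
  have hle : ∀ i j, C₂ i j ≤ D := fun i j =>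
    (Finset.single_le_sum (f := fun j => C₂ i j) (fun j _ => hC₂ i j) (Finset.mem_univ j)).trans
      (Finset.single_le_sum (f := fun i => ∑ j, C₂ i j)
        (fun i _ => Finset.sum_nonneg fun j _ => hC₂ i j) (Finset.mem_univ i))
  refine ⟨(4 * D * C₁).toNNReal, fun g hp hn h0 => ?_⟩
  obtain ⟨M, H, hM0, hH0, hM, hH, hnorm⟩ := norm0_bounds hn
  obtain ⟨G, hGp, hGM, hGH, hGeq⟩ := hG γ g M H hγ hp h0 hM hH0 hH
  have hGn : norm0 γ G ≠ ⊤ := ne_top_of_le_ne_top ENNReal.ofReal_ne_top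
    (norm0_le_ofReal hGM (by positivity) hGH)
  have hGc := continuous_of_norm0 hγ hGn
  set c : ℝ := (volume.real box)⁻¹ * ∫ q in box, potential G q with hc
  have hd1 : Differentiable ℝ (potential G) :=
    fun x => (hasFDerivAt_potential hGc hGM x).differentiableAt
  have hd2 : ∀ j, Differentiable ℝ (pd j (potential G)) :=
    fun j x => (hasFDerivAt_pd_potential hγ hGc hGM hGH j x).differentiableAt
  have e1 : ∀ i, pd i (fun x => c - potential G x) = fun x => -pd i (potential G) x := fun i => by
    ext x
    rw [pd_sub (differentiable_const c) hd1, pd_const, zero_sub]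
  have e2 : ∀ i j, pd i (pd j fun x => c - potential G x) =
      fun x => -(2 * ∫ r in (0 : ℝ)..1, r⁻¹ * avg (pd i (pd j newton)) r G x) := fun i j => by
    ext x
    rw [e1, pd_neg, pd_pd_potential hγ hGc hGM hGH]
  have hest : ∀ i j, norm0 γ (pd i (pd j fun x => c - potential G x)) ≤
      ENNReal.ofReal (4 * D * C₁ * H) := by
    intro i j
    obtain ⟨s1, s2⟩ := hS i j G (C₁ * H) hGc (by positivity) hGH
    have h3 : C₂ i j * (C₁ * H) ≤ D * C₁ * H := by
      rw [mul_assoc]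
      exact mul_le_mul_of_nonneg_right (hle i j) (by positivity)
    refine (norm0_le_ofReal (M := 2 * D * C₁ * H) (H := 2 * D * C₁ * H) ?_ (by positivity)
      ?_).trans (ENNReal.ofReal_le_ofReal (by linarith))
    · intro x
      rw [e2, abs_neg, abs_mul, abs_two]
      linarith [s1 x]
    · intro x y
      rw [e2]
      simp only
      rw [neg_sub_neg, ← mul_sub, abs_mul, abs_two, abs_sub_comm]
      have h4 : 0 ≤ dist x y ^ (γ : ℝ) := by positivity
      have h5 := mul_le_mul_of_nonneg_right h3 h4
      linarith [s2 x y]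
  have hpp : Periodic3 fun x => c - potential G x := fun q i => by
    simp only
    rw [potential_periodic hGp]
  have hcd : ContDiff ℝ 2 fun x => c - potential G x := by
    have : ContDiff ℝ ((1 : ℕ) + 1) fun x => c - potential G x := by
      refine contDiff_succ_of_pd ((differentiable_const c).sub hd1) fun i => ?_
      have h1 : ContDiff ℝ ((0 : ℕ) + 1) (pd i fun x => c - potential G x) := by
        refine contDiff_succ_of_pd ?_ fun j => ?_
        · rw [e1]; exact (hd2 i).neg
        · have := continuous_of_norm0 hγ (ne_top_of_le_ne_top ENNReal.ofReal_ne_top (hest j i))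
          simpa using this
      simpa using h1
    simpa [one_add_one_eq_two] using this
  refine ⟨fun x => c - potential G x, ⟨hpp, hcd, fun i j => memHolder_of_norm0
    (ne_top_of_le_ne_top ENNReal.ofReal_ne_top (hest i j))⟩, ?_, ?_, ?_⟩
  · rw [integral_sub (integrableOn_box continuous_const) (integrableOn_box hd1.continuous)]
    have hv := volume_box_pos.ne'
    simp [hc]
    field_simp
    simp
  · intro x
    have h1 : laplacian (fun x => c - potential G x) x = -laplacian (potential G) x := by
      simp only [laplacian, ← Finset.sum_neg_distrib]
      refine Finset.sum_congr rfl fun i _ => ?_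
      rw [e1, pd_neg]
    rw [h1, laplacian_potential hγ hGc hGM hGH, neg_sub, hGeq]
  · intro i j
    refine (hest i j).trans ?_
    change _ ≤ ENNReal.ofReal _ * _
    rw [hnorm, ← ENNReal.ofReal_mul (by positivity)]
    refine ENNReal.ofReal_le_ofReal ?_
    exact mul_le_mul_of_nonneg_left (by linarith) (by positivity)

/-- A periodic harmonic function of class `C²` has vanishing gradient. -/
lemma pd_eq_zero_of_harmonic {φ : E3 → ℝ} (hp : Periodic3 φ) (hφ : ContDiff ℝ 2 φ)
    (h : ∀ x, laplacian φ x = 0) (i : Fin 3) (x : E3) : pd i φ x = 0 := by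
  have h1 : ContDiff ℝ 1 φ := hφ.of_le (by norm_num)
  have hi : ∀ i, ∫ q in box, pd i φ q * pd i φ q = -∫ q in box, φ q * pd i (pd i φ) q :=
    fun i => by
      rw [integral_mul_pd h1 hp (contDiff_pd hφ i) (hp.pd i), neg_neg]
  have hs : ∑ i, ∫ q in box, pd i φ q * pd i φ q = 0 := by
    simp only [hi, Finset.sum_neg_distrib]
    rw [← integral_finsetSum]
    · simp only [← Finset.mul_sum]
      have : ∀ q, φ q * ∑ i, pd i (pd i φ) q = 0 := fun q => by
        have := h q
        rw [laplacian] at this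
        rw [this, mul_zero]
      simp [this]
    · intro i _
      exact integrableOn_box (h1.continuous.mul (continuous_pd (contDiff_pd hφ i) i))
  have h0 := (Finset.sum_eq_zero_iff_of_nonneg
    (fun i _ => integral_nonneg fun q => mul_self_nonneg _)).1 hs i (Finset.mem_univ i)
  simp only [← sq] at h0
  exact congrFun ((hp.pd i).eq_zero_of_integral_sq (continuous_pd h1 i) h0) x

lemma continuous_laplacian {φ : E3 → ℝ} (hφ : ContDiff ℝ 2 φ) : Continuous (laplacian φ) :=
  continuous_finsetSum _ fun i _ => continuous_pd (contDiff_pd hφ i) i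

lemma Periodic3.laplacian {φ : E3 → ℝ} (hp : Periodic3 φ) : Periodic3 (laplacian φ) :=
  fun q i => Finset.sum_congr rfl fun j _ => (hp.pd j).pd j q i

lemma integral_laplacian {φ : E3 → ℝ} (hp : Periodic3 φ) (hφ : ContDiff ℝ 2 φ) :
    ∫ q in box, laplacian φ q = 0 := by
  simp only [EulerLagrange.laplacian]
  rw [integral_finsetSum _ fun i _ => integrableOn_box (continuous_pd (contDiff_pd hφ i) i)]
  exact Finset.sum_eq_zero fun i _ => integral_pd_eq_zero (contDiff_pd hφ i) (hp.pd i) i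

/-- Existence of Schauder constants. -/
theorem exists_isSchauderConstant {γ : ℝ≥0} (hγ : 0 < γ) (hγ1 : γ < 1) :
    ∃ Θ : ℝ≥0, IsSchauderConstant γ Θ := by
  obtain ⟨C, hC⟩ := exists_poisson hγ hγ1
  refine ⟨C + 1, by positivity, fun φ hφ h0 i j => ?_⟩
  obtain ⟨hp, hcd, hH⟩ := hφ
  have hn : norm0 γ (laplacian φ) ≠ ⊤ := by
    refine ne_top_of_le_ne_top ?_ (norm0_sum_le γ Finset.univ fun i => pd i (pd i φ))
    exact ENNReal.sum_ne_top.2 fun i _ => norm0_ne_top_of_memHolder hγ ((hp.pd i).pd i) (hH i i)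
  obtain ⟨ψ, ⟨hψp, hψ, -⟩, -, hlap, hest⟩ := hC _ hp.laplacian hn (integral_laplacian hp hcd)
  have hdφ : Differentiable ℝ φ := hcd.differentiable two_ne_zero
  have hdψ : Differentiable ℝ ψ := hψ.differentiable two_ne_zero
  have hdφ2 := fun j => differentiable_of_contDiff_one (contDiff_pd hcd j)
  have hdψ2 := fun j => differentiable_of_contDiff_one (contDiff_pd hψ j)
  have e1 : ∀ j, pd j (fun x => φ x - ψ x) = fun x => pd j φ x - pd j ψ x := fun j =>
    funext fun x => pd_sub hdφ hdψ j x
  have hharm := pd_eq_zero_of_harmonic (φ := fun x => φ x - ψ x)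
    (fun q i => by simp only; rw [hp, hψp]) (hcd.sub hψ) (fun x => by
      have h2 := hlap x
      simp only [laplacian, e1, pd_sub (hdφ2 _) (hdψ2 _), Finset.sum_sub_distrib] at h2 ⊢
      linarith)
  have e2 : pd j φ = pd j ψ := funext fun x => by
    have := hharm j x
    rw [e1] at this
    linarith
  rw [e2]
  refine (hest i j).trans (mul_le_mul_left ?_ _)
  exact_mod_cast le_self_add

/-! ### Null Lagrangians -/

/-- An identity `∫ ∇b · h = 0` with continuous `h` extends from `b` of class `C²` to `b` of class
`C¹`, by mollification. -/
lemma integral_sum_pd_mul_eq_zero {b : E3 → ℝ} (hb : ContDiff ℝ 1 b) (hbp : Periodic3 b)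
    {h : Fin 3 → E3 → ℝ} (hc : ∀ i, Continuous (h i))
    (H : ∀ b', ContDiff ℝ 2 b' → Periodic3 b' → ∫ q in box, ∑ i, pd i b' q * h i q = 0) :
    ∫ q in box, ∑ i, pd i b q * h i q = 0 := by
  have hlim : Tendsto (fun r => ∫ q in box, ∑ i, avg moll r (pd i b) q * h i q) (𝓝[>] 0)
      (𝓝 (∫ q in box, ∑ i, pd i b q * h i q)) := by
    choose M hM0 hM using fun i => (hbp.pd i).exists_bound (continuous_pd hb i)
    refine tendsto_integral_filter_of_dominated_convergence
      (fun q => ∑ i, ((∫ z, |moll z|) * M i) * |h i q|) ?_ ?_ ?_ ?_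
    · refine Eventually.of_forall fun r => Continuous.aestronglyMeasurable ?_
      exact continuous_finsetSum _ fun i _ =>
        (continuous_avg isKernel_moll (continuous_pd hb i) r).mul (hc i)
    · refine Eventually.of_forall fun r => Eventually.of_forall fun q => ?_
      refine (norm_sum_le _ _).trans (Finset.sum_le_sum fun i _ => ?_)
      rw [norm_mul]
      exact mul_le_mul_of_nonneg_right (abs_avg_le isKernel_moll (hM i) r q) (norm_nonneg _)
    · exact integrableOn_box (continuous_finsetSum _ fun i _ => continuous_const.mul (hc i).abs)
    · refine Eventually.of_forall fun q => tendsto_finsetSum _ fun i _ => ?_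
      have h1 := ((continuous_avg_scale isKernel_moll (continuous_pd hb i) q).tendsto 0).mono_left
        (nhdsWithin_le_nhds (s := Ioi 0))
      rw [avg_zero_scale, integral_moll, one_mul] at h1
      exact h1.mul_const _
  refine tendsto_nhds_unique hlim (Tendsto.congr' ?_ tendsto_const_nhds)
  filter_upwards [self_mem_nhdsWithin] with r hr
  have h2 := H (avg moll r b) (contDiff_avg 2 isKernel_moll hb.continuous hr)
    (avg_periodic hbp _ _)
  rw [← h2]
  simp only [pd_avg_of_contDiff isKernel_moll hb hbp hr]

/-- The minors of the Jacobian of a periodic map have zero mean. -/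
lemma integral_minor_eq_zero {a b : E3 → ℝ} (ha : ContDiff ℝ 1 a) (hap : Periodic3 a)
    (hb : ContDiff ℝ 1 b) (hbp : Periodic3 b) (i j : Fin 3) :
    ∫ q in box, (pd i a q * pd j b q - pd j a q * pd i b q) = 0 := by
  have h := integral_sum_pd_mul_eq_zero ha hap
    (h := fun k q => (if k = i then pd j b q else 0) - (if k = j then pd i b q else 0))
    (fun k => by
      have h1 := continuous_pd hb i
      have h2 := continuous_pd hb j
      refine Continuous.sub ?_ ?_
      · split_ifs <;> fun_prop
      · split_ifs <;> fun_prop)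
    (fun a' ha' hap' => by
      have h1 := ha'.of_le (m := 1) (by norm_num)
      simp only [mul_sub, mul_ite, mul_zero, Finset.sum_sub_distrib, Finset.sum_ite_eq',
        Finset.mem_univ, if_true]
      rw [integral_sub, integral_mul_pd (contDiff_pd ha' i) (hap'.pd i) hb hbp,
        integral_mul_pd (contDiff_pd ha' j) (hap'.pd j) hb hbp]
      · simp only [pd_pd_comm ha' i j]
        simp
      · exact integrableOn_box ((continuous_pd h1 i).mul (continuous_pd hb j))
      · exact integrableOn_box ((continuous_pd h1 j).mul (continuous_pd hb i)))
  simpa [mul_sub, Finset.sum_sub_distrib] using h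

/-- The triple product of the gradients of three functions. -/
def gradTriple (a b c : E3 → ℝ) (q : E3) : ℝ :=
  pd 0 a q * (pd 1 b q * pd 2 c q - pd 2 b q * pd 1 c q) +
  pd 1 a q * (pd 2 b q * pd 0 c q - pd 0 b q * pd 2 c q) +
  pd 2 a q * (pd 0 b q * pd 1 c q - pd 1 b q * pd 0 c q)

/-- The Jacobian determinant of a periodic map has zero mean. -/
lemma integral_gradTriple_eq_zero {a b c : E3 → ℝ} (ha : ContDiff ℝ 1 a) (hap : Periodic3 a)
    (hb : ContDiff ℝ 1 b) (hbp : Periodic3 b) (hc : ContDiff ℝ 1 c) (hcp : Periodic3 c) :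
    ∫ q in box, gradTriple a b c q = 0 := by
  have hac := fun i => continuous_pd ha i
  -- for `b`, `c` of class `C²` the cross product of their gradients is divergence free
  have step0 : ∀ b c : E3 → ℝ, ContDiff ℝ 2 b → Periodic3 b → ContDiff ℝ 2 c → Periodic3 c →
      ∫ q in box, gradTriple a b c q = 0 := by
    intro b c hb hbp hc hcp
    have hb1 := fun i => contDiff_pd hb i
    have hc1 := fun i => contDiff_pd hc i
    have hF : ∀ i j : Fin 3, ContDiff ℝ 1 fun q => pd i b q * pd j c q - pd j b q * pd i c q :=
      fun i j => ((hb1 i).mul (hc1 j)).sub ((hb1 j).mul (hc1 i))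
    have hFp : ∀ i j : Fin 3, Periodic3 fun q => pd i b q * pd j c q - pd j b q * pd i c q :=
      fun i j q k => by simp only [hbp.pd i q k, hbp.pd j q k, hcp.pd i q k, hcp.pd j q k]
    have key : ∀ k i j : Fin 3, ∫ q in box, pd k a q * (pd i b q * pd j c q - pd j b q * pd i c q)
        = -∫ q in box, a q * pd k (fun q => pd i b q * pd j c q - pd j b q * pd i c q) q :=
      fun k i j => by rw [integral_mul_pd ha hap (hF i j) (hFp i j), neg_neg]
    have hint : ∀ k i j : Fin 3, IntegrableOn
        (fun q => pd k a q * (pd i b q * pd j c q - pd j b q * pd i c q)) box :=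
      fun k i j => integrableOn_box ((hac k).mul (hF i j).continuous)
    have hint' : ∀ k i j : Fin 3, IntegrableOn
        (fun q => a q * pd k (fun q => pd i b q * pd j c q - pd j b q * pd i c q) q) box :=
      fun k i j => integrableOn_box (ha.continuous.mul (continuous_pd (hF i j) k))
    simp only [gradTriple]
    rw [integral_add (f := fun q => pd 0 a q * (pd 1 b q * pd 2 c q - pd 2 b q * pd 1 c q) +
      pd 1 a q * (pd 2 b q * pd 0 c q - pd 0 b q * pd 2 c q))
      ((hint 0 1 2).add (hint 1 2 0)) (hint 2 0 1),
      integral_add (hint 0 1 2) (hint 1 2 0), key, key, key, ← neg_add, ← neg_add,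
      ← integral_add (hint' 0 1 2) (hint' 1 2 0),
      ← integral_add (f := fun q =>
        a q * pd 0 (fun q => pd 1 b q * pd 2 c q - pd 2 b q * pd 1 c q) q +
        a q * pd 1 (fun q => pd 2 b q * pd 0 c q - pd 0 b q * pd 2 c q) q)
        ((hint' 0 1 2).add (hint' 1 2 0)) (hint' 2 0 1), neg_eq_zero]
    have hd := fun i => differentiable_of_contDiff_one (hb1 i)
    have hd' := fun i => differentiable_of_contDiff_one (hc1 i)
    have hpd : ∀ k i j q, pd k (fun q => pd i b q * pd j c q - pd j b q * pd i c q) q =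
        pd i b q * pd k (pd j c) q + pd j c q * pd k (pd i b) q -
          (pd j b q * pd k (pd i c) q + pd i c q * pd k (pd j b) q) := fun k i j q => by
      rw [pd_sub (f := fun q => pd i b q * pd j c q) (g := fun q => pd j b q * pd i c q)
        ((hd i).mul (hd' j)) ((hd j).mul (hd' i)), pd_mul (hd i) (hd' j),
        pd_mul (hd j) (hd' i)]
    refine integral_eq_zero_of_ae (Eventually.of_forall fun q => ?_)
    simp only [hpd, Pi.zero_apply]
    rw [pd_pd_comm hb 1 0, pd_pd_comm hb 2 0, pd_pd_comm hb 2 1, pd_pd_comm hc 1 0,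
      pd_pd_comm hc 2 0, pd_pd_comm hc 2 1]
    ring
  have hL : ∀ b c : E3 → ℝ, ∀ q, gradTriple a b c q = ∑ i, pd i b q *
      (![pd 2 a q * pd 1 c q - pd 1 a q * pd 2 c q, pd 0 a q * pd 2 c q - pd 2 a q * pd 0 c q,
        pd 1 a q * pd 0 c q - pd 0 a q * pd 1 c q] i) := fun b c q => by
    simp [gradTriple, Fin.sum_univ_three]
    ring
  have hR : ∀ b c : E3 → ℝ, ∀ q, gradTriple a b c q = ∑ i, pd i c q *
      (![pd 1 a q * pd 2 b q - pd 2 a q * pd 1 b q, pd 2 a q * pd 0 b q - pd 0 a q * pd 2 b q,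
        pd 0 a q * pd 1 b q - pd 1 a q * pd 0 b q] i) := fun b c q => by
    simp [gradTriple, Fin.sum_univ_three]
    ring
  have step1 : ∀ c : E3 → ℝ, ContDiff ℝ 2 c → Periodic3 c →
      ∫ q in box, gradTriple a b c q = 0 := by
    intro c hc hcp
    have hcc := fun i => continuous_pd (hc.of_le (m := 1) (by norm_num)) i
    simp only [hL]
    refine integral_sum_pd_mul_eq_zero hb hbp (h := fun i q => (![pd 2 a q * pd 1 c q -
      pd 1 a q * pd 2 c q, pd 0 a q * pd 2 c q - pd 2 a q * pd 0 c q,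
        pd 1 a q * pd 0 c q - pd 0 a q * pd 1 c q] : Fin 3 → ℝ) i) (fun i => ?_)
        fun b' hb' hbp' => ?_
    · fin_cases i <;> simp <;> fun_prop
    · simpa only [hL] using step0 b' c hb' hbp' hc hcp
  simp only [hR]
  have hbc := fun i => continuous_pd hb i
  refine integral_sum_pd_mul_eq_zero hc hcp (h := fun i q => (![pd 1 a q * pd 2 b q -
    pd 2 a q * pd 1 b q, pd 2 a q * pd 0 b q - pd 0 a q * pd 2 b q,
    pd 0 a q * pd 1 b q - pd 1 a q * pd 0 b q] : Fin 3 → ℝ) i) (fun i => ?_) fun c' hc' hcp' => ?_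
  · fin_cases i <;> simp <;> fun_prop
  · simpa only [hR] using step1 c' hc' hcp'

/-! ### The Hodge decomposition -/

/-- `W` is divergence free in the sense of distributions. -/
def WeakDivFree (W : Fin 3 → E3 → ℝ) : Prop :=
  ∀ ψ : E3 → ℝ, ContDiff ℝ 2 ψ → Periodic3 ψ → ∫ q in box, ∑ i, pd i ψ q * W i q = 0

/-- The components of the curl of a triple of functions. -/
def curlComp (C : Fin 3 → E3 → ℝ) (i : Fin 3) (q : E3) : ℝ :=
  pd (i + 1) (C (i + 2)) q - pd (i + 2) (C (i + 1)) q

lemma curl_apply (f : E3 → E3) (q : E3) (i : Fin 3) : curl f q i = curlComp (comp f) i q := by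
  fin_cases i <;> rfl

lemma sum_integral {h : Fin 3 → E3 → ℝ} (hc : ∀ i, Continuous (h i)) :
    ∫ q in box, ∑ i, h i q = ∑ i, ∫ q in box, h i q :=
  integral_finsetSum _ fun i _ => integrableOn_box (hc i)

/-- On the torus the curl is symmetric for the `L²` product. -/
lemma integral_curlComp_mul {B C : Fin 3 → E3 → ℝ} (hB : ∀ i, ContDiff ℝ 1 (B i))
    (hBp : ∀ i, Periodic3 (B i)) (hC : ∀ i, ContDiff ℝ 1 (C i)) (hCp : ∀ i, Periodic3 (C i)) :
    ∫ q in box, ∑ i, B i q * curlComp C i q = ∫ q in box, ∑ i, C i q * curlComp B i q := by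
  have hBc := fun i => (hB i).continuous
  have hCc := fun i => (hC i).continuous
  have hBd := fun i j => continuous_pd (hB j) i
  have hCd := fun i j => continuous_pd (hC j) i
  simp only [curlComp, mul_sub]
  rw [sum_integral (h := fun i q => B i q * pd (i + 1) (C (i + 2)) q -
      B i q * pd (i + 2) (C (i + 1)) q) (fun i => by fun_prop),
    sum_integral (h := fun i q => C i q * pd (i + 1) (B (i + 2)) q -
      C i q * pd (i + 2) (B (i + 1)) q) (fun i => by fun_prop)]
  have e1 : ∀ i j k, ∫ q in box, B i q * pd j (C k) q = -∫ q in box, C k q * pd j (B i) q :=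
    fun i j k => by
      rw [integral_mul_pd (hB i) (hBp i) (hC k) (hCp k)]
      simp only [mul_comm]
  have e2 : ∀ i, ∫ q in box, (B i q * pd (i + 1) (C (i + 2)) q - B i q * pd (i + 2) (C (i + 1)) q)
      = -(∫ q in box, C (i + 2) q * pd (i + 1) (B i) q) +
        ∫ q in box, C (i + 1) q * pd (i + 2) (B i) q := fun i => by
    rw [neg_add_eq_sub, ← neg_sub_neg, ← e1, ← e1]
    exact integral_sub (integrableOn_box (by fun_prop)) (integrableOn_box (by fun_prop))
  have e3 : ∀ i, ∫ q in box, (C i q * pd (i + 1) (B (i + 2)) q - C i q * pd (i + 2) (B (i + 1)) q)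
      = (∫ q in box, C i q * pd (i + 1) (B (i + 2)) q) -
        ∫ q in box, C i q * pd (i + 2) (B (i + 1)) q := fun i => by
    exact integral_sub (integrableOn_box (by fun_prop)) (integrableOn_box (by fun_prop))
  simp only [e2, e3, Fin.sum_univ_three]
  simp only [show (0 : Fin 3) + 1 = 1 from rfl, show (0 : Fin 3) + 2 = 2 from rfl,
    show (1 : Fin 3) + 1 = 2 from rfl, show (1 : Fin 3) + 2 = 0 from rfl,
    show (2 : Fin 3) + 1 = 0 from rfl, show (2 : Fin 3) + 2 = 1 from rfl]
  ring

lemma curlComp_grad {ψ : E3 → ℝ} (hψ : ContDiff ℝ 2 ψ) (i : Fin 3) (q : E3) :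
    curlComp (fun k => pd k ψ) i q = 0 := by
  simp only [curlComp]
  rw [pd_pd_comm hψ, sub_self]

lemma weakDivFree_curlComp {C : Fin 3 → E3 → ℝ} (hC : ∀ i, ContDiff ℝ 1 (C i))
    (hCp : ∀ i, Periodic3 (C i)) : WeakDivFree (curlComp C) := by
  intro ψ hψ hψp
  rw [integral_curlComp_mul (B := fun i => pd i ψ) (fun i => contDiff_pd hψ i)
    (fun i => hψp.pd i) hC hCp]
  simp [curlComp_grad hψ]

lemma continuous_curlComp {C : Fin 3 → E3 → ℝ} (hC : ∀ i, ContDiff ℝ 1 (C i)) (i : Fin 3) :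
    Continuous (curlComp C i) :=
  (continuous_pd (hC _) _).sub (continuous_pd (hC _) _)

lemma integral_curlComp_eq_zero {C : Fin 3 → E3 → ℝ} (hC : ∀ i, ContDiff ℝ 1 (C i))
    (hCp : ∀ i, Periodic3 (C i)) (i : Fin 3) : ∫ q in box, curlComp C i q = 0 := by
  simp only [curlComp]
  rw [integral_sub (integrableOn_box (continuous_pd (hC _) _))
    (integrableOn_box (continuous_pd (hC _) _)), integral_pd_eq_zero (hC _) (hCp _),
    integral_pd_eq_zero (hC _) (hCp _), sub_zero]

lemma integral_mul_laplacian {φ ψ : E3 → ℝ} (hφ : ContDiff ℝ 1 φ) (hφp : Periodic3 φ)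
    (hψ : ContDiff ℝ 2 ψ) (hψp : Periodic3 ψ) :
    ∫ q in box, φ q * laplacian ψ q = -∫ q in box, ∑ i, pd i φ q * pd i ψ q := by
  simp only [laplacian, Finset.mul_sum]
  have h1 : ContDiff ℝ 1 ψ := hψ.of_le (by norm_num)
  rw [sum_integral (h := fun i q => φ q * pd i (pd i ψ) q)
      fun i => hφ.continuous.mul (continuous_pd (contDiff_pd hψ i) i),
    sum_integral (h := fun i q => pd i φ q * pd i ψ q)
      fun i => (continuous_pd hφ i).mul (continuous_pd h1 i),
    ← Finset.sum_neg_distrib]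
  exact Finset.sum_congr rfl fun i _ =>
    integral_mul_pd hφ hφp (contDiff_pd hψ i) (hψp.pd i) i

/-- The integral of a vector field is computed componentwise. -/
lemma integral_box_apply {f : E3 → E3} (hf : Continuous f) (k : Fin 3) :
    (∫ q in box, f q) k = ∫ q in box, comp f k q :=
  ((EuclideanSpace.proj k : E3 →L[ℝ] ℝ).integral_comp_comm (integrableOn_box hf)).symm

/-- A vector potential whose Laplacian is divergence free is itself divergence free. -/
lemma sum_pd_eq_zero_of_laplacian {γ : ℝ≥0} (hγ : 0 < γ) (hγ1 : γ < 1) {B W : Fin 3 → E3 → ℝ}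
    (hB : ∀ i, ContDiff ℝ 2 (B i)) (hBp : ∀ i, Periodic3 (B i)) (hW : WeakDivFree W)
    (hBW : ∀ i q, laplacian (B i) q = -W i q) (q : E3) : ∑ k, pd k (B k) q = 0 := by
  obtain ⟨C, hC⟩ := exists_poisson hγ hγ1
  set D : E3 → ℝ := fun q => ∑ k, pd k (B k) q with hD
  have hBd := fun i j => contDiff_pd (hB i) j
  have hB1 : ∀ i, ContDiff ℝ 1 (B i) := fun i => (hB i).of_le (by norm_num)
  have hDc : ContDiff ℝ 1 D := ContDiff.sum fun k _ => hBd k k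
  have hDp : Periodic3 D := fun q i => Finset.sum_congr rfl fun k _ => (hBp k).pd k q i
  have hD0 : ∫ q in box, D q = 0 := by
    simp only [hD]
    rw [sum_integral fun i => (hBd i i).continuous]
    exact Finset.sum_eq_zero fun i _ => integral_pd_eq_zero (hB1 i) (hBp i) i
  obtain ⟨ψ, ⟨hψp, hψ, -⟩, -, hlap, -⟩ := hC D hDp (hDp.norm0_ne_top hγ1 hDc) hD0
  have hψ1 : ContDiff ℝ 1 ψ := hψ.of_le (by norm_num)
  have hcB : ∀ i, ContDiff ℝ 1 (curlComp B i) := fun i => (hBd _ _).sub (hBd _ _)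
  have hcBp : ∀ i, Periodic3 (curlComp B i) := fun i q j => by
    simp only [curlComp, (hBp _).pd _ q j]
  have e1 : ∀ i q, pd i D q = curlComp (curlComp B) i q - W i q := by
    intro i q
    have hd := fun i j => differentiable_of_contDiff_one (hBd i j)
    have h1 : pd i D q = ∑ k, pd i (pd k (B k)) q := pd_sum _ (fun k _ => hd k k) i q
    have h2 : ∀ a b, pd a (curlComp B b) q =
        pd a (pd (b + 1) (B (b + 2))) q - pd a (pd (b + 2) (B (b + 1))) q := fun a b =>
      pd_sub (hd _ _) (hd _ _) a q
    rw [h1, sub_eq_add_neg, ← hBW i q]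
    simp only [curlComp] at h2 ⊢
    rw [h2, h2]
    simp only [laplacian, Fin.sum_univ_three]
    have c := fun k i j => pd_pd_comm (hB k) i j q
    fin_cases i <;> simp <;> simp only [c _ 1 0, c _ 2 0, c _ 2 1] <;> ring
  have key : ∫ q in box, D q ^ 2 = 0 := by
    have h1 : ∫ q in box, D q ^ 2 = ∫ q in box, D q * laplacian ψ q :=
      integral_congr_ae (Eventually.of_forall fun q => by simp only [hlap]; ring)
    rw [h1, integral_mul_laplacian hDc hDp hψ hψp, neg_eq_zero]
    have h2 : ∀ q, ∑ i, pd i D q * pd i ψ q =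
        ∑ i, pd i ψ q * curlComp (curlComp B) i q - ∑ i, pd i ψ q * W i q := fun q => by
      rw [← Finset.sum_sub_distrib]
      refine Finset.sum_congr rfl fun i _ => ?_
      rw [e1]
      ring
    have hWc : ∀ i, Continuous (W i) := fun i => by
      have : W i = fun q => -laplacian (B i) q := funext fun q => by rw [hBW, neg_neg]
      rw [this]
      exact (continuous_laplacian (hB i)).neg
    simp only [h2]
    rw [integral_sub, weakDivFree_curlComp hcB hcBp ψ hψ hψp, hW ψ hψ hψp, sub_zero]
    · exact integrableOn_box (continuous_finsetSum _ fun i _ =>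
        (continuous_pd hψ1 i).mul (continuous_curlComp hcB i))
    · exact integrableOn_box (continuous_finsetSum _ fun i _ => (continuous_pd hψ1 i).mul (hWc i))
  exact congrFun (hDp.eq_zero_of_integral_sq hDc.continuous key) q

/-- A divergence-free field of zero mean has a vector potential, and a field is determined up to
constants by its curl and its divergence: the existence part, with the Schauder estimate. -/
theorem exists_hodge {γ Θ : ℝ≥0} (hγ : 0 < γ) (hγ1 : γ < 1) (hΘ : IsSchauderConstant γ Θ)
    {W : Fin 3 → E3 → ℝ} {g : E3 → ℝ} (hWp : ∀ i, Periodic3 (W i)) (hWn : ∀ i, norm0 γ (W i) ≠ ⊤)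
    (hW0 : ∀ i, ∫ q in box, W i q = 0) (hW : WeakDivFree W) (hgp : Periodic3 g)
    (hgn : norm0 γ g ≠ ⊤) (hg0 : ∫ q in box, g q = 0) (m : E3) :
    ∃ f : E3 → E3, Periodic3 f ∧ ContDiff ℝ 1 f ∧ (∀ i q, curl f q i = W i q) ∧
      (∀ q, divergence f q = g q) ∧ ∫ q in box, f q = m ∧
      ∀ i j, norm0 γ (pd i (comp f j)) ≤
        Θ * norm0 γ g + Θ * (norm0 γ (W (j + 1)) + norm0 γ (W (j + 2))) := by
  obtain ⟨C, hC⟩ := exists_poisson hγ hγ1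
  obtain ⟨φ, hφH, hφ0, hφlap, -⟩ := hC g hgp hgn hg0
  have hex : ∀ i, ∃ B : E3 → ℝ, IsC2Holder γ B ∧ ∫ q in box, B q = 0 ∧
      (∀ x, laplacian B x = -W i x) := fun i => by
    obtain ⟨B, h1, h2, h3, -⟩ := hC (fun q => -W i q) (fun q j => by simp only [hWp i q j])
      (ne_top_of_le_ne_top (hWn i) (norm0_neg_le γ _)) (by rw [integral_neg, hW0, neg_zero])
    exact ⟨B, h1, h2, h3⟩
  choose B hBH hB0 hBlap using hex
  have hφ := hφH.2.1
  have hφp := hφH.1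
  have hB := fun i => (hBH i).2.1
  have hBp := fun i => (hBH i).1
  have hBd := fun i j => contDiff_pd (hB i) j
  have hdivB := sum_pd_eq_zero_of_laplacian hγ hγ1 hB hBp hW hBlap
  set f : E3 → E3 := fun q => WithLp.toLp 2 fun j =>
    pd j φ q + curlComp B j q + (volume.real box)⁻¹ * m j with hf
  have hcomp : ∀ j, comp f j = fun q => pd j φ q + curlComp B j q + (volume.real box)⁻¹ * m j :=
    fun j => rfl
  have hcB : ∀ i, ContDiff ℝ 1 (curlComp B i) := fun i => (hBd _ _).sub (hBd _ _)
  have hdφ := fun i => differentiable_of_contDiff_one (contDiff_pd hφ i)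
  have hdc := fun i => differentiable_of_contDiff_one (hcB i)
  have hdB := fun i j => differentiable_of_contDiff_one (hBd i j)
  have hpd : ∀ i j q, pd i (comp f j) q = pd i (pd j φ) q +
      (pd i (pd (j + 1) (B (j + 2))) q - pd i (pd (j + 2) (B (j + 1))) q) := by
    intro i j q
    rw [hcomp, pd_add (f := fun q => pd j φ q + curlComp B j q) ((hdφ j).add (hdc j))
      (differentiable_const _), pd_const, add_zero,
      pd_add (hdφ j) (hdc j)]
    congr 1
    exact pd_sub (hdB _ _) (hdB _ _) i q
  have hf1 : ContDiff ℝ 1 f := contDiff_of_comp fun k => by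
    rw [hcomp]
    exact ((contDiff_pd hφ k).add (hcB k)).add contDiff_const
  refine ⟨f, ?_, hf1, ?_, ?_, ?_, ?_⟩
  · intro q i
    simp only [hf, curlComp, hφp.pd _ q i, (hBp _).pd _ q i]
  · intro i q
    rw [curl_apply]
    simp only [curlComp, hpd]
    have h1 := hBlap i q
    have h2 : pd i (fun q => ∑ k, pd k (B k) q) q = 0 := by
      simp only [hdivB]
      exact pd_const 0 i q
    rw [pd_sum _ fun k _ => hdB k k] at h2
    simp only [laplacian, Fin.sum_univ_three] at h1 h2
    have c := fun k i j => pd_pd_comm (hB k) i j q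
    have c' := fun i j => pd_pd_comm hφ i j q
    fin_cases i <;> simp at h1 h2 ⊢ <;>
      simp only [c _ 1 0, c _ 2 0, c _ 2 1, c' 1 0, c' 2 0, c' 2 1] at h1 h2 ⊢ <;> linarith
  · intro q
    have h1 := hφlap q
    simp only [divergence, hpd, laplacian, Fin.sum_univ_three] at h1 ⊢
    have c := fun k i j => pd_pd_comm (hB k) i j q
    simp
    simp only [c _ 1 0, c _ 2 0, c _ 2 1]
    linarith
  · ext k
    rw [integral_box_apply hf1.continuous, hcomp]
    have hφ1 := hφ.of_le (m := 1) (by norm_num)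
    simp only
    rw [integral_add (f := fun q => pd k φ q + curlComp B k q)
      (integrableOn_box ((continuous_pd hφ1 k).add (hcB k).continuous))
      (integrableOn_box continuous_const), integral_add (integrableOn_box (continuous_pd hφ1 k))
      (integrableOn_box (hcB k).continuous), integral_pd_eq_zero hφ1 hφp,
      integral_curlComp_eq_zero (fun i => (hB i).of_le (by norm_num)) hBp]
    have hv := volume_box_pos.ne'
    simp
    field_simp
  · intro i j
    have e : pd i (comp f j) = fun q => pd i (pd j φ) q +
      (pd i (pd (j + 1) (B (j + 2))) q - pd i (pd (j + 2) (B (j + 1))) q) :=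
      funext fun q => hpd i j q
    rw [e]
    refine (norm0_add_le γ _ _).trans (add_le_add ?_ ((norm0_sub_le γ _ _).trans ?_))
    · have h1 := hΘ.2 φ hφH hφ0 i j
      rwa [show laplacian φ = g from funext hφlap] at h1
    · have h2 : ∀ k, norm0 γ (laplacian (B k)) ≤ norm0 γ (W k) := fun k => by
        rw [show laplacian (B k) = fun q => -W k q from funext (hBlap k)]
        exact norm0_neg_le γ _
      rw [mul_add, add_comm]
      exact add_le_add ((hΘ.2 _ (hBH _) (hB0 _) i _).trans (mul_le_mul_right (h2 _) _))
        ((hΘ.2 _ (hBH _) (hB0 _) i _).trans (mul_le_mul_right (h2 _) _))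

/-- A field on the torus with vanishing curl, divergence and mean vanishes. -/
lemma eq_zero_of_curl_div_mean {f : E3 → E3} (hf : ContDiff ℝ 1 f) (hp : Periodic3 f)
    (hc : ∀ q i, curl f q i = 0) (hd : ∀ q, divergence f q = 0) (hm : ∫ q in box, f q = 0) :
    f = 0 := by
  obtain ⟨C, hC⟩ := exists_poisson (γ := 1 / 2) (by norm_num) (by
    rw [← NNReal.coe_lt_coe]; norm_num)
  have hfc := fun k => contDiff_comp (n := 1) hf k
  have hfp := fun k => hp.comp k
  have hsymm : ∀ q i j, pd i (comp f j) q = pd j (comp f i) q := by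
    intro q i j
    have h := hc q
    simp only [curl_apply, curlComp] at h
    have h0 := h 0
    have h1 := h 1
    have h2 := h 2
    simp at h0 h1 h2
    fin_cases i <;> fin_cases j <;> simp <;> linarith
  have hzero : ∀ k, comp f k = 0 := by
    intro k
    have hk0 : ∫ q in box, comp f k q = 0 := by
      rw [← integral_box_apply hf.continuous, hm]; rfl
    obtain ⟨ψ, ⟨hψp, hψ, -⟩, -, hlap, -⟩ := hC (comp f k) (hfp k)
      ((hfp k).norm0_ne_top (by rw [← NNReal.coe_lt_coe]; norm_num) (hfc k)) hk0
    have hψd := fun i => contDiff_pd hψ i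
    refine (hfp k).eq_zero_of_integral_sq (hfc k).continuous ?_
    have h1 : ∫ q in box, comp f k q ^ 2 = ∫ q in box, comp f k q * laplacian ψ q :=
      integral_congr_ae (Eventually.of_forall fun q => by simp only [hlap]; ring)
    rw [h1, integral_mul_laplacian (hfc k) (hfp k) hψ hψp, neg_eq_zero]
    rw [sum_integral (h := fun i q => pd i (comp f k) q * pd i ψ q)
      fun i => (continuous_pd (hfc k) i).mul (hψd i).continuous]
    have h2 : ∀ i, ∫ q in box, pd i (comp f k) q * pd i ψ q =
        ∫ q in box, pd i (comp f i) q * pd k ψ q := fun i => by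
      simp only [hsymm _ i k]
      have a1 := integral_mul_pd (hfc i) (hfp i) (hψd i) (hψp.pd i) k
      have a2 := integral_mul_pd (hfc i) (hfp i) (hψd k) (hψp.pd k) i
      simp only [pd_pd_comm hψ k i] at a1
      linarith
    simp only [h2]
    rw [← sum_integral (h := fun i q => pd i (comp f i) q * pd k ψ q)
      fun i => (continuous_pd (hfc i) i).mul (hψd k).continuous]
    simp only [← Finset.sum_mul]
    have h3 : ∀ q, ∑ i, pd i (comp f i) q = 0 := hd
    simp [h3]
  ext q k
  exact congrFun (hzero k) q

/-! ### Cauchy's recurrence relations -/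

/-- The components of the cross product of the gradients of two functions. -/
def crossComp (a b : E3 → ℝ) (i : Fin 3) (q : E3) : ℝ :=
  pd (i + 1) a q * pd (i + 2) b q - pd (i + 2) a q * pd (i + 1) b q

lemma crossProduct_grad (a b : E3 → ℝ) (q : E3) (i : Fin 3) :
    crossProduct (grad a q) (grad b q) i = crossComp a b i q := by
  rw [cross_apply]
  fin_cases i <;> rfl

lemma crossComp_comm (a b : E3 → ℝ) (i : Fin 3) (q : E3) :
    crossComp b a i q = -crossComp a b i q := by
  simp only [crossComp]; ring

lemma continuous_crossComp {a b : E3 → ℝ} (ha : ContDiff ℝ 1 a) (hb : ContDiff ℝ 1 b)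
    (i : Fin 3) : Continuous (crossComp a b i) :=
  ((continuous_pd ha _).mul (continuous_pd hb _)).sub
    ((continuous_pd ha _).mul (continuous_pd hb _))

lemma Periodic3.crossComp {a b : E3 → ℝ} (ha : Periodic3 a) (hb : Periodic3 b) (i : Fin 3) :
    Periodic3 (crossComp a b i) := fun q j => by
  simp only [EulerLagrange.crossComp, ha.pd _ q j, hb.pd _ q j]

lemma weakDivFree_crossComp {a b : E3 → ℝ} (ha : ContDiff ℝ 1 a) (hap : Periodic3 a)
    (hb : ContDiff ℝ 1 b) (hbp : Periodic3 b) : WeakDivFree (crossComp a b) := by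
  intro ψ hψ hψp
  rw [← integral_gradTriple_eq_zero (hψ.of_le (by norm_num)) hψp ha hap hb hbp]
  refine integral_congr_ae (Eventually.of_forall fun q => ?_)
  simp only [gradTriple, crossComp, Fin.sum_univ_three]
  rfl

lemma norm0_crossComp_le (γ : ℝ≥0) {a b : E3 → ℝ} {A B : ℝ≥0∞} (ha : ∀ i, norm0 γ (pd i a) ≤ A)
    (hb : ∀ i, norm0 γ (pd i b) ≤ B) (i : Fin 3) : norm0 γ (crossComp a b i) ≤ 2 * (A * B) := by
  rw [two_mul]
  exact (norm0_sub_le γ _ _).trans (add_le_add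
    ((norm0_mul_le γ _ _).trans (mul_le_mul' (ha _) (hb _)))
    ((norm0_mul_le γ _ _).trans (mul_le_mul' (ha _) (hb _))))

lemma WeakDivFree.const_mul {W : Fin 3 → E3 → ℝ} (h : WeakDivFree W) (c : ℝ) :
    WeakDivFree fun i q => c * W i q := by
  intro ψ hψ hψp
  have h1 := h ψ hψ hψp
  have e : ∀ q, ∑ i, pd i ψ q * (c * W i q) = c * ∑ i, pd i ψ q * W i q := fun q => by
    rw [Finset.mul_sum]
    exact Finset.sum_congr rfl fun i _ => by ring
  simp only [e]
  rw [integral_const_mul, h1, mul_zero]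

lemma WeakDivFree.add {W V : Fin 3 → E3 → ℝ} (hW : WeakDivFree W) (hV : WeakDivFree V)
    (hWc : ∀ i, Continuous (W i)) (hVc : ∀ i, Continuous (V i)) :
    WeakDivFree fun i q => W i q + V i q := by
  intro ψ hψ hψp
  have hψc := fun i => continuous_pd (hψ.of_le (m := 1) (by norm_num)) i
  simp only [mul_add, Finset.sum_add_distrib]
  rw [integral_add (integrableOn_box (by fun_prop)) (integrableOn_box (by fun_prop)),
    hW ψ hψ hψp, hV ψ hψ hψp, add_zero]

lemma WeakDivFree.sum {ι : Type*} (s : Finset ι) {W : ι → Fin 3 → E3 → ℝ}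
    (hW : ∀ k ∈ s, WeakDivFree (W k)) (hWc : ∀ k ∈ s, ∀ i, Continuous (W k i)) :
    WeakDivFree fun i q => ∑ k ∈ s, W k i q := by
  classical
  induction s using Finset.induction_on with
  | empty => intro ψ _ _; simp
  | insert a s ha ih =>
    simp only [Finset.sum_insert ha]
    exact (hW a (Finset.mem_insert_self a s)).add
      (ih (fun k hk => hW k (Finset.mem_insert_of_mem hk))
        fun k hk => hWc k (Finset.mem_insert_of_mem hk))
      (hWc a (Finset.mem_insert_self a s))
      fun i => continuous_finsetSum _ fun k hk => hWc k (Finset.mem_insert_of_mem hk) i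

/-- The largest `C^{0,γ}` norm of an entry of the Jacobian matrix of a vector field. -/
def gradNorm (γ : ℝ≥0) (f : E3 → E3) : ℝ≥0∞ := ⨆ i, ⨆ j, norm0 γ (pd i (comp f j))

lemma norm0_pd_le_gradNorm (γ : ℝ≥0) (f : E3 → E3) (i j : Fin 3) :
    norm0 γ (pd i (comp f j)) ≤ gradNorm γ f :=
  (le_iSup (fun j => norm0 γ (pd i (comp f j))) j).trans
    (le_iSup (fun i => ⨆ j, norm0 γ (pd i (comp f j))) i)

/-- The vector fields of class `C^{1,γ}` on the torus. -/
structure IsC1Holder (γ : ℝ≥0) (f : E3 → E3) : Prop where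
  periodic : Periodic3 f
  contDiff : ContDiff ℝ 1 f
  gradNorm_ne_top : gradNorm γ f ≠ ⊤

lemma curlTerm_apply (ξ : ℕ → E3 → E3) (s : ℕ) (q : E3) (i : Fin 3) :
    curlTerm ξ s q i = ∑ k, ∑ n ∈ Finset.Ioo 0 s,
      (n : ℝ) * crossComp (comp (ξ n) k) (comp (ξ (s - n)) k) i q := by
  simp only [curlTerm, Finset.sum_apply, Pi.smul_apply, smul_eq_mul, crossProduct_grad]

/-- By antisymmetry of the cross product, the weight `n` in the curl relation may be replaced by
`(2n - s) / 2`, which gains a factor `2` in the estimates. -/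
lemma curlTerm_symm (ξ : ℕ → E3 → E3) (s : ℕ) (q : E3) (i : Fin 3) :
    curlTerm ξ s q i = ∑ k, ∑ n ∈ Finset.Ioo 0 s,
      ((2 * n - s : ℝ) / 2) * crossComp (comp (ξ n) k) (comp (ξ (s - n)) k) i q := by
  rw [curlTerm_apply]
  refine Finset.sum_congr rfl fun k _ => ?_
  have h : ∑ n ∈ Finset.Ioo 0 s, (n : ℝ) * crossComp (comp (ξ n) k) (comp (ξ (s - n)) k) i q =
      ∑ n ∈ Finset.Ioo 0 s, -(((s : ℝ) - n) *
        crossComp (comp (ξ n) k) (comp (ξ (s - n)) k) i q) := by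
    refine Finset.sum_nbij' (fun n => s - n) (fun n => s - n) ?_ ?_ ?_ ?_ ?_
    · intro n hn; rw [Finset.mem_Ioo] at hn ⊢; omega
    · intro n hn; rw [Finset.mem_Ioo] at hn ⊢; omega
    · intro n hn; rw [Finset.mem_Ioo] at hn; omega
    · intro n hn; rw [Finset.mem_Ioo] at hn; omega
    · intro n hn
      rw [Finset.mem_Ioo] at hn
      rw [Nat.sub_sub_self hn.2.le, crossComp_comm (comp (ξ n) k), Nat.cast_sub hn.2.le]
      ring
  have h2 : ∑ n ∈ Finset.Ioo 0 s, ((2 * n - s : ℝ) / 2) *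
      crossComp (comp (ξ n) k) (comp (ξ (s - n)) k) i q =
      (∑ n ∈ Finset.Ioo 0 s, (n : ℝ) * crossComp (comp (ξ n) k) (comp (ξ (s - n)) k) i q +
      ∑ n ∈ Finset.Ioo 0 s, -(((s : ℝ) - n) *
        crossComp (comp (ξ n) k) (comp (ξ (s - n)) k) i q)) / 2 := by
    rw [← Finset.sum_add_distrib, Finset.sum_div]
    exact Finset.sum_congr rfl fun n _ => by ring
  rw [h2, ← h]
  ring

/-- The triples of positive integers with sum `s`. -/
abbrev posTriples (s : ℕ) : Finset (Fin 3 → ℕ) :=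
  (Finset.Nat.antidiagonalTuple 3 s).filter (fun n => ∀ k, 0 < n k)

lemma posTriples_pos_lt {s : ℕ} {n : Fin 3 → ℕ} (hn : n ∈ posTriples s) (k : Fin 3) :
    0 < n k ∧ n k < s := by
  rw [Finset.mem_filter, Finset.Nat.mem_antidiagonalTuple, Fin.sum_univ_three] at hn
  have h0 := hn.2 0
  have h1 := hn.2 1
  have h2 := hn.2 2
  refine ⟨hn.2 k, ?_⟩
  have := hn.1
  fin_cases k <;> simp <;> omega

lemma sum_perm_eq_gradTriple (f : Fin 3 → E3 → ℝ) (q : E3) :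
    ∑ σ : Equiv.Perm (Fin 3), ((Equiv.Perm.sign σ : ℤ) : ℝ) * ∏ k : Fin 3, pd (σ k) (f k) q =
      gradTriple (f 0) (f 1) (f 2) q := by
  have h := Matrix.det_apply' (Matrix.of fun i k => pd i (f k) q)
  simp only [Matrix.of_apply] at h
  rw [← h, Matrix.det_fin_three]
  simp [gradTriple]
  ring

lemma divCubic_eq (ξ : ℕ → E3 → E3) (s : ℕ) (q : E3) :
    divCubic ξ s q = ∑ n ∈ posTriples s,
      gradTriple (comp (ξ (n 0)) 0) (comp (ξ (n 1)) 1) (comp (ξ (n 2)) 2) q :=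
  Finset.sum_congr rfl fun n _ => sum_perm_eq_gradTriple (fun k => comp (ξ (n k)) k) q

lemma continuous_gradTriple {a b c : E3 → ℝ} (ha : ContDiff ℝ 1 a) (hb : ContDiff ℝ 1 b)
    (hc : ContDiff ℝ 1 c) : Continuous (gradTriple a b c) := by
  have h1 := fun i => continuous_pd ha i
  have h2 := fun i => continuous_pd hb i
  have h3 := fun i => continuous_pd hc i
  unfold gradTriple
  fun_prop

lemma norm0_sum_perm_le (γ : ℝ≥0) {f : Fin 3 → E3 → ℝ} {A : Fin 3 → ℝ≥0∞}
    (hA : ∀ i k, norm0 γ (pd i (f k)) ≤ A k) :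
    norm0 γ (gradTriple (f 0) (f 1) (f 2)) ≤ 6 * ∏ k, A k := by
  have e : gradTriple (f 0) (f 1) (f 2) = fun q => ∑ σ : Equiv.Perm (Fin 3),
      ((Equiv.Perm.sign σ : ℤ) : ℝ) * ∏ k : Fin 3, pd (σ k) (f k) q :=
    funext fun q => (sum_perm_eq_gradTriple f q).symm
  rw [e]
  refine (norm0_sum_le γ _ _).trans ?_
  have h : ∀ σ ∈ (Finset.univ : Finset (Equiv.Perm (Fin 3))),
      norm0 γ (fun q => ((Equiv.Perm.sign σ : ℤ) : ℝ) * ∏ k : Fin 3, pd (σ k) (f k) q) ≤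
        ∏ k, A k := by
    intro σ _
    refine (norm0_const_mul_le γ _ _).trans ?_
    have h1 : ‖((Equiv.Perm.sign σ : ℤ) : ℝ)‖ₑ = 1 := by
      rcases Int.units_eq_one_or (Equiv.Perm.sign σ) with h | h <;> simp [h]
    rw [h1, one_mul]
    simp only [Fin.prod_univ_three]
    exact (norm0_mul_le γ (fun q => pd (σ 0) (f 0) q * pd (σ 1) (f 1) q) _).trans
      (mul_le_mul' ((norm0_mul_le γ _ _).trans (mul_le_mul' (hA _ _) (hA _ _))) (hA _ _))
  refine (Finset.sum_le_card_nsmul _ _ _ h).trans (le_of_eq ?_)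
  rw [Finset.card_univ, Fintype.card_perm, Fintype.card_fin, nsmul_eq_mul]
  norm_num [Nat.factorial]

section step

variable {γ : ℝ≥0} {ξ : ℕ → E3 → E3} {s : ℕ}

lemma Ioo_sub_mem {n : ℕ} (hn : n ∈ Finset.Ioo 0 s) : s - n ∈ Finset.Ioo 0 s := by
  rw [Finset.mem_Ioo] at hn ⊢; omega

lemma sum_pairs (F : Fin 3 → Fin 3 → ℝ) :
    ∑ i : Fin 3, ∑ j ∈ Finset.Ioi i, F i j = F 0 1 + F 0 2 + F 1 2 := by
  have h0 : Finset.Ioi (0 : Fin 3) = {1, 2} := by decide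
  have h1 : Finset.Ioi (1 : Fin 3) = {2} := by decide
  have h2 : Finset.Ioi (2 : Fin 3) = ∅ := by decide
  rw [Fin.sum_univ_three, h0, h1, h2]
  simp

/-- The quadratic terms of the divergence relation that belong to one pair of coordinates. -/
def divPair (ξ : ℕ → E3 → E3) (s : ℕ) (i j : Fin 3) (q : E3) : ℝ :=
  ∑ n ∈ Finset.Ioo 0 s, (pd j (comp (ξ n) i) q * pd i (comp (ξ (s - n)) j) q
      - pd i (comp (ξ n) i) q * pd j (comp (ξ (s - n)) j) q)

lemma divQuadratic_eq (ξ : ℕ → E3 → E3) (s : ℕ) (q : E3) :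
    divQuadratic ξ s q = divPair ξ s 0 1 q + divPair ξ s 0 2 q + divPair ξ s 1 2 q :=
  sum_pairs fun i j => divPair ξ s i j q

lemma continuous_divPair (hξ : ∀ n ∈ Finset.Ioo 0 s, IsC1Holder γ (ξ n)) (i j : Fin 3) :
    Continuous (divPair ξ s i j) := by
  refine continuous_finsetSum _ fun n hn => ?_
  have h1 := fun i k => continuous_pd (contDiff_comp (n := 1) (hξ n hn).contDiff k) i
  have h2 := fun i k => continuous_pd (contDiff_comp (n := 1) (hξ _ (Ioo_sub_mem hn)).contDiff k) i
  exact ((h1 _ _).mul (h2 _ _)).sub ((h1 _ _).mul (h2 _ _))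

lemma integral_divPair (hξ : ∀ n ∈ Finset.Ioo 0 s, IsC1Holder γ (ξ n)) (i j : Fin 3) :
    ∫ q in box, divPair ξ s i j q = 0 := by
  simp only [divPair]
  have hc : ∀ n ∈ Finset.Ioo 0 s, ∀ k, ContDiff ℝ 1 (comp (ξ n) k) :=
    fun n hn k => contDiff_comp (n := 1) (hξ n hn).contDiff k
  rw [integral_finsetSum]
  · exact Finset.sum_eq_zero fun n hn => integral_minor_eq_zero (hc n hn i)
      ((hξ n hn).periodic.comp i) (hc _ (Ioo_sub_mem hn) j)
      ((hξ _ (Ioo_sub_mem hn)).periodic.comp j) j i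
  · intro n hn
    have h1 := fun i k => continuous_pd (hc n hn k) i
    have h2 := fun i k => continuous_pd (hc _ (Ioo_sub_mem hn) k) i
    exact integrableOn_box (((h1 _ _).mul (h2 _ _)).sub ((h1 _ _).mul (h2 _ _)))

lemma norm0_divPair_le (γ : ℝ≥0) (ξ : ℕ → E3 → E3) (s : ℕ) (i j : Fin 3) :
    norm0 γ (divPair ξ s i j) ≤
      2 * ∑ n ∈ Finset.Ioo 0 s, gradNorm γ (ξ n) * gradNorm γ (ξ (s - n)) := by
  rw [Finset.mul_sum]
  refine (norm0_sum_le γ _ _).trans (Finset.sum_le_sum fun n _ => ?_)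
  rw [two_mul]
  exact (norm0_sub_le γ _ _).trans (add_le_add
    ((norm0_mul_le γ _ _).trans
      (mul_le_mul' (norm0_pd_le_gradNorm _ _ _ _) (norm0_pd_le_gradNorm _ _ _ _)))
    ((norm0_mul_le γ _ _).trans
      (mul_le_mul' (norm0_pd_le_gradNorm _ _ _ _) (norm0_pd_le_gradNorm _ _ _ _))))

end step

/-- The sum of the products of two of the `a n` with indices adding up to `s`. -/
def convTwo (a : ℕ → ℝ≥0∞) (s : ℕ) : ℝ≥0∞ := ∑ n ∈ Finset.Ioo 0 s, a n * a (s - n)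

/-- The sum of the products of three of the `a n` with indices adding up to `s`. -/
def convThree (a : ℕ → ℝ≥0∞) (s : ℕ) : ℝ≥0∞ := ∑ n ∈ posTriples s, ∏ k, a (n k)

lemma convTwo_ne_top {a : ℕ → ℝ≥0∞} {s : ℕ} (h : ∀ n ∈ Finset.Ioo 0 s, a n ≠ ⊤) :
    convTwo a s ≠ ⊤ :=
  ENNReal.sum_ne_top.2 fun n hn => ENNReal.mul_ne_top (h n hn) (h (s - n) (Ioo_sub_mem hn))

lemma convThree_ne_top {a : ℕ → ℝ≥0∞} {s : ℕ} (h : ∀ n ∈ Finset.Ioo 0 s, a n ≠ ⊤) :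
    convThree a s ≠ ⊤ :=
  ENNReal.sum_ne_top.2 fun n hn => ENNReal.prod_ne_top fun k _ =>
    h (n k) (Finset.mem_Ioo.2 (posTriples_pos_lt hn k))

/-- The right-hand side of the curl relation, divided by `s`. -/
def curlRhs (v₀ : E3 → E3) (ξ : ℕ → E3 → E3) (s : ℕ) (i : Fin 3) (q : E3) : ℝ :=
  (if s = 1 then curlComp (comp v₀) i q else 0) + ∑ k, ∑ n ∈ Finset.Ioo 0 s,
    (-((2 * n - s : ℝ) / (2 * s))) * crossComp (comp (ξ n) k) (comp (ξ (s - n)) k) i q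

lemma curlRhs_eq (v₀ : E3 → E3) (ξ : ℕ → E3 → E3) {s : ℕ} (hs : 1 ≤ s) (i : Fin 3) (q : E3) :
    (s : ℝ) * curlRhs v₀ ξ s i q =
      (if s = 1 then curlComp (comp v₀) i q else 0) - curlTerm ξ s q i := by
  have hs0 : (s : ℝ) ≠ 0 := by positivity
  rw [curlRhs, curlTerm_symm, mul_add, sub_eq_add_neg]
  congr 1
  · split_ifs with h
    · rw [h]; simp
    · simp
  · rw [Finset.mul_sum, ← Finset.sum_neg_distrib]
    refine Finset.sum_congr rfl fun k _ => ?_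
    rw [Finset.mul_sum, ← Finset.sum_neg_distrib]
    refine Finset.sum_congr rfl fun n _ => ?_
    field_simp

section step

variable {γ Θ : ℝ≥0} {v₀ : E3 → E3} {ξ : ℕ → E3 → E3} {s : ℕ}

lemma norm0_curlRhs_le (γ : ℝ≥0) (v₀ : E3 → E3) (ξ : ℕ → E3 → E3) {s : ℕ} (hs : 1 ≤ s)
    (i : Fin 3) : norm0 γ (curlRhs v₀ ξ s i) ≤
      (if s = 1 then vecNorm0 γ (curl v₀) else 0) + 3 * convTwo (fun n => gradNorm γ (ξ n)) s := by
  refine (norm0_add_le γ _ _).trans (add_le_add ?_ ?_)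
  · split_ifs with h
    · refine le_trans (le_of_eq ?_) (le_iSup (fun k => norm0 γ fun q => curl v₀ q k) i)
      simp only [curl_apply]
    · simp [norm0_zero]
  · refine (norm0_sum_le γ _ _).trans ?_
    have h : ∀ k ∈ (Finset.univ : Finset (Fin 3)), norm0 γ (fun q => ∑ n ∈ Finset.Ioo 0 s,
        (-((2 * n - s : ℝ) / (2 * s))) * crossComp (comp (ξ n) k) (comp (ξ (s - n)) k) i q) ≤
          convTwo (fun n => gradNorm γ (ξ n)) s := by
      intro k _
      refine (norm0_sum_le γ _ _).trans (Finset.sum_le_sum fun n hn => ?_)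
      refine (norm0_const_mul_le γ _ _).trans ?_
      rw [Finset.mem_Ioo] at hn
      have h1 : ‖(-((2 * n - s : ℝ) / (2 * s)))‖ₑ ≤ ENNReal.ofReal (1 / 2) := by
        rw [Real.enorm_eq_ofReal_abs]
        refine ENNReal.ofReal_le_ofReal ?_
        have hs0 : (0 : ℝ) < s := by positivity
        have hn1 : (n : ℝ) < s := by exact_mod_cast hn.2
        have hn0 : (0 : ℝ) < n := by exact_mod_cast hn.1
        rw [abs_neg, abs_le, div_le_div_iff₀ (by positivity) (by positivity),
          le_div_iff₀ (by positivity)]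
        constructor <;> linarith
      have h2 := norm0_crossComp_le γ (fun i => norm0_pd_le_gradNorm γ (ξ n) i k)
        (fun i => norm0_pd_le_gradNorm γ (ξ (s - n)) i k) i
      refine (mul_le_mul' h1 h2).trans (le_of_eq ?_)
      rw [← mul_assoc, show (2 : ℝ≥0∞) = ENNReal.ofReal 2 by simp,
        ← ENNReal.ofReal_mul (by norm_num)]
      norm_num
    refine (Finset.sum_le_card_nsmul _ _ _ h).trans (le_of_eq ?_)
    simp

lemma norm0_divRhs_le (γ : ℝ≥0) (ξ : ℕ → E3 → E3) (s : ℕ) :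
    norm0 γ (fun q => divQuadratic ξ s q - divCubic ξ s q) ≤
      6 * convTwo (fun n => gradNorm γ (ξ n)) s + 6 * convThree (fun n => gradNorm γ (ξ n)) s := by
  refine (norm0_sub_le γ _ _).trans (add_le_add ?_ ?_)
  · rw [show divQuadratic ξ s = fun q => divPair ξ s 0 1 q + divPair ξ s 0 2 q + divPair ξ s 1 2 q
      from funext fun q => divQuadratic_eq ξ s q]
    refine (norm0_add_le γ (fun q => divPair ξ s 0 1 q + divPair ξ s 0 2 q) _).trans
      ((add_le_add ((norm0_add_le γ _ _).trans (add_le_add (norm0_divPair_le γ ξ s 0 1)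
        (norm0_divPair_le γ ξ s 0 2))) (norm0_divPair_le γ ξ s 1 2)).trans (le_of_eq ?_))
    rw [← convTwo]
    ring
  · rw [show divCubic ξ s = fun q => ∑ n ∈ posTriples s,
      gradTriple (comp (ξ (n 0)) 0) (comp (ξ (n 1)) 1) (comp (ξ (n 2)) 2) q
      from funext fun q => divCubic_eq ξ s q, convThree, Finset.mul_sum]
    refine (norm0_sum_le γ _ _).trans (Finset.sum_le_sum fun n _ => ?_)
    exact norm0_sum_perm_le γ (f := fun k => comp (ξ (n k)) k)
      fun i k => norm0_pd_le_gradNorm γ (ξ (n k)) i k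

/-- The recurrence relations at the order `s` can be solved in `C^{1,γ}`: the right-hand sides have
zero mean and the one for the curl is divergence free. A derivative of the solution is controlled by
two components of the curl and by the divergence, whence `12 = 2 * 3 + 6`: after the factor `1 / 2`
from antisymmetry a component of the curl has three products of each sign, and the divergence
has six; the cubic term is a sum over the six permutations. -/
lemma exists_solvesRecurrence (hγ : 0 < γ) (hγ1 : γ < 1) (hΘ : IsSchauderConstant γ Θ)
    (hv : ContDiff ℝ 1 v₀) (hvp : Periodic3 v₀) (hω : ∀ k, MemHolder γ fun q => curl v₀ q k)
    (hs : 1 ≤ s) (hξ : ∀ n ∈ Finset.Ioo 0 s, IsC1Holder γ (ξ n)) :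
    ∃ f, SolvesRecurrence v₀ ξ s f ∧ IsC1Holder γ f ∧ gradNorm γ f ≤
      2 * Θ * (if s = 1 then vecNorm0 γ (curl v₀) else 0) +
      12 * Θ * convTwo (fun n => gradNorm γ (ξ n)) s +
      6 * Θ * convThree (fun n => gradNorm γ (ξ n)) s := by
  have hvc := fun k => contDiff_comp (n := 1) hv k
  have hvcp := fun k => hvp.comp k
  have hc : ∀ n ∈ Finset.Ioo 0 s, ∀ k, ContDiff ℝ 1 (comp (ξ n) k) :=
    fun n hn k => contDiff_comp (n := 1) (hξ n hn).contDiff k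
  have hp : ∀ n ∈ Finset.Ioo 0 s, ∀ k, Periodic3 (comp (ξ n) k) :=
    fun n hn k => (hξ n hn).periodic.comp k
  have hwp : ∀ i, Periodic3 (curlComp (comp v₀) i) := fun i q j => by
    simp only [curlComp, (hvcp _).pd _ q j]
  have hωn : vecNorm0 γ (curl v₀) ≠ ⊤ := by
    refine (iSup_lt_iff.2 ⟨∑ k, norm0 γ fun q => curl v₀ q k, ?_, fun k =>
      Finset.single_le_sum (f := fun k => norm0 γ fun q => curl v₀ q k) (fun _ _ => zero_le)
        (Finset.mem_univ k)⟩).ne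
    refine ENNReal.sum_lt_top.2 fun k _ => lt_top_iff_ne_top.2
      (norm0_ne_top_of_memHolder hγ ?_ (hω k))
    simp only [curl_apply]
    exact hwp k
  have ha : ∀ n ∈ Finset.Ioo 0 s, gradNorm γ (ξ n) ≠ ⊤ := fun n hn => (hξ n hn).gradNorm_ne_top
  have hc2 := convTwo_ne_top ha
  have hc3 := convThree_ne_top ha
  -- the data of the Hodge problem
  have hcrossc : ∀ k, ∀ n ∈ Finset.Ioo 0 s, ∀ i, Continuous fun q =>
      (-((2 * n - s : ℝ) / (2 * s))) * crossComp (comp (ξ n) k) (comp (ξ (s - n)) k) i q :=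
    fun k n hn i =>
      continuous_const.mul (continuous_crossComp (hc n hn k) (hc _ (Ioo_sub_mem hn) k) i)
  have hsumc : ∀ i, Continuous fun q => ∑ k, ∑ n ∈ Finset.Ioo 0 s,
      (-((2 * n - s : ℝ) / (2 * s))) * crossComp (comp (ξ n) k) (comp (ξ (s - n)) k) i q :=
    fun i => continuous_finsetSum _ fun k _ => continuous_finsetSum _ fun n hn => hcrossc k n hn i
  have hifc : ∀ i, Continuous fun q => if s = 1 then curlComp (comp v₀) i q else 0 := fun i => by
    split_ifs
    · exact continuous_curlComp hvc i
    · exact continuous_const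
  have hWp : ∀ i, Periodic3 (curlRhs v₀ ξ s i) := fun i q j => by
    simp only [curlRhs, hwp i q j]
    congr 1
    refine Finset.sum_congr rfl fun k _ => Finset.sum_congr rfl fun n hn => ?_
    rw [(hp n hn k).crossComp (hp _ (Ioo_sub_mem hn) k) i q j]
  have hWn : ∀ i, norm0 γ (curlRhs v₀ ξ s i) ≠ ⊤ := fun i => by
    refine ne_top_of_le_ne_top ?_ (norm0_curlRhs_le γ v₀ ξ hs i)
    refine ENNReal.add_ne_top.2 ⟨?_, ENNReal.mul_ne_top (by norm_num) hc2⟩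
    split_ifs
    · exact hωn
    · exact ENNReal.zero_ne_top
  have hW0 : ∀ i, ∫ q in box, curlRhs v₀ ξ s i q = 0 := fun i => by
    simp only [curlRhs]
    rw [integral_add (integrableOn_box (hifc i)) (integrableOn_box (hsumc i))]
    have h1 : ∫ q in box, (if s = 1 then curlComp (comp v₀) i q else 0) = 0 := by
      split_ifs
      · exact integral_curlComp_eq_zero hvc hvcp i
      · simp
    rw [h1, zero_add, integral_finsetSum _ fun k _ => integrableOn_box
      (continuous_finsetSum _ fun n hn => hcrossc k n hn i)]
    refine Finset.sum_eq_zero fun k _ => ?_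
    rw [integral_finsetSum _ fun n hn => integrableOn_box (hcrossc k n hn i)]
    refine Finset.sum_eq_zero fun n hn => ?_
    rw [integral_const_mul]
    simp only [crossComp]
    rw [integral_minor_eq_zero (hc n hn k) (hp n hn k) (hc _ (Ioo_sub_mem hn) k)
      (hp _ (Ioo_sub_mem hn) k), mul_zero]
  have hWd : WeakDivFree (curlRhs v₀ ξ s) := by
    refine WeakDivFree.add (W := fun i q => if s = 1 then curlComp (comp v₀) i q else 0)
      (V := fun i q => ∑ k, ∑ n ∈ Finset.Ioo 0 s,
      (-((2 * n - s : ℝ) / (2 * s))) * crossComp (comp (ξ n) k) (comp (ξ (s - n)) k) i q)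
      ?_ ?_ hifc hsumc
    · split_ifs
      · exact weakDivFree_curlComp hvc hvcp
      · intro ψ _ _; simp
    · refine WeakDivFree.sum _ (fun k _ => WeakDivFree.sum _ (fun n hn => ?_)
        fun n hn i => hcrossc k n hn i) fun k _ i => continuous_finsetSum _ fun n hn =>
          hcrossc k n hn i
      exact (weakDivFree_crossComp (hc n hn k) (hp n hn k) (hc _ (Ioo_sub_mem hn) k)
        (hp _ (Ioo_sub_mem hn) k)).const_mul _
  have htc : ∀ n ∈ posTriples s, Continuous
      (gradTriple (comp (ξ (n 0)) 0) (comp (ξ (n 1)) 1) (comp (ξ (n 2)) 2)) := fun n hn =>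
    continuous_gradTriple (hc _ (Finset.mem_Ioo.2 (posTriples_pos_lt hn 0)) 0)
      (hc _ (Finset.mem_Ioo.2 (posTriples_pos_lt hn 1)) 1)
      (hc _ (Finset.mem_Ioo.2 (posTriples_pos_lt hn 2)) 2)
  have hgp : Periodic3 fun q => divQuadratic ξ s q - divCubic ξ s q := fun q i => by
    simp only [divQuadratic_eq, divCubic_eq, divPair, gradTriple]
    congr 1
    · congr 1
      · congr 1 <;> refine Finset.sum_congr rfl fun n hn => ?_ <;>
        simp only [(hp n hn _).pd _ q i, (hp _ (Ioo_sub_mem hn) _).pd _ q i]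
      · refine Finset.sum_congr rfl fun n hn => ?_
        simp only [(hp n hn _).pd _ q i, (hp _ (Ioo_sub_mem hn) _).pd _ q i]
    · refine Finset.sum_congr rfl fun n hn => ?_
      simp only [(hp _ (Finset.mem_Ioo.2 (posTriples_pos_lt hn 0)) _).pd _ q i,
        (hp _ (Finset.mem_Ioo.2 (posTriples_pos_lt hn 1)) _).pd _ q i,
        (hp _ (Finset.mem_Ioo.2 (posTriples_pos_lt hn 2)) _).pd _ q i]
  have hgn : norm0 γ (fun q => divQuadratic ξ s q - divCubic ξ s q) ≠ ⊤ := by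
    refine ne_top_of_le_ne_top ?_ (norm0_divRhs_le γ ξ s)
    exact ENNReal.add_ne_top.2 ⟨ENNReal.mul_ne_top (by norm_num) hc2,
      ENNReal.mul_ne_top (by norm_num) hc3⟩
  have hg0 : ∫ q in box, (divQuadratic ξ s q - divCubic ξ s q) = 0 := by
    simp only [divQuadratic_eq, divCubic_eq]
    have hpc := fun i j => continuous_divPair hξ i j
    rw [integral_sub (integrableOn_box (by fun_prop))
      (integrableOn_box (continuous_finsetSum _ fun n hn => htc n hn)),
      integral_add (integrableOn_box (by fun_prop)) (integrableOn_box (by fun_prop)),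
      integral_add (integrableOn_box (by fun_prop)) (integrableOn_box (by fun_prop)),
      integral_divPair hξ, integral_divPair hξ, integral_divPair hξ,
      integral_finsetSum _ fun n hn => integrableOn_box (htc n hn)]
    rw [Finset.sum_eq_zero fun n hn => integral_gradTriple_eq_zero
      (hc _ (Finset.mem_Ioo.2 (posTriples_pos_lt hn 0)) 0)
      (hp _ (Finset.mem_Ioo.2 (posTriples_pos_lt hn 0)) 0)
      (hc _ (Finset.mem_Ioo.2 (posTriples_pos_lt hn 1)) 1)
      (hp _ (Finset.mem_Ioo.2 (posTriples_pos_lt hn 1)) 1)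
      (hc _ (Finset.mem_Ioo.2 (posTriples_pos_lt hn 2)) 2)
      (hp _ (Finset.mem_Ioo.2 (posTriples_pos_lt hn 2)) 2)]
    norm_num
  obtain ⟨f, hfp, hfc, hfcurl, hfdiv, hfm, hfn⟩ := exists_hodge hγ hγ1 hΘ hWp hWn hW0 hWd hgp hgn
    hg0 (if s = 1 then ∫ q in box, v₀ q else 0)
  have hbound : gradNorm γ f ≤ 2 * Θ * (if s = 1 then vecNorm0 γ (curl v₀) else 0) +
      12 * Θ * convTwo (fun n => gradNorm γ (ξ n)) s +
      6 * Θ * convThree (fun n => gradNorm γ (ξ n)) s := by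
    refine iSup_le fun i => iSup_le fun j => (hfn i j).trans ?_
    have h1 := norm0_divRhs_le γ ξ s
    have h2 := norm0_curlRhs_le γ v₀ ξ hs
    refine (add_le_add (mul_le_mul_right h1 _)
      (mul_le_mul_right (add_le_add (h2 _) (h2 _)) _)).trans (le_of_eq ?_)
    ring
  refine ⟨f, ⟨hfp, hfc, fun q => ?_, hfdiv, hfm⟩, ⟨hfp, hfc, ?_⟩, hbound⟩
  · ext i
    have h1 := curlRhs_eq v₀ ξ hs i q
    rw [← hfcurl] at h1
    rw [Pi.smul_apply, smul_eq_mul, h1, Pi.sub_apply]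
    split_ifs with h
    · rw [curl_apply]
    · rfl
  · refine ne_top_of_le_ne_top ?_ hbound
    refine ENNReal.add_ne_top.2 ⟨ENNReal.add_ne_top.2 ⟨?_, ?_⟩, ?_⟩
    · split_ifs
      · exact ENNReal.mul_ne_top (ENNReal.mul_ne_top (by norm_num) ENNReal.coe_ne_top) hωn
      · simp
    · exact ENNReal.mul_ne_top (ENNReal.mul_ne_top (by norm_num) ENNReal.coe_ne_top) hc2
    · exact ENNReal.mul_ne_top (ENNReal.mul_ne_top (by norm_num) ENNReal.coe_ne_top) hc3

lemma comp_sub (f g : E3 → E3) (k : Fin 3) :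
    comp (fun q => f q - g q) k = fun q => comp f k q - comp g k q := rfl

lemma SolvesRecurrence.unique (hs : 1 ≤ s) {f g : E3 → E3} (hf : SolvesRecurrence v₀ ξ s f)
    (hg : SolvesRecurrence v₀ ξ s g) : f = g := by
  have hs0 : (s : ℝ) ≠ 0 := by positivity
  have hfd := fun k => differentiable_of_contDiff_one (contDiff_comp (n := 1) hf.contDiff k)
  have hgd := fun k => differentiable_of_contDiff_one (contDiff_comp (n := 1) hg.contDiff k)
  have h := eq_zero_of_curl_div_mean (f := fun q => f q - g q) (hf.contDiff.sub hg.contDiff)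
    (fun q i => by simp only [hf.periodic q i, hg.periodic q i])
    (fun q i => by
      have h1 : curl f q = curl g q := by
        have := (hf.curl_eq q).trans (hg.curl_eq q).symm
        exact smul_right_injective _ hs0 this
      have h2 := congrFun h1 i
      rw [curl_apply, curl_apply] at h2
      rw [curl_apply]
      simp only [curlComp, comp_sub, pd_sub (hfd _) (hgd _)] at h2 ⊢
      linarith)
    (fun q => by
      have h1 := (hf.div_eq q).trans (hg.div_eq q).symm
      simp only [divergence, comp_sub, pd_sub (hfd _) (hgd _), Finset.sum_sub_distrib] at h1 ⊢
      linarith)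
    (by
      rw [integral_sub (integrableOn_box hf.contDiff.continuous)
        (integrableOn_box hg.contDiff.continuous), hf.mean_eq, hg.mean_eq, sub_self])
  ext1 q
  exact sub_eq_zero.1 (congrFun h q)

lemma SolvesRecurrence.congr {ξ' : ℕ → E3 → E3} (h : ∀ n < s, ξ n = ξ' n) {f : E3 → E3}
    (hf : SolvesRecurrence v₀ ξ s f) : SolvesRecurrence v₀ ξ' s f := by
  have e1 : ∀ q, curlTerm ξ s q = curlTerm ξ' s q := fun q => by
    refine Finset.sum_congr rfl fun k _ => Finset.sum_congr rfl fun n hn => ?_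
    rw [h n (Finset.mem_Ioo.1 hn).2, h (s - n) (Finset.mem_Ioo.1 (Ioo_sub_mem hn)).2]
  have e2 : ∀ q, divQuadratic ξ s q = divQuadratic ξ' s q := fun q => by
    refine Finset.sum_congr rfl fun i _ => Finset.sum_congr rfl fun j _ =>
      Finset.sum_congr rfl fun n hn => ?_
    rw [h n (Finset.mem_Ioo.1 hn).2, h (s - n) (Finset.mem_Ioo.1 (Ioo_sub_mem hn)).2]
  have e3 : ∀ q, divCubic ξ s q = divCubic ξ' s q := fun q => by
    refine Finset.sum_congr rfl fun n hn => Finset.sum_congr rfl fun σ _ => ?_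
    congr 1
    refine Finset.prod_congr rfl fun k _ => ?_
    rw [h _ (posTriples_pos_lt hn k).2]
  exact ⟨hf.periodic, hf.contDiff, fun q => by rw [← e1]; exact hf.curl_eq q,
    fun q => by rw [← e2, ← e3]; exact hf.div_eq q, hf.mean_eq⟩

end step

open Classical in
/-- The time-Taylor coefficients of the displacement, determined recursively. -/
def coeffs (v₀ : E3 → E3) (s : ℕ) : E3 → E3 :=
  if s = 0 then 0 else
    Classical.epsilon fun f => SolvesRecurrence v₀ (fun n => if n < s then coeffs v₀ n else 0) s f
termination_by s
decreasing_by assumption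

lemma coeffs_zero (v₀ : E3 → E3) : coeffs v₀ 0 = 0 := by
  rw [coeffs]; simp

lemma coeffs_spec {γ Θ : ℝ≥0} {v₀ : E3 → E3} (hγ : 0 < γ) (hγ1 : γ < 1)
    (hΘ : IsSchauderConstant γ Θ) (hv : ContDiff ℝ 1 v₀) (hvp : Periodic3 v₀)
    (hω : ∀ k, MemHolder γ fun q => curl v₀ q k) (s : ℕ) (hs : 1 ≤ s) :
    SolvesRecurrence v₀ (coeffs v₀) s (coeffs v₀ s) ∧ IsC1Holder γ (coeffs v₀ s) ∧
      gradNorm γ (coeffs v₀ s) ≤ 2 * Θ * (if s = 1 then vecNorm0 γ (curl v₀) else 0) +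
        12 * Θ * convTwo (fun n => gradNorm γ (coeffs v₀ n)) s +
        6 * Θ * convThree (fun n => gradNorm γ (coeffs v₀ n)) s := by
  induction s using Nat.strong_induction_on with
  | _ s ih =>
  have hξ : ∀ n ∈ Finset.Ioo 0 s, IsC1Holder γ (coeffs v₀ n) := fun n hn => by
    rw [Finset.mem_Ioo] at hn
    exact (ih n hn.2 hn.1).2.1
  obtain ⟨f, h1, h2, h3⟩ := exists_solvesRecurrence hγ hγ1 hΘ hv hvp hω hs hξ
  have hsol : SolvesRecurrence v₀ (coeffs v₀) s (coeffs v₀ s) := by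
    have hex : ∃ f, SolvesRecurrence v₀ (fun n => if n < s then coeffs v₀ n else 0) s f :=
      ⟨f, h1.congr fun n hn => by simp [hn]⟩
    have h4 := Classical.epsilon_spec hex
    have h5 : coeffs v₀ s = Classical.epsilon fun f =>
        SolvesRecurrence v₀ (fun n => if n < s then coeffs v₀ n else 0) s f := by
      conv_lhs => rw [coeffs]
      rw [if_neg (by omega)]
    rw [← h5] at h4
    exact h4.congr fun n hn => by simp [hn]
  rw [show coeffs v₀ s = f from hsol.unique hs h1]
  exact ⟨h1, h2, h3⟩

/-! ### The majorant cubic equation -/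

lemma sum_convTwo_le (b : ℕ → ℝ≥0∞) (N : ℕ) :
    ∑ s ∈ Finset.range (N + 1), convTwo b s ≤ (∑ n ∈ Finset.range N, b n) ^ 2 := by
  rw [sq, Finset.sum_mul_sum, ← Finset.sum_product']
  simp only [convTwo]
  rw [Finset.sum_sigma']
  have hinj : Set.InjOn (fun x : (_ : ℕ) × ℕ => (x.2, x.1 - x.2))
      ((Finset.range (N + 1)).sigma fun s => Finset.Ioo 0 s) := by
    rintro ⟨s, n⟩ h ⟨s', n'⟩ h' e
    simp only [Finset.coe_sigma, Set.mem_sigma_iff, Finset.mem_coe, Finset.mem_Ioo] at h h'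
    simp only [Prod.mk.injEq] at e
    obtain ⟨rfl, e2⟩ := e
    have : s = s' := by omega
    subst this
    rfl
  rw [← Finset.sum_image (f := fun p : ℕ × ℕ => b p.1 * b p.2) hinj]
  refine Finset.sum_le_sum_of_subset fun p hp => ?_
  obtain ⟨⟨s, n⟩, h, rfl⟩ := Finset.mem_image.1 hp
  simp only [Finset.mem_sigma, Finset.mem_range, Finset.mem_Ioo] at h
  simp only [Finset.mem_product, Finset.mem_range]
  omega

lemma sum_convThree_le (b : ℕ → ℝ≥0∞) (N : ℕ) :
    ∑ s ∈ Finset.range (N + 1), convThree b s ≤ (∑ n ∈ Finset.range N, b n) ^ 3 := by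
  have h3 : (∑ n ∈ Finset.range N, b n) ^ 3 = ∏ _k : Fin 3, ∑ n ∈ Finset.range N, b n := by
    simp
  rw [h3, Finset.prod_univ_sum]
  simp only [convThree]
  rw [Finset.sum_sigma']
  have hinj : Set.InjOn (fun x : (_ : ℕ) × (Fin 3 → ℕ) => x.2)
      ((Finset.range (N + 1)).sigma fun s => posTriples s) := by
    rintro ⟨s, n⟩ h ⟨s', n'⟩ h' e
    simp only [Finset.coe_sigma, Set.mem_sigma_iff, Finset.mem_coe, Finset.mem_filter,
      Finset.Nat.mem_antidiagonalTuple] at h h'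
    obtain rfl : n = n' := e
    have : s = s' := h.2.1.symm.trans h'.2.1
    subst this
    rfl
  rw [← Finset.sum_image (f := fun p : Fin 3 → ℕ => ∏ k, b (p k)) hinj]
  refine Finset.sum_le_sum_of_subset fun p hp => ?_
  obtain ⟨⟨s, n⟩, h, rfl⟩ := Finset.mem_image.1 hp
  rw [Finset.mem_sigma, Finset.mem_range] at h
  rw [Fintype.mem_piFinset]
  intro k
  have := (posTriples_pos_lt h.2 k).2
  rw [Finset.mem_range]
  have := h.1
  simp only at this
  omega

lemma convTwo_mul_pow (a : ℕ → ℝ≥0∞) (t : ℝ≥0∞) (s : ℕ) :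
    convTwo (fun n => a n * t ^ n) s = convTwo a s * t ^ s := by
  simp only [convTwo, Finset.sum_mul]
  refine Finset.sum_congr rfl fun n hn => ?_
  rw [mul_mul_mul_comm, ← pow_add, Nat.add_sub_cancel' (Finset.mem_Ioo.1 hn).2.le]

lemma convThree_mul_pow (a : ℕ → ℝ≥0∞) (t : ℝ≥0∞) (s : ℕ) :
    convThree (fun n => a n * t ^ n) s = convThree a s * t ^ s := by
  simp only [convThree, Finset.sum_mul]
  refine Finset.sum_congr rfl fun n hn => ?_
  rw [Finset.mem_filter, Finset.Nat.mem_antidiagonalTuple] at hn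
  rw [Finset.prod_mul_distrib, Finset.prod_pow_eq_pow_sum, hn.1]

/-- A power series whose coefficients satisfy the cubic recurrence inequality is bounded by any
supersolution of the cubic equation: a partial sum is bounded by the right-hand side at the
preceding one. -/
lemma tsum_le_of_cubic_majorant {a : ℕ → ℝ≥0∞} {ω c d t x : ℝ≥0∞} (h0 : a 0 = 0)
    (ha : ∀ s, 1 ≤ s → a s ≤ (if s = 1 then ω else 0) + c * convTwo a s + d * convThree a s)
    (hx : ω * t + c * x ^ 2 + d * x ^ 3 ≤ x) : ∑' s, a s * t ^ s ≤ x := by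
  refine ENNReal.tsum_le_of_sum_range_le fun N => ?_
  induction N with
  | zero => simp
  | succ N ih =>
    have hterm : ∀ s, a s * t ^ s ≤ (if s = 1 then ω * t else 0) +
        c * convTwo (fun n => a n * t ^ n) s + d * convThree (fun n => a n * t ^ n) s := by
      intro s
      rcases Nat.eq_zero_or_pos s with rfl | hs
      · simp [h0]
      · rw [convTwo_mul_pow, convThree_mul_pow]
        refine (mul_le_mul_left (ha s hs) _).trans (le_of_eq ?_)
        rw [add_mul, add_mul, mul_assoc, mul_assoc]
        congr 2
        split_ifs with h1
        · simp [h1]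
        · simp
    refine (Finset.sum_le_sum fun s _ => hterm s).trans ?_
    rw [Finset.sum_add_distrib, Finset.sum_add_distrib, ← Finset.mul_sum, ← Finset.mul_sum]
    refine le_trans (add_le_add (add_le_add ?_ ?_) ?_) hx
    · rw [Finset.sum_ite_eq']
      split_ifs
      · exact le_rfl
      · exact zero_le
    · exact mul_le_mul_right ((sum_convTwo_le _ N).trans (pow_le_pow_left' ih 2)) _
    · exact mul_le_mul_right ((sum_convThree_le _ N).trans (pow_le_pow_left' ih 3)) _

/-- The critical value of the majorant: the point where `x / Θ - 12 x² - 6 x³` is maximal. -/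
def critValue (Θ : ℝ) : ℝ := Real.sqrt (4 / 9 + 1 / (18 * Θ)) - 2 / 3

lemma critValue_pos {Θ : ℝ} (hΘ : 0 < Θ) : 0 < critValue Θ := by
  have h : (2 / 3 : ℝ) < Real.sqrt (4 / 9 + 1 / (18 * Θ)) := by
    refine Real.lt_sqrt_of_sq_lt ?_
    have : 0 < 1 / (18 * Θ) := by positivity
    linarith
  rw [critValue]
  linarith

lemma Qc_pos {Θ : ℝ} (hΘ : 0 < Θ) : 0 < Qc Θ := by
  have h : 2 / (3 * Θ) + 32 / 9 <
      Real.sqrt ((2 / (3 * Θ) + 32 / 9) ^ 2 + 4 / (27 * Θ ^ 2) + 2 / (81 * Θ ^ 3)) := by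
    refine Real.lt_sqrt_of_sq_lt ?_
    have h1 : 0 < 4 / (27 * Θ ^ 2) := by positivity
    have h2 : 0 < 2 / (81 * Θ ^ 3) := by positivity
    linarith
  rw [Qc]
  linarith

/-- `Q_c` is the critical value of the cubic of the majorant equation. -/
lemma Qc_eq_cubic {Θ : ℝ} (hΘ : 0 < Θ) :
    Θ * Qc Θ + 12 * Θ * critValue Θ ^ 2 + 6 * Θ * critValue Θ ^ 3 = critValue Θ := by
  have hsq : Real.sqrt (4 / 9 + 1 / (18 * Θ)) ^ 2 = 4 / 9 + 1 / (18 * Θ) :=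
    Real.sq_sqrt (by positivity)
  have hQ : Real.sqrt ((2 / (3 * Θ) + 32 / 9) ^ 2 + 4 / (27 * Θ ^ 2) + 2 / (81 * Θ ^ 3)) =
      (2 / (3 * Θ) + 16 / 3) * Real.sqrt (4 / 9 + 1 / (18 * Θ)) := by
    have e : (2 / (3 * Θ) + 32 / 9) ^ 2 + 4 / (27 * Θ ^ 2) + 2 / (81 * Θ ^ 3) =
        (2 / (3 * Θ) + 16 / 3) ^ 2 * (4 / 9 + 1 / (18 * Θ)) := by
      field_simp
      ring
    rw [e, Real.sqrt_mul (by positivity), Real.sqrt_sq (by positivity)]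
  rw [Qc, hQ, critValue]
  set y := Real.sqrt (4 / 9 + 1 / (18 * Θ)) with hy
  have hy2 : Θ * y ^ 2 = 4 / 9 * Θ + 1 / 18 := by
    rw [hsq]
    field_simp
  have h1 : Θ * ((2 / (3 * Θ) + 16 / 3) * y - 2 / (3 * Θ) - 32 / 9) =
      (2 / 3 + 16 / 3 * Θ) * y - 2 / 3 - 32 / 9 * Θ := by
    field_simp
  rw [h1]
  linear_combination (6 * y) * hy2

/-! ### Convergence before the critical time -/

section radius

variable {γ Θ : ℝ≥0} {v₀ : E3 → E3}

lemma gradNorm_zero (γ : ℝ≥0) : gradNorm γ 0 = 0 := by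
  refine le_antisymm (iSup_le fun i => iSup_le fun j => ?_) zero_le
  have : pd i (comp (0 : E3 → E3) j) = fun _ => 0 := funext fun q => pd_const 0 i q
  rw [this, norm0_zero]

/-- Before the critical time the gradients of the coefficients are summable, with a bound by the
critical value. -/
lemma tsum_gradNorm_le (hγ : 0 < γ) (hγ1 : γ < 1) (hΘ : IsSchauderConstant γ Θ)
    (hv : ContDiff ℝ 1 v₀) (hvp : Periodic3 v₀) (hω : ∀ k, MemHolder γ fun q => curl v₀ q k)
    {t : ℝ≥0∞} (ht : t < ENNReal.ofReal (Qc Θ) / (2 * vecNorm0 γ (curl v₀))) :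
    ∑' s, gradNorm γ (coeffs v₀ s) * t ^ s ≤ ENNReal.ofReal (critValue Θ) := by
  have hΘ0 : (0 : ℝ) < Θ := by exact_mod_cast hΘ.1
  have hx0 := (critValue_pos hΘ0).le
  refine tsum_le_of_cubic_majorant (ω := 2 * Θ * vecNorm0 γ (curl v₀)) (c := 12 * Θ) (d := 6 * Θ)
    ?_ (fun s hs => ?_) ?_
  · rw [coeffs_zero, gradNorm_zero]
  · refine (coeffs_spec hγ hγ1 hΘ hv hvp hω s hs).2.2.trans (le_of_eq ?_)
    rw [mul_ite, mul_zero]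
  · have h1 : t * (2 * vecNorm0 γ (curl v₀)) ≤ ENNReal.ofReal (Qc Θ) :=
      ENNReal.mul_le_of_le_div ht.le
    have h2 : 2 * Θ * vecNorm0 γ (curl v₀) * t ≤ ENNReal.ofReal (Θ * Qc Θ) := by
      rw [ENNReal.ofReal_mul hΘ0.le, ENNReal.ofReal_coe_nnreal]
      refine le_trans (le_of_eq ?_) (mul_le_mul_right h1 _)
      ring
    refine (add_le_add_left (add_le_add_left h2 _) _).trans (le_of_eq ?_)
    conv_rhs => rw [← Qc_eq_cubic hΘ0]
    have hQ := Qc_pos hΘ0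
    rw [ENNReal.ofReal_add (by positivity) (by positivity),
      ENNReal.ofReal_add (by positivity) (by positivity),
      ENNReal.ofReal_mul (p := 12 * (Θ : ℝ)) (by positivity),
      ENNReal.ofReal_mul (p := 6 * (Θ : ℝ)) (by positivity),
      ENNReal.ofReal_mul (p := 12) (by positivity), ENNReal.ofReal_mul (p := 6) (by positivity),
      ENNReal.ofReal_pow hx0, ENNReal.ofReal_pow hx0, ENNReal.ofReal_coe_nnreal]
    norm_num

lemma lipschitz_of_pd_le {f : E3 → ℝ} (hf : ContDiff ℝ 1 f) {A : ℝ}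
    (hA : ∀ i q, |pd i f q| ≤ A) (x y : E3) : |f x - f y| ≤ 3 * A * ‖x - y‖ := by
  have hA0 : 0 ≤ A := (abs_nonneg _).trans (hA 0 0)
  refine convex_univ.norm_image_sub_le_of_norm_fderiv_le (𝕜 := ℝ) (f := f)
    (fun x _ => hf.differentiable one_ne_zero x) (fun x _ => ?_) (mem_univ y) (mem_univ x)
  refine ContinuousLinearMap.opNorm_le_bound _ (by positivity) fun v => ?_
  rw [fderiv_apply_eq_sum]
  refine (norm_sum_le _ _).trans ?_
  have h : ∀ i ∈ (Finset.univ : Finset (Fin 3)), ‖v i * pd i f x‖ ≤ A * ‖v‖ := fun i _ => by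
    rw [norm_mul, mul_comm]
    exact mul_le_mul (hA i x) (PiLp.norm_apply_le v i) (norm_nonneg _) hA0
  refine (Finset.sum_le_card_nsmul _ _ _ h).trans (le_of_eq ?_)
  simp
  ring

/-- A Poincaré inequality on the torus, for the supremum norm. -/
lemma exists_poincare : ∃ K : ℝ, 0 ≤ K ∧ ∀ (f : E3 → ℝ) (A : ℝ), ContDiff ℝ 1 f → Periodic3 f →
    ∫ q in box, f q = 0 → (∀ i q, |pd i f q| ≤ A) → ∀ q, |f q| ≤ K * A := by
  obtain ⟨R, hR⟩ := isCompact_box.isBounded.subset_closedBall (0 : E3)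
  have hR0 : 0 ≤ R := by
    have := hR zero_mem_box
    rw [mem_closedBall_zero_iff, norm_zero] at this
    exact this
  refine ⟨3 * (2 * R), by positivity, fun f A hf hp h0 hA q => ?_⟩
  have hA0 : 0 ≤ A := (abs_nonneg _).trans (hA 0 0)
  obtain ⟨g, hg, hq⟩ := exists_lattice_add_mem_box q
  rw [← hp.add_lattice hg]
  have h1 : ∫ x in box, (f (q + g) - f x) = f (q + g) * volume.real box := by
    rw [integral_sub (integrableOn_box continuous_const) (integrableOn_box hf.continuous), h0]
    simp [mul_comm]
  have h2 : |∫ x in box, (f (q + g) - f x)| ≤ 3 * (2 * R) * A * volume.real box := by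
    refine norm_setIntegral_le_of_norm_le_const (f := fun x => f (q + g) - f x)
      volume_box_lt_top fun x hx => ?_
    refine (lipschitz_of_pd_le hf hA _ _).trans ?_
    have h3 := hR hq
    have h4 := hR hx
    rw [mem_closedBall_zero_iff] at h3 h4
    have h5 := norm_sub_le (q + g) x
    have : 3 * (2 * R) * A = 3 * A * (2 * R) := by ring
    rw [this]
    exact mul_le_mul_of_nonneg_left (by linarith) (by positivity)
  rw [h1, abs_mul, abs_of_pos volume_box_pos] at h2
  exact le_of_mul_le_mul_right h2 volume_box_pos

/-- Before the critical time the series of the coefficients converges absolutely in `C^{1,γ}`. -/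
lemma tsum_vecNorm1_ne_top (hγ : 0 < γ) (hγ1 : γ < 1) (hΘ : IsSchauderConstant γ Θ)
    (hv : ContDiff ℝ 1 v₀) (hvp : Periodic3 v₀) (hω : ∀ k, MemHolder γ fun q => curl v₀ q k)
    {r : ℝ≥0} (hr : (r : ℝ≥0∞) < ENNReal.ofReal (Qc Θ) / (2 * vecNorm0 γ (curl v₀))) :
    ∑' s, vecNorm1 γ (coeffs v₀ s) * (r : ℝ≥0∞) ^ s ≠ ⊤ := by
  obtain ⟨K, hK0, hK⟩ := exists_poincare
  have hgrad := ne_top_of_le_ne_top ENNReal.ofReal_ne_top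
    (tsum_gradNorm_le hγ hγ1 hΘ hv hvp hω hr)
  have hspec := coeffs_spec hγ hγ1 hΘ hv hvp hω
  obtain ⟨M, hM0, hM⟩ := (hspec 1 le_rfl).2.1.periodic.exists_bound
    (hspec 1 le_rfl).2.1.contDiff.continuous
  have hpt : ∀ (f : E3 → E3) (A : ℝ≥0∞), (∀ k q, ‖comp f k q‖ₑ ≤ A) →
      vecNorm1 γ f ≤ A + gradNorm γ f := fun f A hA => iSup_le fun k =>
    add_le_add (iSup_le fun q => hA k q) (iSup_le fun i => norm0_pd_le_gradNorm γ f i k)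
  have hterm : ∀ s, vecNorm1 γ (coeffs v₀ s) ≤
      (if s = 1 then ENNReal.ofReal M else 0) +
        (ENNReal.ofReal K + 1) * gradNorm γ (coeffs v₀ s) := by
    intro s
    rcases Nat.lt_trichotomy s 1 with hs | rfl | hs
    · obtain rfl : s = 0 := by omega
      refine (hpt _ 0 fun k q => ?_).trans ?_
      · rw [coeffs_zero]; simp [comp]
      · rw [coeffs_zero, gradNorm_zero]; simp
    · rw [if_pos rfl, add_mul, one_mul]
      refine (hpt _ (ENNReal.ofReal M) fun k q => ?_).trans (add_le_add_right le_add_self _)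
      rw [Real.enorm_eq_ofReal_abs]
      exact ENNReal.ofReal_le_ofReal ((PiLp.norm_apply_le _ k).trans (hM q))
    · obtain ⟨h1, h2, -⟩ := hspec s hs.le
      rw [if_neg (by omega), zero_add, add_mul, one_mul]
      refine hpt _ _ fun k q => ?_
      obtain ⟨A, hA⟩ : ∃ A : ℝ≥0, (A : ℝ≥0∞) = gradNorm γ (coeffs v₀ s) :=
        ⟨_, ENNReal.coe_toNNReal h2.gradNorm_ne_top⟩
      have h3 : ∀ i q, |pd i (comp (coeffs v₀ s) k) q| ≤ A := fun i q => by
        refine abs_le_of_norm0_le (γ := γ) A.coe_nonneg ?_ q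
        rw [ENNReal.ofReal_coe_nnreal, hA]
        exact norm0_pd_le_gradNorm γ _ i k
      have h4 := hK _ A (contDiff_comp (n := 1) h2.contDiff k) (h2.periodic.comp k) (by
        rw [← integral_box_apply h2.contDiff.continuous, h1.mean_eq, if_neg (by omega)]
        rfl) h3 q
      rw [Real.enorm_eq_ofReal_abs, ← hA, ← ENNReal.ofReal_coe_nnreal, ← ENNReal.ofReal_mul hK0]
      exact ENNReal.ofReal_le_ofReal h4
  refine ne_top_of_le_ne_top ?_ (ENNReal.tsum_le_tsum fun s => mul_le_mul_left (hterm s) _)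
  simp only [add_mul ((if _ = 1 then ENNReal.ofReal M else 0)), mul_assoc]
  rw [ENNReal.tsum_add, ENNReal.tsum_mul_left]
  refine ENNReal.add_ne_top.2 ⟨?_, ENNReal.mul_ne_top (by simp) hgrad⟩
  rw [tsum_eq_single 1 fun s hs => by simp [hs]]
  simp [ENNReal.mul_eq_top]

/-- The lower bound for the radius of convergence in time. -/
lemma le_timeRadius (hγ : 0 < γ) (hγ1 : γ < 1) (hΘ : IsSchauderConstant γ Θ)
    (hv : ContDiff ℝ 1 v₀) (hvp : Periodic3 v₀) (hω : ∀ k, MemHolder γ fun q => curl v₀ q k) :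
    ENNReal.ofReal (Qc Θ) / (2 * vecNorm0 γ (curl v₀)) ≤ timeRadius γ (coeffs v₀) := by
  refine ENNReal.le_of_forall_nnreal_lt fun r hr => ?_
  exact le_iSup₂_of_le r (tsum_vecNorm1_ne_top hγ hγ1 hΘ hv hvp hω hr) le_rfl

end radius

/-! ### Volume-preserving perturbations of the identity -/

lemma pd_comp_coord {F : ℝ → ℝ} {F' : ℝ} {q : E3} (h : HasDerivAt F F' (q 0)) (i : Fin 3) :
    pd i (fun q => F (q 0)) q = if i = 0 then F' else 0 := by
  have h1 : HasFDerivAt (fun q : E3 => q 0) (EuclideanSpace.proj 0 : E3 →L[ℝ] ℝ) q :=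
    (EuclideanSpace.proj 0 : E3 →L[ℝ] ℝ).hasFDerivAt
  have h2 := h.comp_hasFDerivAt q h1
  rw [show (fun q : E3 => F (q 0)) = F ∘ fun q : E3 => q 0 from rfl, pd, h2.fderiv]
  simp [basisVec, eq_comm]

/-- A Schauder constant is at least `1`: test with the cosine of one coordinate. -/
lemma IsSchauderConstant.one_le {γ Θ : ℝ≥0} (hγ1 : γ < 1) (hΘ : IsSchauderConstant γ Θ) :
    1 ≤ Θ := by
  set c : E3 → ℝ := fun q => Real.cos (q 0) with hc
  have hcd : ∀ n : ℕ, ContDiff ℝ n c := fun n => by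
    simp only [hc]
    fun_prop
  have hcp : Periodic3 c := by
    intro q i
    fin_cases i <;> simp [hc, basisVec]
  have e1 : ∀ i, pd i c = fun q => if i = 0 then -Real.sin (q 0) else 0 := fun i =>
    funext fun q => pd_comp_coord (Real.hasDerivAt_cos _) i
  have e2 : ∀ i j, pd i (pd j c) = fun q => if i = 0 ∧ j = 0 then -c q else 0 := by
    intro i j
    funext q
    rw [e1]
    by_cases hj : j = 0
    · simp only [hj, if_true, and_true]
      exact pd_comp_coord (F := fun x => -Real.sin x) (Real.hasDerivAt_sin _).neg i
    · simp only [hj, if_false, and_false]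
      exact pd_const 0 i q
  have hcn : norm0 γ (fun q => -c q) ≠ ⊤ :=
    Periodic3.norm0_ne_top hγ1 (fun q i => by simp only [hcp q i]) (hcd 1).neg
  have hlap : laplacian c = fun q => -c q := by
    funext q
    simp [laplacian, e2]
  have h0 : norm0 γ (fun q => -c q) ≠ 0 := by
    intro h
    have h1 := enorm_le_norm0 γ (fun q => -c q) 0
    rw [h] at h1
    simp [hc] at h1
  have hint : ∫ q in box, c q = 0 := by
    have h1 := integral_pd_eq_zero (contDiff_pd (hcd 2) 0) (hcp.pd 0) 0
    simp only [e2, and_self, if_true, integral_neg] at h1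
    linarith
  have h1 := hΘ.2 c ⟨hcp, hcd 2, fun i j => ?_⟩ hint 0 0
  · rw [hlap, e2] at h1
    simp only [and_self, if_true] at h1
    by_contra hlt
    rw [not_le] at hlt
    have h2 : (Θ : ℝ≥0∞) * norm0 γ (fun q => -c q) < 1 * norm0 γ (fun q => -c q) :=
      ENNReal.mul_lt_mul_left h0 hcn (by exact_mod_cast hlt)
    rw [one_mul] at h2
    exact absurd h1 (not_le.2 h2)
  · rw [e2]
    by_cases h : i = 0 ∧ j = 0
    · simp only [h, and_self, if_true]
      exact memHolder_of_norm0 hcn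
    · simp only [h, if_false]
      exact memHolder_of_norm0 (Periodic3.norm0_ne_top hγ1 (fun _ _ => rfl) contDiff_const)

/-- The critical value bounds the gradient of the displacement, so the Lagrangian map stays close to
the identity. -/
lemma critValue_le {Θ : ℝ} (hΘ : 1 ≤ Θ) : critValue Θ ≤ 1 / 20 := by
  have h : Real.sqrt (4 / 9 + 1 / (18 * Θ)) ≤ 2 / 3 + 1 / 20 := by
    rw [Real.sqrt_le_left (by norm_num)]
    have : 1 / (18 * Θ) ≤ 1 / 18 := one_div_le_one_div_of_le (by norm_num) (by linarith)
    linarith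
  simp only [critValue]
  linarith

lemma Periodic3.add_id {η : E3 → E3} (hp : Periodic3 η) (q : E3) (i : Fin 3) :
    (fun q => q + η q) (q + (2 * Real.pi) • basisVec i) =
      (fun q => q + η q) q + (2 * Real.pi) • basisVec i := by
  simp only [hp q i]
  abel

lemma det_fderiv_eq_gradTriple {Y : E3 → E3} (hY : ContDiff ℝ 1 Y) (q : E3) :
    (fderiv ℝ Y q).det = gradTriple (comp Y 0) (comp Y 1) (comp Y 2) q := by
  rw [ContinuousLinearMap.det, ← LinearMap.det_toMatrix (EuclideanSpace.basisFun (Fin 3) ℝ).toBasis,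
    Matrix.det_fin_three]
  have h : ∀ i j, LinearMap.toMatrix (EuclideanSpace.basisFun (Fin 3) ℝ).toBasis
      (EuclideanSpace.basisFun (Fin 3) ℝ).toBasis (fderiv ℝ Y q : E3 →ₗ[ℝ] E3) i j =
      pd j (comp Y i) q := by
    intro i j
    have h1 : HasFDerivAt (comp Y i)
        ((EuclideanSpace.proj i : E3 →L[ℝ] ℝ).comp (fderiv ℝ Y q)) q :=
      (EuclideanSpace.proj i : E3 →L[ℝ] ℝ).hasFDerivAt.comp q
        (hY.differentiable one_ne_zero q).hasFDerivAt
    rw [pd, h1.fderiv, LinearMap.toMatrix_apply]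
    simp [basisVec]
  simp only [h, gradTriple]
  ring

/-- A `C¹` map of Jacobian determinant `1` that differs from the identity by a periodic map with
small derivative is a measure-preserving `C¹` diffeomorphism. -/
lemma exists_inverse {η : E3 → E3} (hη : ContDiff ℝ 1 η)
    (hsmall : ∀ i k q, |pd i (comp η k) q| ≤ 1 / 20)
    (hdet : ∀ q, gradTriple (comp (fun q => q + η q) 0) (comp (fun q => q + η q) 1)
      (comp (fun q => q + η q) 2) q = 1) :
    ∃ Y : E3 ≃ₜ E3, (∀ q, Y q = q + η q) ∧ ContDiff ℝ 1 Y.symm ∧ MeasurePreserving Y := by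
  set F : E3 → E3 := fun q => q + η q with hF
  have hF1 : ContDiff ℝ 1 F := contDiff_id.add hη
  have hlip : ∀ x y, ‖η x - η y‖ ≤ 9 / 20 * ‖x - y‖ := by
    intro x y
    have h1 : ∀ k, |η x k - η y k| ≤ 3 * (1 / 20) * ‖x - y‖ := fun k =>
      lipschitz_of_pd_le (contDiff_comp (n := 1) hη k) (fun i q => hsmall i k q) x y
    have h2 : ‖η x - η y‖ ≤ ∑ k, ‖(η x - η y) k • basisVec k‖ := by
      have : η x - η y = ∑ k, (η x - η y) k • basisVec k := by
        ext j
        simp [basisVec, Pi.single_apply]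
      conv_lhs => rw [this]
      exact norm_sum_le _ _
    refine h2.trans ((Finset.sum_le_sum (g := fun _ => 3 * (1 / 20) * ‖x - y‖)
      fun k _ => ?_).trans ?_)
    · rw [norm_smul]
      simpa [basisVec] using h1 k
    · simp
      linarith
  have happ : ApproximatesLinearOn F ((ContinuousLinearEquiv.refl ℝ E3 : E3 ≃L[ℝ] E3) : E3 →L[ℝ] E3)
      univ (9 / 20 : ℝ≥0) := by
    intro x _ y _
    have : F x - F y - ((ContinuousLinearEquiv.refl ℝ E3 : E3 ≃L[ℝ] E3) : E3 →L[ℝ] E3) (x - y) =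
        η x - η y := by
      simp only [hF, ContinuousLinearEquiv.coe_refl, ContinuousLinearMap.id_apply]
      abel
    rw [this]
    simpa using hlip x y
  have hc : Subsingleton E3 ∨ (9 / 20 : ℝ≥0) <
      ‖((ContinuousLinearEquiv.refl ℝ E3).symm : E3 →L[ℝ] E3)‖₊⁻¹ := by
    right
    have : ‖((ContinuousLinearEquiv.refl ℝ E3).symm : E3 →L[ℝ] E3)‖₊ = 1 := by
      rw [← NNReal.coe_inj, coe_nnnorm]
      exact ContinuousLinearMap.norm_id
    rw [this, inv_one, ← NNReal.coe_lt_coe]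
    norm_num
  set Y := happ.toHomeomorph F hc with hY
  have hYF : ∀ q, Y q = F q := fun q => rfl
  have hd : ∀ q, (fderiv ℝ F q).det = 1 := fun q => by
    rw [det_fderiv_eq_gradTriple hF1, hdet]
  have hFd : ∀ q, HasFDerivAt F (fderiv ℝ F q) q := fun q =>
    (hF1.differentiable one_ne_zero q).hasFDerivAt
  refine ⟨Y, hYF, ?_, ?_⟩
  · refine Y.contDiff_symm (f₀' := fun a => (fderiv ℝ F a).toContinuousLinearEquivOfDetNeZero
      (by rw [hd]; exact one_ne_zero)) (fun a => ?_) hF1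
    exact hFd a
  · refine ⟨Y.continuous.measurable, Measure.ext fun s hs => ?_⟩
    rw [Measure.map_apply Y.continuous.measurable hs]
    have h1 := lintegral_abs_det_fderiv_eq_addHaar_image volume (s := Y ⁻¹' s)
      (Y.continuous.measurable hs) (fun x _ => (hFd x).hasFDerivWithinAt)
      (Y.injective.injOn : InjOn F _)
    simp only [hd, abs_one, ENNReal.ofReal_one, setLIntegral_one] at h1
    rw [h1]
    congr 1
    exact Y.surjective.image_preimage s

lemma pd_comp_map {f : E3 → ℝ} (hf : ContDiff ℝ 1 f) {X : E3 → E3} (hX : ContDiff ℝ 1 X)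
    (i : Fin 3) (q : E3) :
    pd i (fun q => f (X q)) q = ∑ l, pd i (comp X l) q * pd l f (X q) := by
  have h1 : HasFDerivAt X (fderiv ℝ X q) q := (hX.differentiable one_ne_zero q).hasFDerivAt
  have h2 := (differentiable_of_contDiff_one hf (X q)).hasFDerivAt.comp q h1
  have h3 : ∀ l, pd i (comp X l) q = fderiv ℝ X q (basisVec i) l := fun l => by
    have h4 : HasFDerivAt (comp X l)
        ((EuclideanSpace.proj l : E3 →L[ℝ] ℝ).comp (fderiv ℝ X q)) q :=
      (EuclideanSpace.proj l : E3 →L[ℝ] ℝ).hasFDerivAt.comp q h1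
    rw [pd, h4.fderiv]
    rfl
  simp only [h3]
  rw [← fderiv_apply_eq_sum, pd, show (fun q => f (X q)) = f ∘ X from rfl, h2.fderiv]
  rfl

/-- On the torus a divergence-free field is orthogonal in `L²` to gradients. -/
lemma integral_divFree_mul_pd {w : Fin 3 → E3 → ℝ} (hw : ∀ k, ContDiff ℝ 1 (w k))
    (hwp : ∀ k, Periodic3 (w k)) (hdiv : ∀ q, ∑ k, pd k (w k) q = 0) {p : E3 → ℝ}
    (hp : ContDiff ℝ 1 p) (hpp : Periodic3 p) : ∫ q in box, ∑ k, w k q * pd k p q = 0 := by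
  have hwc := fun k => (hw k).continuous
  have hpc := fun k => continuous_pd hp k
  have hwd := fun i k => continuous_pd (hw k) i
  have hc := hp.continuous
  rw [sum_integral (h := fun k q => w k q * pd k p q) fun k => by fun_prop]
  simp only [fun k => integral_mul_pd (hw k) (hwp k) hp hpp k]
  rw [Finset.sum_neg_distrib,
    ← sum_integral (h := fun k q => pd k (w k) q * p q) fun k => by fun_prop]
  simp [← Finset.sum_mul, hdiv]

/-- On the torus a divergence-free field is orthogonal in `L²` to the curl-free fields of zero
mean. -/
lemma integral_divFree_mul_curlFree {w g : Fin 3 → E3 → ℝ} (hw : ∀ k, ContDiff ℝ 1 (w k))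
    (hwp : ∀ k, Periodic3 (w k)) (hdiv : ∀ q, ∑ k, pd k (w k) q = 0)
    (hg : ∀ k, ContDiff ℝ 1 (g k)) (hgp : ∀ k, Periodic3 (g k))
    (hcurl : ∀ i q, curlComp g i q = 0) (hg0 : ∀ k, ∫ q in box, g k q = 0) :
    ∫ q in box, ∑ k, w k q * g k q = 0 := by
  have hhalf : (1 / 2 : ℝ≥0) < 1 := by rw [← NNReal.coe_lt_coe]; norm_num
  obtain ⟨Θ, hΘ⟩ := exists_isSchauderConstant (γ := 1 / 2) (by norm_num) hhalf
  -- the mean value of `w` is removed, the rest has a vector potential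
  set m : Fin 3 → ℝ := fun k => (volume.real box)⁻¹ * ∫ q in box, w k q with hm
  have hWc : ∀ k, ContDiff ℝ 1 fun q => w k q - m k := fun k => (hw k).sub contDiff_const
  have hWp : ∀ k, Periodic3 fun q => w k q - m k := fun k q i => by simp only [hwp k q i]
  have hWd : ∀ i k q, pd i (fun q => w k q - m k) q = pd i (w k) q := fun i k q => by
    rw [pd_sub (differentiable_of_contDiff_one (hw k)) (differentiable_const _), pd_const, sub_zero]
  obtain ⟨f, hfp, hf, hcf, -, -, -⟩ := exists_hodge (γ := 1 / 2) (by norm_num) hhalf hΘ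
    (W := fun k q => w k q - m k) (g := fun _ => 0) hWp
    (fun k => (hWp k).norm0_ne_top hhalf (hWc k))
    (fun k => by
      rw [integral_sub (integrableOn_box (hw k).continuous) (integrableOn_box continuous_const)]
      have := volume_box_pos.ne'
      simp only [hm, setIntegral_const, smul_eq_mul]
      field_simp
      simp)
    (fun ψ hψ hψp => by
      have h1 := integral_divFree_mul_pd hWc hWp (fun q => by simp only [hWd, hdiv])
        (hψ.of_le (m := 1) (by norm_num)) hψp
      simpa only [mul_comm] using h1)
    (fun _ _ => rfl) (Periodic3.norm0_ne_top hhalf (fun _ _ => rfl) contDiff_const)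
    (by simp) 0
  have hgc := fun k => (hg k).continuous
  have hwc := fun k => (hw k).continuous
  have h1 := integral_curlComp_mul hg hgp (fun k => contDiff_comp (n := 1) hf k)
    (fun k => hfp.comp k)
  simp only [hcurl, ← curl_apply, hcf, mul_zero, Finset.sum_const_zero, integral_zero] at h1
  have h2 : ∀ q, ∑ k, w k q * g k q = ∑ k, g k q * (w k q - m k) + ∑ k, m k * g k q := fun q => by
    rw [← Finset.sum_add_distrib]
    exact Finset.sum_congr rfl fun k _ => by ring
  simp only [h2]
  rw [integral_add (integrableOn_box (by fun_prop)) (integrableOn_box (by fun_prop)), h1,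
    sum_integral (h := fun k q => m k * g k q) fun k => by fun_prop]
  simp [integral_const_mul, hg0]

/-- The orthogonality behind the energy estimate. Let `X` be a volume-preserving diffeomorphism
of the torus, `V` a variation of `X` that preserves volume to first order, and `A` a field whose
push-forward under `X` is curl free. Then `v ∘ X - V` is orthogonal to `∇p ∘ X + A`, since after
the change of variables the first field is divergence free and the second is curl free with
constant part of zero mean. -/
lemma integral_eulerian_orthogonal {η V A v : E3 → E3} {p : E3 → ℝ} (hη : ContDiff ℝ 1 η)
    (hηp : Periodic3 η) (hsmall : ∀ i k q, |pd i (comp η k) q| ≤ 1 / 20)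
    {X : E3 → E3} (hX : X = fun q => q + η q)
    (hdet : ∀ q, gradTriple (comp X 0) (comp X 1) (comp X 2) q = 1)
    (hV : ContDiff ℝ 1 V) (hVp : Periodic3 V)
    (hVdet : ∀ q, gradTriple (comp V 0) (comp X 1) (comp X 2) q +
      gradTriple (comp X 0) (comp V 1) (comp X 2) q +
      gradTriple (comp X 0) (comp X 1) (comp V 2) q = 0)
    (hA : ContDiff ℝ 1 A) (hAp : Periodic3 A)
    (hAcurl : ∀ q i, ∑ k, crossComp (comp A k) (comp X k) i q = 0)
    (hA0 : ∀ k, ∫ q in box, comp A k q = 0)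
    (hv : ContDiff ℝ 1 v) (hvp : Periodic3 v) (hvdiv : ∀ q, divergence v q = 0)
    (hp : ContDiff ℝ 1 p) (hpp : Periodic3 p) :
    ∫ q in box, ∑ k, (v (X q) k - V q k) * (pd k p (X q) + A q k) = 0 := by
  obtain ⟨Y, hYX, hZ, hmp⟩ := exists_inverse hη hsmall (by rw [← hX]; exact hdet)
  have hYX' : ∀ q, Y q = X q := fun q => by rw [hYX, hX]
  have hX1 : ContDiff ℝ 1 X := by rw [hX]; exact contDiff_id.add hη
  have hZX : ∀ q, Y.symm (X q) = q := fun q => by rw [← hYX', Y.symm_apply_apply]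
  have hXZ : ∀ q, X (Y.symm q) = q := fun q => by rw [← hYX', Y.apply_symm_apply]
  have hYp : ∀ q i, Y (q + (2 * Real.pi) • basisVec i) = Y q + (2 * Real.pi) • basisVec i :=
    fun q i => by
      simp only [hYX]
      exact hηp.add_id q i
  have hZp : ∀ q i, Y.symm (q + (2 * Real.pi) • basisVec i) =
      Y.symm q + (2 * Real.pi) • basisVec i := fun q i => by
    rw [Y.symm_apply_eq, hYp, Y.apply_symm_apply]
  have hcov : ∀ f : E3 → ℝ, Periodic3 f → ∫ q in box, f (X q) = ∫ q in box, f q := fun f hf => by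
    simp only [← hYX']
    exact setIntegral_box_comp hf hmp Y.measurableEmbedding hYp
  -- the push-forwards
  set W : Fin 3 → E3 → ℝ := fun k q => V (Y.symm q) k with hW
  set g : Fin 3 → E3 → ℝ := fun k q => A (Y.symm q) k with hg
  have hW1 : ∀ k, ContDiff ℝ 1 (W k) := fun k => (contDiff_comp (n := 1) hV k).comp hZ
  have hg1 : ∀ k, ContDiff ℝ 1 (g k) := fun k => (contDiff_comp (n := 1) hA k).comp hZ
  have hWp : ∀ k, Periodic3 (W k) := fun k q i => by simp only [hW, hZp, hVp _ i]
  have hgp : ∀ k, Periodic3 (g k) := fun k q i => by simp only [hg, hZp, hAp _ i]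
  have hWX : ∀ k, comp V k = fun q => W k (X q) := fun k => by
    funext q; simp only [hW, hZX]; rfl
  have hgX : ∀ k, comp A k = fun q => g k (X q) := fun k => by
    funext q; simp only [hg, hZX]; rfl
  have hWd : ∀ q, ∑ k, pd k (W k) q = 0 := by
    intro q
    obtain ⟨q, rfl⟩ : ∃ q', X q' = q := ⟨_, hXZ q⟩
    have h1 := hVdet q
    have h2 := hdet q
    simp only [gradTriple, hWX, fun k i => pd_comp_map (hW1 k) hX1 i q, Fin.sum_univ_three]
      at h1 h2 ⊢
    linear_combination h1 - (pd 0 (W 0) (X q) + pd 1 (W 1) (X q) + pd 2 (W 2) (X q)) * h2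
  have hgc : ∀ i q, curlComp g i q = 0 := by
    intro j q
    obtain ⟨q, rfl⟩ : ∃ q', X q' = q := ⟨_, hXZ q⟩
    have h0 := hAcurl q 0
    have h1 := hAcurl q 1
    have h2 := hAcurl q 2
    have h3 := hdet q
    simp only [crossComp, curlComp, gradTriple, hgX, fun k i => pd_comp_map (hg1 k) hX1 i q,
      Fin.sum_univ_three] at h0 h1 h2 h3 ⊢
    simp only [show (0 : Fin 3) + 1 = 1 from rfl, show (0 : Fin 3) + 2 = 2 from rfl,
      show (1 : Fin 3) + 1 = 2 from rfl, show (1 : Fin 3) + 2 = 0 from rfl,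
      show (2 : Fin 3) + 1 = 0 from rfl, show (2 : Fin 3) + 2 = 1 from rfl] at h0 h1 h2
    fin_cases j
    · simp
      linear_combination (pd 0 (comp X 0) q) * h0 + (pd 1 (comp X 0) q) * h1 +
        (pd 2 (comp X 0) q) * h2 - (pd 1 (g 2) (X q) - pd 2 (g 1) (X q)) * h3
    · simp
      linear_combination (pd 0 (comp X 1) q) * h0 + (pd 1 (comp X 1) q) * h1 +
        (pd 2 (comp X 1) q) * h2 - (pd 2 (g 0) (X q) - pd 0 (g 2) (X q)) * h3
    · simp
      linear_combination (pd 0 (comp X 2) q) * h0 + (pd 1 (comp X 2) q) * h1 +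
        (pd 2 (comp X 2) q) * h2 - (pd 0 (g 1) (X q) - pd 1 (g 0) (X q)) * h3
  have hvc := fun k => contDiff_comp (n := 1) hv k
  have hw1 : ∀ k, ContDiff ℝ 1 fun q => comp v k q - W k q := fun k => (hvc k).sub (hW1 k)
  have hwp : ∀ k, Periodic3 fun q => comp v k q - W k q := fun k q i => by
    simp only [hWp k q i, hvp.comp k q i]
  have hwd : ∀ q, ∑ k, pd k (fun q => comp v k q - W k q) q = 0 := fun q => by
    simp only [fun k => pd_sub (differentiable_of_contDiff_one (hvc k))
      (differentiable_of_contDiff_one (hW1 k)) k q, Finset.sum_sub_distrib, hWd, sub_zero]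
    exact hvdiv q
  have e1 := integral_divFree_mul_pd hw1 hwp hwd hp hpp
  have e2 := integral_divFree_mul_curlFree hw1 hwp hwd hg1 hgp hgc (fun k => by
    rw [← hcov _ (hgp k), ← hA0 k, hgX])
  have hwcont := fun k => (hw1 k).continuous
  have hgcont := fun k => (hg1 k).continuous
  have hpcont := fun k => continuous_pd hp k
  have e3 : ∫ q in box, ∑ k, (comp v k q - W k q) * (pd k p q + g k q) = 0 := by
    simp only [mul_add, Finset.sum_add_distrib]
    rw [integral_add (f := fun q => ∑ k, (comp v k q - W k q) * pd k p q)
      (g := fun q => ∑ k, (comp v k q - W k q) * g k q)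
      (integrableOn_box (continuous_finsetSum _ fun k _ => (hwcont k).mul (hpcont k)))
      (integrableOn_box (continuous_finsetSum _ fun k _ => (hwcont k).mul (hgcont k))), e1, e2,
      add_zero]
  rw [← hcov _ (fun q i => by simp only [(hvp.comp _) q i, hWp _ q i, hpp.pd _ q i, hgp _ q i])]
    at e3
  rw [← e3]
  refine integral_congr_ae (Eventually.of_forall fun q => ?_)
  simp only [hW, hg, hZX]
  rfl

/-! ### Power series in time -/

/-- The `j`-th derivative of the monomial `t ^ s`. -/
def wt (j s : ℕ) (t : ℝ) : ℝ := s.descFactorial j * t ^ (s - j)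

lemma wt_zero (s : ℕ) (t : ℝ) : wt 0 s t = t ^ s := by simp [wt]

lemma wt_one (s : ℕ) (t : ℝ) : wt 1 s t = s * t ^ (s - 1) := by simp [wt]

lemma hasDerivAt_wt (j s : ℕ) (t : ℝ) : HasDerivAt (wt j s) (wt (j + 1) s t) t := by
  have h := (hasDerivAt_pow (s - j) t).const_mul (s.descFactorial j : ℝ)
  refine h.congr_deriv ?_
  rw [wt, Nat.descFactorial_succ, Nat.sub_sub]
  push_cast
  ring

lemma abs_wt_le {j s : ℕ} {t r : ℝ} (h : |t| ≤ r) : |wt j s t| ≤ wt j s r := by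
  rw [wt, wt, abs_mul, abs_pow, abs_of_nonneg (Nat.cast_nonneg _)]
  gcongr

section series

variable {M : ℕ → ℝ} {R : ℝ}

lemma summable_mul_wt (hM : ∀ s, 0 ≤ M s) (hMR : Summable fun s => M s * R ^ s) (j : ℕ) {t : ℝ}
    (ht : |t| < R) : Summable fun s => M s * |wt j s t| := by
  obtain ⟨r, hr, hrR⟩ := exists_between ht
  have hr0 : 0 < r := (abs_nonneg t).trans_lt hr
  have hR0 : 0 < R := hr0.trans hrR
  obtain ⟨B, hB⟩ : ∃ B, ∀ s, M s * R ^ s ≤ B := by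
    obtain ⟨B, hB⟩ := hMR.tendsto_atTop_zero.bddAbove_range
    exact ⟨B, fun s => hB ⟨s, rfl⟩⟩
  have hgeo : Summable fun s : ℕ => (s : ℝ) ^ j * (r / R) ^ s :=
    summable_pow_mul_geometric_of_norm_lt_one j (by
      rw [Real.norm_of_nonneg (by positivity)]
      exact (div_lt_one hR0).2 hrR)
  refine Summable.of_nonneg_of_le (fun s => mul_nonneg (hM s) (abs_nonneg _)) (fun s => ?_)
    (hgeo.mul_left (B * (r ^ j)⁻¹))
  refine (mul_le_mul_of_nonneg_left (abs_wt_le hr.le) (hM s)).trans ?_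
  rcases lt_or_ge s j with hs | hs
  · have hB0 : 0 ≤ B := (mul_nonneg (hM 0) (by positivity)).trans (hB 0)
    rw [wt, Nat.descFactorial_eq_zero_iff_lt.2 hs]
    simp only [Nat.cast_zero, zero_mul, mul_zero]
    positivity
  · have h1 : M s ≤ B / R ^ s := by
      rw [le_div_iff₀ (by positivity)]
      exact hB s
    have h2 : wt j s r ≤ (s : ℝ) ^ j * (r ^ s / r ^ j) := by
      rw [wt, pow_sub₀ _ hr0.ne' hs, div_eq_mul_inv]
      gcongr
      exact_mod_cast Nat.descFactorial_le_pow s j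
    have h3 : 0 ≤ wt j s r := by
      rw [wt]
      positivity
    calc M s * wt j s r ≤ B / R ^ s * ((s : ℝ) ^ j * (r ^ s / r ^ j)) :=
          mul_le_mul h1 h2 h3 ((hM s).trans h1)
      _ = _ := by
          rw [div_pow]
          field_simp

lemma summable_wt_mul (hM : ∀ s, 0 ≤ M s) (hMR : Summable fun s => M s * R ^ s) (j : ℕ) {t : ℝ}
    (ht : |t| < R) {a : ℕ → ℝ} (ha : ∀ s, |a s| ≤ M s) : Summable fun s => ‖wt j s t * a s‖ := by
  refine Summable.of_nonneg_of_le (fun s => norm_nonneg _) (fun s => ?_)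
    (summable_mul_wt hM hMR j ht)
  rw [norm_mul, mul_comm]
  exact mul_le_mul_of_nonneg_right (ha s) (abs_nonneg _)

/-- Termwise differentiation of a power series in time. -/
lemma hasDerivAt_tsum_wt (hM : ∀ s, 0 ≤ M s) (hMR : Summable fun s => M s * R ^ s) (j : ℕ) {t : ℝ}
    (ht : |t| < R) {a : ℕ → ℝ} (ha : ∀ s, |a s| ≤ M s) :
    HasDerivAt (fun t => ∑' s, wt j s t * a s) (∑' s, wt (j + 1) s t * a s) t := by
  obtain ⟨r, hr, hrR⟩ := exists_between ht
  have hr0 : 0 < r := (abs_nonneg t).trans_lt hr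
  have hrr : |r| < R := by rwa [abs_of_pos hr0]
  refine hasDerivAt_tsum_of_isPreconnected (summable_mul_wt hM hMR (j + 1) hrr) isOpen_Ioo
    (isPreconnected_Ioo (a := -r) (b := r)) (fun s τ _ => (hasDerivAt_wt j s τ).mul_const (a s))
    (fun s τ hτ => ?_) (y₀ := t) (abs_lt.1 hr) (summable_wt_mul hM hMR j ht ha).of_norm
    (abs_lt.1 hr)
  rw [norm_mul, mul_comm]
  exact mul_le_mul (ha s) ((abs_wt_le (abs_lt.2 hτ).le).trans (le_abs_self _)) (abs_nonneg _) (hM s)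

end series

/-! ### Cauchy products -/

lemma sum_range_eq_sum_Ioo {a b : ℕ → ℝ} (ha0 : a 0 = 0) (hb0 : b 0 = 0) (s : ℕ) :
    ∑ n ∈ Finset.range (s + 1), a n * b (s - n) = ∑ n ∈ Finset.Ioo 0 s, a n * b (s - n) := by
  symm
  refine Finset.sum_subset (fun n hn => ?_) fun n hn hn' => ?_
  · rw [Finset.mem_Ioo] at hn
    rw [Finset.mem_range]
    omega
  · rw [Finset.mem_range] at hn
    rw [Finset.mem_Ioo] at hn'
    rcases Nat.eq_zero_or_pos n with rfl | h
    · rw [ha0, zero_mul]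
    · obtain rfl : n = s := by omega
      rw [Nat.sub_self, hb0, mul_zero]

lemma summable_norm_cauchy_two {a b : ℕ → ℝ} (ha : Summable fun s => ‖a s‖)
    (hb : Summable fun s => ‖b s‖) (ha0 : a 0 = 0) (hb0 : b 0 = 0) :
    Summable fun s => ‖∑ n ∈ Finset.Ioo 0 s, a n * b (s - n)‖ := by
  simpa only [sum_range_eq_sum_Ioo ha0 hb0] using
    summable_norm_sum_mul_range_of_summable_norm ha hb

lemma hasSum_cauchy_two {a b : ℕ → ℝ} (ha : Summable fun s => ‖a s‖)
    (hb : Summable fun s => ‖b s‖) (ha0 : a 0 = 0) (hb0 : b 0 = 0) :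
    HasSum (fun s => ∑ n ∈ Finset.Ioo 0 s, a n * b (s - n)) ((∑' s, a s) * ∑' s, b s) := by
  rw [tsum_mul_tsum_eq_tsum_sum_range_of_summable_norm ha hb]
  simp only [sum_range_eq_sum_Ioo ha0 hb0]
  exact (summable_norm_cauchy_two ha hb ha0 hb0).of_norm.hasSum

lemma sum_posTriples (a b c : ℕ → ℝ) (s : ℕ) :
    ∑ n ∈ posTriples s, a (n 0) * b (n 1) * c (n 2) =
      ∑ m ∈ Finset.Ioo 0 s, (∑ n ∈ Finset.Ioo 0 m, a n * b (m - n)) * c (s - m) := by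
  simp only [Finset.sum_mul]
  rw [Finset.sum_sigma']
  have hmem : ∀ n : Fin 3 → ℕ, n ∈ posTriples s ↔
      n 0 + n 1 + n 2 = s ∧ 0 < n 0 ∧ 0 < n 1 ∧ 0 < n 2 := fun n => by
    rw [Finset.mem_filter, Finset.Nat.mem_antidiagonalTuple, Fin.sum_univ_three,
      Fin.forall_fin_succ, Fin.forall_fin_two]
    rfl
  refine Finset.sum_bij' (fun n _ => ⟨n 0 + n 1, n 0⟩) (fun x _ => ![x.2, x.1 - x.2, s - x.1])
    ?_ ?_ ?_ ?_ ?_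
  · intro n hn
    have := (hmem n).1 hn
    simp only [Finset.mem_sigma, Finset.mem_Ioo]
    omega
  · rintro ⟨m, n⟩ hx
    simp only [Finset.mem_sigma, Finset.mem_Ioo] at hx
    rw [hmem]
    simp
    omega
  · intro n hn
    have := (hmem n).1 hn
    ext k
    fin_cases k <;> simp <;> omega
  · rintro ⟨m, n⟩ hx
    simp only [Finset.mem_sigma, Finset.mem_Ioo] at hx
    simp
    omega
  · intro n hn
    have := (hmem n).1 hn
    simp only [Nat.add_sub_cancel_left]
    rw [show s - (n 0 + n 1) = n 2 by omega]

lemma hasSum_cauchy_three {a b c : ℕ → ℝ} (ha : Summable fun s => ‖a s‖)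
    (hb : Summable fun s => ‖b s‖) (hc : Summable fun s => ‖c s‖) (ha0 : a 0 = 0) (hb0 : b 0 = 0)
    (hc0 : c 0 = 0) :
    HasSum (fun s => ∑ n ∈ posTriples s, a (n 0) * b (n 1) * c (n 2))
      ((∑' s, a s) * (∑' s, b s) * ∑' s, c s) := by
  simp only [sum_posTriples]
  rw [← (hasSum_cauchy_two ha hb ha0 hb0).tsum_eq]
  exact hasSum_cauchy_two (summable_norm_cauchy_two ha hb ha0 hb0) hc (by simp) hc0

/-! ### Series of vector fields -/

section fields

variable {M c : ℕ → ℝ} {f : ℕ → E3 → ℝ}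

lemma summable_series (hc : Summable fun s => M s * |c s|) {a : ℕ → ℝ} (ha : ∀ s, |a s| ≤ M s) :
    Summable fun s => c s * a s := by
  refine Summable.of_norm_bounded hc fun s => ?_
  rw [norm_mul, mul_comm]
  exact mul_le_mul_of_nonneg_right (ha s) (abs_nonneg _)

lemma continuous_series (hc : Summable fun s => M s * |c s|) (hf : ∀ s, Continuous (f s))
    (hM : ∀ s q, |f s q| ≤ M s) : Continuous fun q => ∑' s, c s * f s q := by
  refine continuous_tsum (fun s => continuous_const.mul (hf s)) hc fun s q => ?_
  rw [norm_mul, mul_comm]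
  exact mul_le_mul_of_nonneg_right (hM s q) (abs_nonneg _)

/-- Termwise differentiation of a series of functions. -/
lemma hasFDerivAt_series (hc : Summable fun s => M s * |c s|) (hf : ∀ s, ContDiff ℝ 1 (f s))
    (hM : ∀ s q, |f s q| ≤ M s) (hMd : ∀ s i q, |pd i (f s) q| ≤ M s) (q : E3) :
    HasFDerivAt (fun q => ∑' s, c s * f s q)
      (∑ i, (∑' s, c s * pd i (f s) q) • (EuclideanSpace.proj i : E3 →L[ℝ] ℝ)) q := by
  have hbd : ∀ s q, ‖c s • fderiv ℝ (f s) q‖ ≤ 3 * (M s * |c s|) := fun s q => by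
    rw [norm_smul, fderiv_eq_sum, Real.norm_eq_abs]
    have h1 : ∀ i, ‖pd i (f s) q • (EuclideanSpace.proj i : E3 →L[ℝ] ℝ)‖ ≤ M s := fun i => by
      rw [norm_smul]
      have h2 : ‖(EuclideanSpace.proj i : E3 →L[ℝ] ℝ)‖ ≤ 1 :=
        ContinuousLinearMap.opNorm_le_bound _ zero_le_one fun x => by
          rw [one_mul]
          exact PiLp.norm_apply_le x i
      exact (mul_le_of_le_one_right (norm_nonneg _) h2).trans (hMd s i q)
    have h3 := (norm_sum_le Finset.univ fun i =>
      pd i (f s) q • (EuclideanSpace.proj i : E3 →L[ℝ] ℝ)).trans (Finset.sum_le_sum fun i _ => h1 i)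
    simp at h3
    calc _ ≤ |c s| * (3 * M s) := mul_le_mul_of_nonneg_left h3 (abs_nonneg _)
      _ = _ := by ring
  have h := hasFDerivAt_tsum (hc.mul_left 3)
    (fun s q => ((differentiable_of_contDiff_one (hf s) q).hasFDerivAt.const_mul (c s))) hbd
    (x₀ := q) (summable_series hc fun s => hM s q) q
  refine h.congr_fderiv ?_
  ext v
  have hs : Summable fun s => c s • fderiv ℝ (f s) q :=
    Summable.of_norm_bounded (hc.mul_left 3) fun s => hbd s q
  have h1 := (ContinuousLinearMap.apply ℝ ℝ v).map_tsum hs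
  simp only [ContinuousLinearMap.apply_apply] at h1
  rw [h1]
  simp only [smul_apply, fderiv_apply_eq_sum, sum_apply,
    smul_eq_mul, PiLp.proj_apply, Finset.mul_sum]
  rw [Summable.tsum_finsetSum fun i _ => ?_]
  · refine Finset.sum_congr rfl fun i _ => ?_
    rw [← tsum_mul_right]
    exact tsum_congr fun s => by ring
  · have := (summable_series hc fun s => hMd s i q).mul_left (v i)
    refine this.congr fun s => by ring

lemma pd_series (hc : Summable fun s => M s * |c s|) (hf : ∀ s, ContDiff ℝ 1 (f s))
    (hM : ∀ s q, |f s q| ≤ M s) (hMd : ∀ s i q, |pd i (f s) q| ≤ M s) (i : Fin 3) (q : E3) :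
    pd i (fun q => ∑' s, c s * f s q) q = ∑' s, c s * pd i (f s) q :=
  pd_eq_of_hasFDerivAt (c := fun i => ∑' s, c s * pd i (f s) q)
    (hasFDerivAt_series hc hf hM hMd q) i

lemma contDiff_series (hc : Summable fun s => M s * |c s|) (hf : ∀ s, ContDiff ℝ 1 (f s))
    (hM : ∀ s q, |f s q| ≤ M s) (hMd : ∀ s i q, |pd i (f s) q| ≤ M s) :
    ContDiff ℝ 1 fun q => ∑' s, c s * f s q := by
  have h := contDiff_succ_of_pd (n := 0) (g := fun q => ∑' s, c s * f s q)
    (fun q => (hasFDerivAt_series hc hf hM hMd q).differentiableAt) fun i => by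
      rw [funext (pd_series hc hf hM hMd i)]
      exact contDiff_zero.2 (continuous_series hc (fun s => continuous_pd (hf s) i)
        fun s q => hMd s i q)
  simpa using h

lemma integral_series (hc : Summable fun s => M s * |c s|) (hf : ∀ s, Continuous (f s))
    (hM : ∀ s q, |f s q| ≤ M s) :
    ∫ q in box, ∑' s, c s * f s q = ∑' s, c s * ∫ q in box, f s q := by
  have hb : ∀ s q, ‖c s * f s q‖ ≤ M s * |c s| := fun s q => by
    rw [norm_mul, mul_comm]
    exact mul_le_mul_of_nonneg_right (hM s q) (abs_nonneg _)
  have h := hasSum_integral_of_summable_integral_norm (μ := volume.restrict box)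
    (F := fun s q => c s * f s q) (fun s => integrableOn_box (continuous_const.mul (hf s)))
    (Summable.of_nonneg_of_le (fun s => integral_nonneg fun q => norm_nonneg _) (fun s => ?_)
      (hc.mul_right (volume.real box)))
  · rw [← h.tsum_eq]
    exact tsum_congr fun s => integral_const_mul _ _
  · refine (le_abs_self _).trans (abs_integral_box_le fun q => ?_)
    rw [abs_norm]
    exact hb s q

end fields

/-! ### The Lagrangian power series -/

/-- The `j`-th time derivative of the power series `∑ ξ s * t ^ s`. -/
def series (ξ : ℕ → E3 → E3) (j : ℕ) (t : ℝ) (q : E3) : E3 :=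
  WithLp.toLp 2 fun k => ∑' s, wt j s t * comp (ξ s) k q

/-- Solutions `ξ s` of the recurrence relations, bounded together with their first derivatives by
constants `M s` for which `∑ M s * R ^ s` converges. -/
structure IsCauchySeries (v₀ : E3 → E3) (ξ : ℕ → E3 → E3) (M : ℕ → ℝ) (R : ℝ) : Prop where
  zero : ξ 0 = 0
  solves : ∀ s, 1 ≤ s → SolvesRecurrence v₀ ξ s (ξ s)
  abs_le : ∀ s k q, |comp (ξ s) k q| ≤ M s
  abs_pd_le : ∀ s i k q, |pd i (comp (ξ s) k) q| ≤ M s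
  summable : Summable fun s => M s * R ^ s

namespace IsCauchySeries

variable {v₀ : E3 → E3} {ξ : ℕ → E3 → E3} {M : ℕ → ℝ} {R t : ℝ}

lemma nonneg (H : IsCauchySeries v₀ ξ M R) (s : ℕ) : 0 ≤ M s :=
  (abs_nonneg _).trans (H.abs_le s 0 0)

lemma contDiff_coeff (H : IsCauchySeries v₀ ξ M R) (s : ℕ) : ContDiff ℝ 1 (ξ s) := by
  rcases Nat.eq_zero_or_pos s with rfl | hs
  · rw [H.zero]
    exact contDiff_const
  · exact (H.solves s hs).contDiff

lemma contDiff_comp_coeff (H : IsCauchySeries v₀ ξ M R) (s : ℕ) (k : Fin 3) :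
    ContDiff ℝ 1 (comp (ξ s) k) :=
  contDiff_comp (n := 1) (H.contDiff_coeff s) k

lemma periodic_coeff (H : IsCauchySeries v₀ ξ M R) (s : ℕ) : Periodic3 (ξ s) := by
  rcases Nat.eq_zero_or_pos s with rfl | hs
  · rw [H.zero]
    exact fun _ _ => rfl
  · exact (H.solves s hs).periodic

lemma pd_coeff_zero (H : IsCauchySeries v₀ ξ M R) (i k : Fin 3) (q : E3) :
    pd i (comp (ξ 0) k) q = 0 := by
  have : comp (ξ 0) k = fun _ => 0 := by rw [H.zero]; rfl
  rw [this, pd_const]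

lemma summable_wt (H : IsCauchySeries v₀ ξ M R) (j : ℕ) (ht : |t| < R) :
    Summable fun s => M s * |wt j s t| :=
  summable_mul_wt H.nonneg H.summable j ht

lemma contDiff_series (H : IsCauchySeries v₀ ξ M R) (j : ℕ) (ht : |t| < R) :
    ContDiff ℝ 1 (series ξ j t) :=
  contDiff_of_comp (n := 1) fun k => EulerLagrange.contDiff_series (H.summable_wt j ht)
    (fun s => H.contDiff_comp_coeff s k) (fun s q => H.abs_le s k q)
    fun s i q => H.abs_pd_le s i k q

lemma periodic_series (H : IsCauchySeries v₀ ξ M R) (j : ℕ) (t : ℝ) :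
    Periodic3 (series ξ j t) := fun q i => by
  simp only [series, (H.periodic_coeff _).comp _ q i]

lemma pd_series (H : IsCauchySeries v₀ ξ M R) (j : ℕ) (ht : |t| < R) (i k : Fin 3) (q : E3) :
    pd i (comp (series ξ j t) k) q = ∑' s, wt j s t * pd i (comp (ξ s) k) q :=
  EulerLagrange.pd_series (H.summable_wt j ht) (fun s => H.contDiff_comp_coeff s k)
    (fun s q => H.abs_le s k q) (fun s i q => H.abs_pd_le s i k q) i q

lemma integral_comp_series (H : IsCauchySeries v₀ ξ M R) (j : ℕ) (ht : |t| < R) (k : Fin 3) :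
    ∫ q in box, comp (series ξ j t) k q = ∑' s, wt j s t * ∫ q in box, comp (ξ s) k q :=
  integral_series (H.summable_wt j ht) (fun s => (H.contDiff_comp_coeff s k).continuous)
    fun s q => H.abs_le s k q

lemma hasDerivAt_series (H : IsCauchySeries v₀ ξ M R) (j : ℕ) (ht : |t| < R) (q : E3) :
    HasDerivAt (fun t => series ξ j t q) (series ξ (j + 1) t q) t := by
  have h := hasDerivAt_pi.2 fun k : Fin 3 =>
    hasDerivAt_tsum_wt H.nonneg H.summable j ht fun s => H.abs_le s k q
  exact (PiLp.continuousLinearEquiv 2 ℝ fun _ : Fin 3 => ℝ).symm.hasFDerivAt.comp_hasDerivAt t h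

lemma eventually_abs_lt (ht : |t| < R) : ∀ᶠ τ in 𝓝 t, |τ| < R :=
  (continuous_abs.tendsto t).eventually_lt_const ht

lemma hasDerivAt_pd_series (H : IsCauchySeries v₀ ξ M R) (j : ℕ) (ht : |t| < R) (i k : Fin 3)
    (q : E3) : HasDerivAt (fun t => pd i (comp (series ξ j t) k) q)
      (pd i (comp (series ξ (j + 1) t) k) q) t := by
  rw [H.pd_series (j + 1) ht]
  refine (hasDerivAt_tsum_wt H.nonneg H.summable j ht
    fun s => H.abs_pd_le s i k q).congr_of_eventuallyEq ?_
  filter_upwards [eventually_abs_lt ht] with τ hτ using H.pd_series j hτ i k q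

/-- The position at time `t` of the particle that starts at `q`, as given by the power series. -/
def _root_.EulerLagrange.position (ξ : ℕ → E3 → E3) (t : ℝ) (q : E3) : E3 := q + series ξ 0 t q

lemma contDiff_position (H : IsCauchySeries v₀ ξ M R) (ht : |t| < R) :
    ContDiff ℝ 1 (position ξ t) :=
  contDiff_id.add (H.contDiff_series 0 ht)

lemma hasDerivAt_position (H : IsCauchySeries v₀ ξ M R) (ht : |t| < R) (q : E3) :
    HasDerivAt (fun t => position ξ t q) (series ξ 1 t q) t :=
  (H.hasDerivAt_series 0 ht q).const_add q

lemma pd_position (H : IsCauchySeries v₀ ξ M R) (ht : |t| < R) (i k : Fin 3) (q : E3) :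
    pd i (comp (position ξ t) k) q = (if i = k then 1 else 0) + pd i (comp (series ξ 0 t) k) q := by
  have h1 : HasFDerivAt (fun q : E3 => q k) (EuclideanSpace.proj k : E3 →L[ℝ] ℝ) q :=
    (EuclideanSpace.proj k : E3 →L[ℝ] ℝ).hasFDerivAt
  have h2 : pd i (fun q : E3 => q k) q = if i = k then 1 else 0 := by
    rw [pd, h1.fderiv]
    simp [basisVec, eq_comm]
  have h3 : comp (position ξ t) k = fun q => q k + comp (series ξ 0 t) k q := rfl
  rw [h3, pd_add (f := fun q => q k)
    (fun q => (EuclideanSpace.proj k : E3 →L[ℝ] ℝ).hasFDerivAt.differentiableAt)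
    (differentiable_of_contDiff_one (contDiff_comp (n := 1) (H.contDiff_series 0 ht) k)), h2]

lemma hasDerivAt_pd_position (H : IsCauchySeries v₀ ξ M R) (ht : |t| < R) (i k : Fin 3)
    (q : E3) : HasDerivAt (fun t => pd i (comp (position ξ t) k) q)
      (pd i (comp (series ξ 1 t) k) q) t := by
  refine ((H.hasDerivAt_pd_series 0 ht i k q).const_add
    (if i = k then 1 else 0)).congr_of_eventuallyEq ?_
  filter_upwards [eventually_abs_lt ht] with τ hτ using H.pd_position hτ i k q

lemma summable_norm_pd (H : IsCauchySeries v₀ ξ M R) (j : ℕ) (ht : |t| < R) (i k : Fin 3) (q : E3) :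
    Summable fun s => ‖wt j s t * pd i (comp (ξ s) k) q‖ :=
  summable_wt_mul H.nonneg H.summable j ht fun s => H.abs_pd_le s i k q

/-- The map given by the power series preserves volume: the divergence relations say that its
Jacobian determinant is `1`. -/
lemma gradTriple_position (H : IsCauchySeries v₀ ξ M R) (ht : |t| < R) (q : E3) :
    gradTriple (comp (position ξ t) 0) (comp (position ξ t) 1) (comp (position ξ t) 2) q = 1 := by
  set P : Fin 3 → Fin 3 → ℝ := fun i k => pd i (comp (series ξ 0 t) k) q with hP
  set a : Fin 3 → Fin 3 → ℕ → ℝ := fun i k s => wt 0 s t * pd i (comp (ξ s) k) q with ha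
  have haP : ∀ i k, ∑' s, a i k s = P i k := fun i k => (H.pd_series 0 ht i k q).symm
  have has : ∀ i k, Summable fun s => ‖a i k s‖ := fun i k => H.summable_norm_pd 0 ht i k q
  have ha0 : ∀ i k, a i k 0 = 0 := fun i k => by simp only [ha, H.pd_coeff_zero, mul_zero]
  have hsum : ∀ i k, HasSum (a i k) (P i k) := fun i k => by
    rw [← haP]
    exact (has i k).of_norm.hasSum
  have h2 : ∀ i j k l, HasSum (fun s => ∑ n ∈ Finset.Ioo 0 s, a i j n * a k l (s - n))
      (P i j * P k l) := fun i j k l => by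
    rw [← haP, ← haP]
    exact hasSum_cauchy_two (has _ _) (has _ _) (ha0 _ _) (ha0 _ _)
  have h3 : ∀ i j k, HasSum (fun s => ∑ n ∈ posTriples s, a i 0 (n 0) * a j 1 (n 1) * a k 2 (n 2))
      (P i 0 * P j 1 * P k 2) := fun i j k => by
    rw [← haP, ← haP, ← haP]
    exact hasSum_cauchy_three (has _ _) (has _ _) (has _ _) (ha0 _ _) (ha0 _ _) (ha0 _ _)
  have hpair : ∀ i j, HasSum (fun s => t ^ s * divPair ξ s i j q)
      (P j i * P i j - P i i * P j j) := fun i j => by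
    refine ((h2 j i i j).sub (h2 i i j j)).congr_fun fun s => ?_
    rw [divPair, ← Finset.sum_sub_distrib, Finset.mul_sum]
    refine Finset.sum_congr rfl fun n hn => ?_
    rw [Finset.mem_Ioo] at hn
    have e : t ^ s = t ^ n * t ^ (s - n) := by rw [← pow_add]; congr 1; omega
    simp only [ha, wt_zero, e]
    ring
  have htri : HasSum (fun s => t ^ s * divCubic ξ s q)
      (gradTriple (comp (series ξ 0 t) 0) (comp (series ξ 0 t) 1) (comp (series ξ 0 t) 2) q) := by
    have h4 := (((h3 0 1 2).sub (h3 0 2 1)).add ((h3 1 2 0).sub (h3 1 0 2))).add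
      ((h3 2 0 1).sub (h3 2 1 0))
    have e1 : gradTriple (comp (series ξ 0 t) 0) (comp (series ξ 0 t) 1) (comp (series ξ 0 t) 2) q
        = P 0 0 * P 1 1 * P 2 2 - P 0 0 * P 2 1 * P 1 2 +
          (P 1 0 * P 2 1 * P 0 2 - P 1 0 * P 0 1 * P 2 2) +
          (P 2 0 * P 0 1 * P 1 2 - P 2 0 * P 1 1 * P 0 2) := by
      simp only [gradTriple, hP]
      ring
    rw [e1]
    refine h4.congr_fun fun s => ?_
    simp only [← Finset.sum_sub_distrib, ← Finset.sum_add_distrib]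
    rw [divCubic_eq, Finset.mul_sum]
    refine Finset.sum_congr rfl fun n hn => ?_
    have e : t ^ s = t ^ n 0 * t ^ n 1 * t ^ n 2 := by
      rw [Finset.mem_filter, Finset.Nat.mem_antidiagonalTuple, Fin.sum_univ_three] at hn
      rw [← pow_add, ← pow_add, hn.1]
    simp only [ha, wt_zero, e, gradTriple]
    ring
  have hdiv : HasSum (fun s => t ^ s * divergence (ξ s) q) (P 0 0 + P 1 1 + P 2 2) := by
    refine (((hsum 0 0).add (hsum 1 1)).add (hsum 2 2)).congr_fun fun s => ?_
    simp only [ha, wt_zero, divergence, Fin.sum_univ_three]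
    ring
  have hrel : ∀ s, divergence (ξ s) q = divPair ξ s 0 1 q + divPair ξ s 0 2 q + divPair ξ s 1 2 q
      - divCubic ξ s q := fun s => by
    rw [← divQuadratic_eq]
    rcases Nat.eq_zero_or_pos s with rfl | hs
    · have e : posTriples 0 = ∅ := Finset.eq_empty_of_forall_notMem fun n hn =>
        absurd (posTriples_pos_lt hn 0).2 (Nat.not_lt_zero _)
      rw [divCubic_eq, e, divQuadratic_eq]
      simp [divPair, divergence, H.pd_coeff_zero]
    · exact (H.solves s hs).div_eq q
  have key := hdiv.unique (((((hpair 0 1).add (hpair 0 2)).add (hpair 1 2)).sub htri).congr_fun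
    fun s => by rw [hrel]; ring)
  simp only [gradTriple, H.pd_position ht] at key ⊢
  simp
  simp only [hP] at key
  linear_combination key

/-- Cauchy's invariants: the sum over `k` of `∇(∂ₜX_k) × ∇X_k` is the initial vorticity. -/
lemma sum_crossComp_position (H : IsCauchySeries v₀ ξ M R) (ht : |t| < R) (q : E3) (i : Fin 3) :
    ∑ k, crossComp (comp (series ξ 1 t) k) (comp (position ξ t) k) i q = curl v₀ q i := by
  set P : Fin 3 → Fin 3 → ℝ := fun i k => pd i (comp (series ξ 0 t) k) q with hP
  set Q : Fin 3 → Fin 3 → ℝ := fun i k => pd i (comp (series ξ 1 t) k) q with hQ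
  set a : Fin 3 → Fin 3 → ℕ → ℝ := fun i k s => wt 0 s t * pd i (comp (ξ s) k) q with ha
  set b : Fin 3 → Fin 3 → ℕ → ℝ := fun i k s => wt 1 s t * pd i (comp (ξ s) k) q with hb
  have haP : ∀ i k, ∑' s, a i k s = P i k := fun i k => (H.pd_series 0 ht i k q).symm
  have hbQ : ∀ i k, ∑' s, b i k s = Q i k := fun i k => (H.pd_series 1 ht i k q).symm
  have has : ∀ i k, Summable fun s => ‖a i k s‖ := fun i k => H.summable_norm_pd 0 ht i k q
  have hbs : ∀ i k, Summable fun s => ‖b i k s‖ := fun i k => H.summable_norm_pd 1 ht i k q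
  have ha0 : ∀ i k, a i k 0 = 0 := fun i k => by simp only [ha, H.pd_coeff_zero, mul_zero]
  have hb0 : ∀ i k, b i k 0 = 0 := fun i k => by simp only [hb, H.pd_coeff_zero, mul_zero]
  have hsum : ∀ i k, HasSum (b i k) (Q i k) := fun i k => by
    rw [← hbQ]
    exact (hbs i k).of_norm.hasSum
  have h2 : ∀ i j k l, HasSum (fun s => ∑ n ∈ Finset.Ioo 0 s, b i j n * a k l (s - n))
      (Q i j * P k l) := fun i j k l => by
    rw [← haP, ← hbQ]
    exact hasSum_cauchy_two (hbs _ _) (has _ _) (hb0 _ _) (ha0 _ _)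
  have hcross : HasSum (fun s => t ^ (s - 1) * curlTerm ξ s q i)
      (∑ k, (Q (i + 1) k * P (i + 2) k - Q (i + 2) k * P (i + 1) k)) := by
    refine (hasSum_sum fun k _ => (h2 (i + 1) k (i + 2) k).sub (h2 (i + 2) k (i + 1) k)).congr_fun
      fun s => ?_
    rw [curlTerm_apply, Finset.mul_sum]
    refine Finset.sum_congr rfl fun k _ => ?_
    rw [← Finset.sum_sub_distrib, Finset.mul_sum]
    refine Finset.sum_congr rfl fun n hn => ?_
    rw [Finset.mem_Ioo] at hn
    have e : t ^ (s - 1) = t ^ (n - 1) * t ^ (s - n) := by rw [← pow_add]; congr 1; omega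
    simp only [ha, hb, wt_zero, wt_one, e, crossComp]
    ring
  have hcurl : HasSum (fun s => t ^ (s - 1) * (s * curl (ξ s) q i))
      (Q (i + 1) (i + 2) - Q (i + 2) (i + 1)) := by
    refine ((hsum (i + 1) (i + 2)).sub (hsum (i + 2) (i + 1))).congr_fun fun s => ?_
    simp only [hb, wt_one, curl_apply, curlComp]
    ring
  have hω : HasSum (fun s => if s = 1 then curl v₀ q i else 0) (curl v₀ q i) :=
    hasSum_ite_eq 1 _
  have key := hω.unique ((hcurl.add hcross).congr_fun fun s => by
    rcases Nat.eq_zero_or_pos s with rfl | hs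
    · simp [curlTerm_apply]
    · have h := congrFun ((H.solves s hs).curl_eq q) i
      simp only [Pi.smul_apply, smul_eq_mul, Pi.sub_apply] at h
      rw [h]
      split_ifs with h1
      · subst h1
        simp
      · simp)
  rw [key]
  simp only [crossComp, H.pd_position ht, Fin.sum_univ_three]
  simp only [hP, hQ]
  fin_cases i <;> simp <;> ring

/-- The time derivative of the Jacobian determinant vanishes: the velocity is tangent to the
volume-preserving maps. -/
lemma gradTriple_velocity (H : IsCauchySeries v₀ ξ M R) (ht : |t| < R) (q : E3) :
    gradTriple (comp (series ξ 1 t) 0) (comp (position ξ t) 1) (comp (position ξ t) 2) q +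
      gradTriple (comp (position ξ t) 0) (comp (series ξ 1 t) 1) (comp (position ξ t) 2) q +
      gradTriple (comp (position ξ t) 0) (comp (position ξ t) 1) (comp (series ξ 1 t) 2) q = 0 := by
  have hd := fun i k => H.hasDerivAt_pd_position ht i k q
  have h1 := (((hd 0 0).mul (((hd 1 1).mul (hd 2 2)).sub ((hd 2 1).mul (hd 1 2)))).add
    ((hd 1 0).mul (((hd 2 1).mul (hd 0 2)).sub ((hd 0 1).mul (hd 2 2))))).add
    ((hd 2 0).mul (((hd 0 1).mul (hd 1 2)).sub ((hd 1 1).mul (hd 0 2))))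
  have h2 : HasDerivAt (fun _ : ℝ => (1 : ℝ)) 0 t := hasDerivAt_const _ _
  have h3 := h1.unique (h2.congr_of_eventuallyEq (by
    filter_upwards [eventually_abs_lt ht] with τ hτ using H.gradTriple_position hτ q))
  simp only [gradTriple]
  simp only [Pi.mul_apply, Pi.sub_apply] at h3
  linear_combination h3

/-- The time derivative of Cauchy's invariants vanishes: the acceleration, pushed forward by the
position map, is curl free. -/
lemma sum_crossComp_acceleration (H : IsCauchySeries v₀ ξ M R) (ht : |t| < R) (q : E3)
    (i : Fin 3) : ∑ k, crossComp (comp (series ξ 2 t) k) (comp (position ξ t) k) i q = 0 := by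
  have hd := fun i k => H.hasDerivAt_pd_position ht i k q
  have hd' := fun i k => H.hasDerivAt_pd_series 1 ht i k q
  have h1 : HasDerivAt
      (fun t => ∑ k, crossComp (comp (series ξ 1 t) k) (comp (position ξ t) k) i q) _ t :=
    HasDerivAt.fun_sum (u := Finset.univ) fun k _ =>
    ((hd' (i + 1) k).mul (hd (i + 2) k)).sub ((hd' (i + 2) k).mul (hd (i + 1) k))
  have h2 : HasDerivAt (fun _ : ℝ => curl v₀ q i) 0 t := hasDerivAt_const _ _
  have h3 := h1.unique (h2.congr_of_eventuallyEq (by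
    filter_upwards [eventually_abs_lt ht] with τ hτ using H.sum_crossComp_position hτ q i))
  rw [← h3]
  refine Finset.sum_congr rfl fun k _ => ?_
  simp only [crossComp]
  ring

lemma integral_acceleration (H : IsCauchySeries v₀ ξ M R) (ht : |t| < R) (k : Fin 3) :
    ∫ q in box, comp (series ξ 2 t) k q = 0 := by
  rw [H.integral_comp_series 2 ht]
  refine (tsum_congr fun s => ?_).trans tsum_zero
  rcases lt_or_ge s 2 with hs | hs
  · rw [wt, Nat.descFactorial_eq_zero_iff_lt.2 hs]
    simp
  · have h := (H.solves s (by omega)).mean_eq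
    rw [if_neg (by omega)] at h
    rw [← integral_box_apply (H.contDiff_coeff s).continuous, h]
    simp

lemma exists_bound_series (H : IsCauchySeries v₀ ξ M R) (j : ℕ) (ht : |t| < R) :
    ∃ B, 0 ≤ B ∧ ∀ τ, |τ| ≤ t → ∀ q, ‖series ξ j τ q‖ ≤ B := by
  have hs := H.summable_wt j ht
  set b := ∑' s, M s * |wt j s t| with hb
  have hb0 : 0 ≤ b := tsum_nonneg fun s => mul_nonneg (H.nonneg s) (abs_nonneg _)
  refine ⟨3 * b, by positivity, fun τ hτ q => ?_⟩
  have h1 : ∀ k, |series ξ j τ q k| ≤ b := fun k => by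
    refine tsum_of_norm_bounded (f := fun s => wt j s τ * comp (ξ s) k q) hs.hasSum fun s => ?_
    rw [norm_mul, mul_comm]
    exact mul_le_mul (H.abs_le s k q) ((abs_wt_le hτ).trans (le_abs_self _)) (abs_nonneg _)
      (H.nonneg s)
  have h2 : ‖series ξ j τ q‖ ≤ ∑ k, ‖(series ξ j τ q) k • basisVec k‖ := by
    have : series ξ j τ q = ∑ k, (series ξ j τ q) k • basisVec k := by
      ext j
      simp [basisVec, Pi.single_apply]
    conv_lhs => rw [this]
    exact norm_sum_le _ _
  refine h2.trans ((Finset.sum_le_sum (g := fun _ => b) fun k _ => ?_).trans ?_)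
  · rw [norm_smul]
    simpa [basisVec] using h1 k
  · simp

lemma _root_.EulerLagrange.series_one_zero (ξ : ℕ → E3 → E3) : series ξ 1 0 = ξ 1 := by
  funext q
  ext k
  change ∑' s, wt 1 s 0 * comp (ξ s) k q = comp (ξ 1) k q
  rw [tsum_eq_single 1]
  · simp [wt]
  · intro s hs
    rcases Nat.eq_zero_or_pos s with rfl | h
    · simp [wt]
    · rw [wt, zero_pow (by omega)]
      simp

lemma series_zero_zero (H : IsCauchySeries v₀ ξ M R) (q : E3) : series ξ 0 0 q = 0 := by
  ext k
  change ∑' s, wt 0 s 0 * comp (ξ s) k q = 0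
  refine (tsum_congr fun s => ?_).trans tsum_zero
  rcases Nat.eq_zero_or_pos s with rfl | h
  · rw [H.zero]
    simp [comp]
  · rw [wt_zero, zero_pow h.ne', zero_mul]

lemma hasSum_series (H : IsCauchySeries v₀ ξ M R) (ht : |t| < R) (q : E3) :
    HasSum (fun s => t ^ s • ξ s q) (series ξ 0 t q) := by
  have h : HasSum (fun s => fun k : Fin 3 => wt 0 s t * comp (ξ s) k q)
      (fun k => ∑' s, wt 0 s t * comp (ξ s) k q) := Pi.hasSum.2 fun k =>
    (summable_series (H.summable_wt 0 ht) fun s => H.abs_le s k q).hasSum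
  have h2 := ((PiLp.continuousLinearEquiv 2 ℝ fun _ : Fin 3 => ℝ).symm :
    (Fin 3 → ℝ) →L[ℝ] E3).hasSum h
  refine h2.congr_fun fun s => ?_
  ext k
  simp [wt_zero, comp]

end IsCauchySeries

/-! ### Classical Euler flows -/

/-- The derivative of the velocity of a flow in space and time jointly. -/
def velocityDeriv (T : ℝ) (v : ℝ → E3 → E3) (z : ℝ × E3) : ℝ × E3 →L[ℝ] E3 :=
  fderivWithin ℝ (fun z : ℝ × E3 => v z.1 z.2) (Ico 0 T ×ˢ univ) z

lemma gradient_apply (p : E3 → ℝ) (x : E3) (k : Fin 3) : gradient p x k = pd k p x := by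
  have h : inner ℝ (gradient p x) (basisVec k) = fderiv ℝ p x (basisVec k) := by
    rw [gradient, InnerProductSpace.toDual_symm_apply]
  rw [pd, ← h, basisVec, EuclideanSpace.inner_single_right]
  simp

namespace IsEulerFlow

variable {T t : ℝ} {v : ℝ → E3 → E3} {p : ℝ → E3 → ℝ}

lemma uniqueDiffOn : UniqueDiffOn ℝ (Ico 0 T ×ˢ (univ : Set E3)) :=
  (uniqueDiffOn_Ico 0 T).prod uniqueDiffOn_univ

lemma continuousOn_velocity (h : IsEulerFlow T v p) :
    ContinuousOn (fun z : ℝ × E3 => v z.1 z.2) (Ico 0 T ×ˢ univ) :=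
  h.contDiff_velocity.continuousOn

lemma continuousOn_velocityDeriv (h : IsEulerFlow T v p) :
    ContinuousOn (velocityDeriv T v) (Ico 0 T ×ˢ univ) :=
  h.contDiff_velocity.continuousOn_fderivWithin uniqueDiffOn le_rfl

lemma hasFDerivWithinAt (h : IsEulerFlow T v p) (ht : t ∈ Ico 0 T) (x : E3) :
    HasFDerivWithinAt (fun z : ℝ × E3 => v z.1 z.2) (velocityDeriv T v (t, x))
      (Ico 0 T ×ˢ univ) (t, x) :=
  ((h.contDiff_velocity.differentiableOn one_ne_zero) (t, x) ⟨ht, mem_univ _⟩).hasFDerivWithinAt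

lemma contDiff_slice (h : IsEulerFlow T v p) (ht : t ∈ Ico 0 T) : ContDiff ℝ 1 (v t) := by
  have h1 : ContDiff ℝ 1 fun x : E3 => (t, x) := contDiff_const.prodMk contDiff_id
  exact contDiffOn_univ.1 (h.contDiff_velocity.comp (s := univ) h1.contDiffOn
    fun x _ => ⟨ht, mem_univ _⟩)

lemma hasFDerivAt_slice (h : IsEulerFlow T v p) (ht : t ∈ Ico 0 T) (x : E3) :
    HasFDerivAt (v t) ((velocityDeriv T v (t, x)).comp (ContinuousLinearMap.inr ℝ ℝ E3)) x := by
  have h1 := (h.hasFDerivWithinAt ht x).comp (s := univ) (g := fun z : ℝ × E3 => v z.1 z.2)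
    (f := fun x : E3 => (t, x)) x
    (hasFDerivAt_prodMk_right t x).hasFDerivWithinAt fun y _ => ⟨ht, mem_univ _⟩
  exact hasFDerivWithinAt_univ.1 h1

lemma fderiv_slice (h : IsEulerFlow T v p) (ht : t ∈ Ico 0 T) (x y : E3) :
    fderiv ℝ (v t) x y = velocityDeriv T v (t, x) (0, y) := by
  rw [(h.hasFDerivAt_slice ht x).fderiv]
  rfl

lemma velocityDeriv_time (h : IsEulerFlow T v p) (ht : t ∈ Ico 0 T) (x : E3) :
    velocityDeriv T v (t, x) (1, 0) =
      -velocityDeriv T v (t, x) (0, v t x) - gradient (p t) x := by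
  have h1 := (h.hasFDerivWithinAt ht x).comp_hasDerivWithinAt (s := Ico 0 T) t
    (f := fun τ : ℝ => (τ, x)) ((hasDerivWithinAt_id t _).prodMk (hasDerivWithinAt_const t _ x))
    fun τ hτ => ⟨hτ, mem_univ _⟩
  have h2 := h.momentum t ht x
  rw [← h.fderiv_slice ht]
  exact (uniqueDiffOn_Ico 0 T t ht).eq_deriv _ h1 h2

lemma velocityDeriv_apply (h : IsEulerFlow T v p) (ht : t ∈ Ico 0 T) (x w : E3) :
    velocityDeriv T v (t, x) (1, w) =
      -velocityDeriv T v (t, x) (0, v t x - w) - gradient (p t) x := by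
  have e1 : ((1 : ℝ), w) = (1, 0) + (0, w) := by simp
  have e2 : ((0 : ℝ), v t x - w) = (0, v t x) - (0, w) := by simp
  rw [e1, e2, map_add, map_sub, h.velocityDeriv_time ht]
  abel

lemma exists_bound (h : IsEulerFlow T v p) (htT : t < T) (C : ℝ) :
    ∃ L, 0 ≤ L ∧ ∀ τ ∈ Icc 0 t, ∀ x, ‖x‖ ≤ C →
      ‖v τ x‖ ≤ L ∧ ‖velocityDeriv T v (τ, x)‖ ≤ L := by
  have hK : IsCompact (Icc 0 t ×ˢ Metric.closedBall (0 : E3) C) :=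
    isCompact_Icc.prod (isCompact_closedBall _ _)
  have hKS : Icc 0 t ×ˢ Metric.closedBall (0 : E3) C ⊆ Ico 0 T ×ˢ univ :=
    prod_mono (Icc_subset_Ico_right htT) (subset_univ _)
  obtain ⟨L1, hL1⟩ := hK.exists_bound_of_continuousOn (h.continuousOn_velocity.mono hKS)
  obtain ⟨L2, hL2⟩ := hK.exists_bound_of_continuousOn (h.continuousOn_velocityDeriv.mono hKS)
  refine ⟨max 0 (max L1 L2), le_max_left _ _, fun τ hτ x hx => ⟨?_, ?_⟩⟩
  · exact (hL1 (τ, x) ⟨hτ, by simpa using hx⟩).trans ((le_max_left _ _).trans (le_max_right _ _))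
  · exact (hL2 (τ, x) ⟨hτ, by simpa using hx⟩).trans ((le_max_right _ _).trans (le_max_right _ _))

end IsEulerFlow

/-! ### The energy estimate -/

lemma exists_norm_le_of_mem_box : ∃ C : ℝ, ∀ q ∈ box, ‖q‖ ≤ C :=
  isCompact_box.isBounded.exists_norm_le

section energy

variable {T t : ℝ} {v : ℝ → E3 → E3} {p : ℝ → E3 → ℝ} {v₀ : E3 → E3} {ξ : ℕ → E3 → E3} {M : ℕ → ℝ}
  {R : ℝ}

/-- The difference of the Euler velocity along the trajectories of the power series and the
velocity of these trajectories. -/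
def defect (v : ℝ → E3 → E3) (ξ : ℕ → E3 → E3) (t : ℝ) (q : E3) : E3 :=
  v t (position ξ t q) - series ξ 1 t q

/-- The time derivative of the defect, by the Euler equations. -/
def defectDeriv (T : ℝ) (v : ℝ → E3 → E3) (p : ℝ → E3 → ℝ) (ξ : ℕ → E3 → E3) (t : ℝ) (q : E3) :
    E3 :=
  -velocityDeriv T v (t, position ξ t q) (0, defect v ξ t q) -
    gradient (p t) (position ξ t q) - series ξ 2 t q

lemma continuous_gradient {p : E3 → ℝ} (hp : ContDiff ℝ 1 p) : Continuous (gradient p) :=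
  (InnerProductSpace.toDual ℝ E3).symm.continuous.comp (hp.continuous_fderiv one_ne_zero)

lemma continuous_position (H : IsCauchySeries v₀ ξ M R) (htR : |t| < R) :
    Continuous (position ξ t) := (H.contDiff_position htR).continuous

lemma continuous_defect (H : IsCauchySeries v₀ ξ M R) (hE : IsEulerFlow T v p) (ht : t ∈ Ico 0 T)
    (htR : |t| < R) : Continuous (defect v ξ t) :=
  ((hE.contDiff_slice ht).continuous.comp (continuous_position H htR)).sub
    (H.contDiff_series 1 htR).continuous

lemma continuous_velocityDeriv_defect (H : IsCauchySeries v₀ ξ M R) (hE : IsEulerFlow T v p)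
    (ht : t ∈ Ico 0 T) (htR : |t| < R) :
    Continuous fun q => velocityDeriv T v (t, position ξ t q) (0, defect v ξ t q) := by
  refine Continuous.clm_apply ?_ (continuous_const.prodMk (continuous_defect H hE ht htR))
  exact hE.continuousOn_velocityDeriv.comp_continuous
    (continuous_const.prodMk (continuous_position H htR)) fun q => ⟨ht, mem_univ _⟩

lemma continuous_defectDeriv (H : IsCauchySeries v₀ ξ M R) (hE : IsEulerFlow T v p)
    (ht : t ∈ Ico 0 T) (htR : |t| < R) : Continuous (defectDeriv T v p ξ t) :=
  ((continuous_velocityDeriv_defect H hE ht htR).neg.sub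
    ((continuous_gradient (hE.contDiff_pressure t ht)).comp (continuous_position H htR))).sub
    (H.contDiff_series 2 htR).continuous

lemma periodic_defect (H : IsCauchySeries v₀ ξ M R) (hE : IsEulerFlow T v p) (ht : t ∈ Ico 0 T) :
    Periodic3 (defect v ξ t) := fun q i => by
  have h1 : position ξ t (q + (2 * Real.pi) • basisVec i) =
      position ξ t q + (2 * Real.pi) • basisVec i := (H.periodic_series 0 t).add_id q i
  rw [defect, h1, hE.periodic_velocity t ht, H.periodic_series 1 t, ← defect]

lemma hasDerivAt_defect (H : IsCauchySeries v₀ ξ M R) (hE : IsEulerFlow T v p) (ht : t ∈ Ioo 0 T)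
    (htR : |t| < R) (q : E3) :
    HasDerivAt (fun t => defect v ξ t q) (defectDeriv T v p ξ t q) t := by
  have ht' : t ∈ Ico 0 T := Ioo_subset_Ico_self ht
  have h1 : HasFDerivAt (fun z : ℝ × E3 => v z.1 z.2) (velocityDeriv T v (t, position ξ t q))
      (t, position ξ t q) :=
    (hE.hasFDerivWithinAt ht' _).hasFDerivAt (prod_mem_nhds (Ico_mem_nhds ht.1 ht.2) univ_mem)
  have h2 := h1.comp_hasDerivAt t (f := fun t => (t, position ξ t q))
    ((hasDerivAt_id t).prodMk (H.hasDerivAt_position htR q))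
  have h3 := h2.sub (H.hasDerivAt_series 1 htR q)
  refine h3.congr_deriv ?_
  rw [hE.velocityDeriv_apply ht']
  rfl

lemma continuousOn_defect (H : IsCauchySeries v₀ ξ M R) (hE : IsEulerFlow T v p) (htT : t < T)
    (htR : t < R) (q : E3) : ContinuousOn (fun t => defect v ξ t q) (Icc 0 t) := by
  have hR : ∀ τ ∈ Icc 0 t, |τ| < R := fun τ hτ => by
    rw [abs_of_nonneg hτ.1]
    exact hτ.2.trans_lt htR
  have h1 : ContinuousOn (fun τ => position ξ τ q) (Icc 0 t) := fun τ hτ =>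
    (H.hasDerivAt_position (hR τ hτ) q).continuousAt.continuousWithinAt
  have h2 : ContinuousOn (fun τ => series ξ 1 τ q) (Icc 0 t) := fun τ hτ =>
    (H.hasDerivAt_series 1 (hR τ hτ) q).continuousAt.continuousWithinAt
  exact (hE.continuousOn_velocity.comp (continuousOn_id.prodMk h1) fun τ hτ =>
    ⟨Icc_subset_Ico_right htT hτ, mem_univ _⟩).sub h2

/-- In the time derivative of the energy of the defect only the term with the velocity gradient
survives. -/
lemma integral_inner_defectDeriv (H : IsCauchySeries v₀ ξ M R) (hE : IsEulerFlow T v p)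
    (ht : t ∈ Ico 0 T) (htR : |t| < R)
    (hsmall : ∀ i k q, |pd i (comp (series ξ 0 t) k) q| ≤ 1 / 20) :
    ∫ q in box, 2 * inner ℝ (defect v ξ t q) (defectDeriv T v p ξ t q) =
      ∫ q in box, -2 * inner ℝ (defect v ξ t q)
        (velocityDeriv T v (t, position ξ t q) (0, defect v ξ t q)) := by
  have horth := integral_eulerian_orthogonal (H.contDiff_series 0 htR) (H.periodic_series 0 t)
    hsmall (X := position ξ t) rfl (H.gradTriple_position htR) (H.contDiff_series 1 htR)
    (H.periodic_series 1 t) (H.gradTriple_velocity htR) (H.contDiff_series 2 htR)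
    (H.periodic_series 2 t) (H.sum_crossComp_acceleration htR) (H.integral_acceleration htR)
    (hE.contDiff_slice ht) (hE.periodic_velocity t ht) (hE.incompressible t ht)
    (hE.contDiff_pressure t ht) (hE.periodic_pressure t ht)
  have hu := continuous_defect H hE ht htR
  have hD := continuous_velocityDeriv_defect H hE ht htR
  have hG := ((continuous_gradient (hE.contDiff_pressure t ht)).comp
    (continuous_position H htR)).add (H.contDiff_series 2 htR).continuous
  have e1 : ∀ q, 2 * inner ℝ (defect v ξ t q) (defectDeriv T v p ξ t q) =
      -2 * inner ℝ (defect v ξ t q) (velocityDeriv T v (t, position ξ t q) (0, defect v ξ t q)) -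
      2 * inner ℝ (defect v ξ t q) (gradient (p t) (position ξ t q) + series ξ 2 t q) := fun q => by
    rw [defectDeriv, sub_sub, inner_sub_right, inner_neg_right]
    ring
  have e2 : ∫ q in box, 2 * inner ℝ (defect v ξ t q)
      (gradient (p t) (position ξ t q) + series ξ 2 t q) = 0 := by
    rw [integral_const_mul, mul_eq_zero]
    right
    rw [← horth]
    refine integral_congr_ae (Eventually.of_forall fun q => ?_)
    simp only [PiLp.inner_apply]
    refine Finset.sum_congr rfl fun k _ => ?_
    rw [← gradient_apply]
    simp [defect, mul_comm]
  simp only [e1]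
  rw [integral_sub, e2, sub_zero]
  · exact integrableOn_box (continuous_const.mul (hu.inner hD))
  · exact integrableOn_box (continuous_const.mul (hu.inner hG))

/-- The trajectories of the power series move with the Euler velocity: the energy of the defect
vanishes initially and satisfies a Grönwall inequality. -/
theorem defect_eq_zero (H : IsCauchySeries v₀ ξ M R) (hξ : ξ 1 = v₀) (hE : IsEulerFlow T v p)
    (h0 : v 0 = v₀) (htT : t < T) (htR : t < R)
    (hsmall : ∀ τ ∈ Icc 0 t, ∀ i k q, |pd i (comp (series ξ 0 τ) k) q| ≤ 1 / 20)
    {τ : ℝ} (hτ : τ ∈ Icc 0 t) (q : E3) : defect v ξ τ q = 0 := by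
  have hR : ∀ τ ∈ Icc 0 t, |τ| < R := fun τ hτ => by
    rw [abs_of_nonneg hτ.1]
    exact hτ.2.trans_lt htR
  have hT : ∀ τ ∈ Icc 0 t, τ ∈ Ico 0 T := fun τ hτ => Icc_subset_Ico_right htT hτ
  have ht0 : 0 ≤ t := hτ.1.trans hτ.2
  have habs : |t| < R := hR t ⟨ht0, le_rfl⟩
  obtain ⟨C, hC⟩ := exists_norm_le_of_mem_box
  obtain ⟨B0, hB0, hB0'⟩ := H.exists_bound_series 0 habs
  obtain ⟨B1, hB1, hB1'⟩ := H.exists_bound_series 1 habs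
  obtain ⟨L, hL, hL'⟩ := hE.exists_bound htT (C + B0)
  have hle : ∀ τ ∈ Icc 0 t, |τ| ≤ t := fun τ hτ => by
    rw [abs_of_nonneg hτ.1]
    exact hτ.2
  have hX : ∀ τ ∈ Icc 0 t, ∀ q ∈ box, ‖position ξ τ q‖ ≤ C + B0 := fun τ hτ q hq =>
    (norm_add_le _ _).trans (add_le_add (hC q hq) (hB0' τ (hle τ hτ) q))
  have hub : ∀ τ ∈ Icc 0 t, ∀ q ∈ box, ‖defect v ξ τ q‖ ≤ L + B1 := fun τ hτ q hq =>
    (norm_sub_le _ _).trans (add_le_add (hL' τ hτ _ (hX τ hτ q hq)).1 (hB1' τ (hle τ hτ) q))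
  obtain ⟨B2, hB2, hB2'⟩ := H.exists_bound_series 2 habs
  have hud : ∀ τ ∈ Icc 0 t, ∀ q ∈ box, ‖defectDeriv T v p ξ τ q‖ ≤ L * (1 + B1) + B2 := by
    intro τ hτ q hq
    have e : defectDeriv T v p ξ τ q =
        velocityDeriv T v (τ, position ξ τ q) (1, series ξ 1 τ q) - series ξ 2 τ q := by
      rw [hE.velocityDeriv_apply (hT τ hτ)]
      rfl
    rw [e]
    refine (norm_sub_le _ _).trans (add_le_add ?_ (hB2' τ (hle τ hτ) q))
    refine (ContinuousLinearMap.le_opNorm _ _).trans (mul_le_mul (hL' τ hτ _ (hX τ hτ q hq)).2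
      ?_ (norm_nonneg _) hL)
    rw [Prod.norm_mk, norm_one]
    exact max_le (by linarith) ((hB1' τ (hle τ hτ) q).trans (by linarith))
  set e : ℝ → ℝ := fun τ => ∫ q in box, ‖defect v ξ τ q‖ ^ 2 with he
  have hmem : ∀ᵐ q ∂(volume.restrict box), q ∈ box := ae_restrict_mem measurableSet_box
  have hcont : ContinuousOn e (Icc 0 t) := by
    refine continuousOn_of_dominated (bound := fun _ => (L + B1) ^ 2)
      (fun τ hτ => ((continuous_defect H hE (hT τ hτ) (hR τ hτ)).norm.pow 2).aestronglyMeasurable)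
      (fun τ hτ => hmem.mono fun q hq => ?_) (integrable_const _)
      (Eventually.of_forall fun q => (continuousOn_defect H hE htT htR q).norm.pow 2)
    rw [norm_pow, norm_norm]
    exact pow_le_pow_left₀ (norm_nonneg _) (hub τ hτ q hq) 2
  have hderiv : ∀ τ ∈ Ioo 0 t, HasDerivAt e (∫ q in box, 2 * inner ℝ (defect v ξ τ q)
      (defectDeriv T v p ξ τ q)) τ := by
    intro τ hτ
    have hτ' := Ioo_subset_Icc_self hτ
    have hu := continuous_defect H hE (hT τ hτ') (hR τ hτ')
    refine (hasDerivAt_integral_of_dominated_loc_of_deriv_le (μ := volume.restrict box)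
      (F := fun τ q => ‖defect v ξ τ q‖ ^ 2)
      (F' := fun τ q => 2 * inner ℝ (defect v ξ τ q) (defectDeriv T v p ξ τ q)) (s := Ioo 0 t)
      (bound := fun _ => 2 * ((L + B1) * (L * (1 + B1) + B2)))
      (Ioo_mem_nhds hτ.1 hτ.2) ?_ (integrableOn_box (hu.norm.pow 2)) ?_
      (hmem.mono fun q hq σ hσ => ?_) (integrable_const _)
      (Eventually.of_forall fun q σ hσ => ?_)).2
    · filter_upwards [Ioo_mem_nhds hτ.1 hτ.2] with σ hσ
      have hσ' := Ioo_subset_Icc_self hσ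
      exact ((continuous_defect H hE (hT σ hσ') (hR σ hσ')).norm.pow 2).aestronglyMeasurable
    · exact (continuous_const.mul (hu.inner
        (continuous_defectDeriv H hE (hT τ hτ') (hR τ hτ')))).aestronglyMeasurable
    · have hσ' := Ioo_subset_Icc_self hσ
      rw [norm_mul, Real.norm_two]
      refine mul_le_mul_of_nonneg_left ((norm_inner_le_norm _ _).trans ?_) zero_le_two
      exact mul_le_mul (hub σ hσ' q hq) (hud σ hσ' q hq) (norm_nonneg _) (by linarith)
    · have hσ' := Ioo_subset_Icc_self hσ
      exact (hasDerivAt_defect H hE ⟨hσ.1, hσ.2.trans htT⟩ (hR σ hσ') q).norm_sq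
  have hineq : ∀ τ ∈ Ioo 0 t, ∫ q in box, 2 * inner ℝ (defect v ξ τ q)
      (defectDeriv T v p ξ τ q) ≤ 2 * L * e τ := by
    intro τ hτ
    have hτ' := Ioo_subset_Icc_self hτ
    have hu := continuous_defect H hE (hT τ hτ') (hR τ hτ')
    have hD := continuous_velocityDeriv_defect H hE (hT τ hτ') (hR τ hτ')
    rw [integral_inner_defectDeriv H hE (hT τ hτ') (hR τ hτ') (hsmall τ hτ'), he,
      ← integral_const_mul]
    refine setIntegral_mono_on (integrableOn_box (continuous_const.mul (hu.inner hD)))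
      (integrableOn_box (continuous_const.mul (hu.norm.pow 2))) measurableSet_box fun q hq => ?_
    have h1 := neg_le_of_abs_le (abs_real_inner_le_norm (defect v ξ τ q)
      (velocityDeriv T v (τ, position ξ τ q) (0, defect v ξ τ q)))
    have h2 : ‖velocityDeriv T v (τ, position ξ τ q) (0, defect v ξ τ q)‖ ≤
        L * ‖defect v ξ τ q‖ := by
      refine (ContinuousLinearMap.le_opNorm _ _).trans ?_
      rw [Prod.norm_mk, norm_zero, max_eq_right (norm_nonneg _)]
      exact mul_le_mul_of_nonneg_right (hL' τ hτ' _ (hX τ hτ' q hq)).2 (norm_nonneg _)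
    have h3 := mul_le_mul_of_nonneg_left h2 (norm_nonneg (defect v ξ τ q))
    nlinarith
  have hexp : ∀ τ, HasDerivAt (fun τ => Real.exp (-(2 * L) * τ))
      (Real.exp (-(2 * L) * τ) * (-(2 * L))) τ := fun τ => by
    simpa using ((hasDerivAt_id τ).const_mul (-(2 * L))).exp
  have hanti : AntitoneOn (fun τ => e τ * Real.exp (-(2 * L) * τ)) (Icc 0 t) := by
    have hd : ∀ τ ∈ Ioo 0 t, HasDerivAt (fun τ => e τ * Real.exp (-(2 * L) * τ)) _ τ :=
      fun τ hτ => (hderiv τ hτ).mul (hexp τ)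
    refine antitoneOn_of_deriv_nonpos (convex_Icc 0 t)
      (hcont.mul (by fun_prop)) ?_ ?_
    · rw [interior_Icc]
      exact fun τ hτ => (hd τ hτ).differentiableAt.differentiableWithinAt
    · rw [interior_Icc]
      intro τ hτ
      rw [(hd τ hτ).deriv]
      have h1 := mul_le_mul_of_nonneg_right (hineq τ hτ) (Real.exp_pos (-(2 * L) * τ)).le
      linarith
  have he0 : e 0 = 0 := by
    have h1 : ∀ q, defect v ξ 0 q = 0 := fun q => by
      rw [defect, position, IsCauchySeries.series_zero_zero H, series_one_zero, h0, hξ, add_zero,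
        sub_self]
    simp [he, h1]
  have heτ : e τ = 0 := by
    have h1 := hanti ⟨le_rfl, ht0⟩ hτ hτ.1
    simp only [he0, zero_mul] at h1
    exact le_antisymm (nonpos_of_mul_nonpos_left h1 (Real.exp_pos _))
      (integral_nonneg fun q => sq_nonneg _)
  have h1 := Periodic3.eq_zero_of_integral_sq (f := fun q => ‖defect v ξ τ q‖)
    (fun q i => by simp only [periodic_defect H hE (hT τ hτ) q i])
    (continuous_defect H hE (hT τ hτ) (hR τ hτ)).norm heτ
  exact norm_eq_zero.1 (congrFun h1 q)

/-- The displacement of the Euler flow is the sum of the power series. -/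
theorem displacement_eq_series (H : IsCauchySeries v₀ ξ M R) (hξ : ξ 1 = v₀)
    (hE : IsEulerFlow T v p) (h0 : v 0 = v₀) {d : ℝ → E3 → E3} (hd : IsDisplacement T v d)
    (ht0 : 0 ≤ t) (htT : t < T) (htR : t < R)
    (hsmall : ∀ τ ∈ Icc 0 t, ∀ i k q, |pd i (comp (series ξ 0 τ) k) q| ≤ 1 / 20) (q : E3) :
    d t q = series ξ 0 t q := by
  have hR : ∀ τ ∈ Icc 0 t, |τ| < R := fun τ hτ => by
    rw [abs_of_nonneg hτ.1]
    exact hτ.2.trans_lt htR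
  have hT : ∀ τ ∈ Icc 0 t, τ ∈ Ico 0 T := fun τ hτ => Icc_subset_Ico_right htT hτ
  have hf : ∀ τ ∈ Icc 0 t, HasDerivAt (fun τ => position ξ τ q) (v τ (position ξ τ q)) τ :=
    fun τ hτ => by
      rw [sub_eq_zero.1 (defect_eq_zero H hξ hE h0 htT htR hsmall hτ q)]
      exact H.hasDerivAt_position (hR τ hτ) q
  have hg : ∀ τ ∈ Icc 0 t, HasDerivWithinAt (fun τ => q + d τ q) (v τ (q + d τ q)) (Ico 0 T) τ :=
    fun τ hτ => (hd.trajectory τ (hT τ hτ) q).const_add q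
  have hfc : ContinuousOn (fun τ => position ξ τ q) (Icc 0 t) := fun τ hτ =>
    (hf τ hτ).continuousAt.continuousWithinAt
  have hgc : ContinuousOn (fun τ => q + d τ q) (Icc 0 t) := fun τ hτ =>
    (hg τ hτ).continuousWithinAt.mono (Icc_subset_Ico_right htT)
  -- both curves stay in a ball, on which the velocity is Lipschitz uniformly in time
  obtain ⟨C1, hC1⟩ := isCompact_Icc.exists_bound_of_continuousOn hfc
  obtain ⟨C2, hC2⟩ := isCompact_Icc.exists_bound_of_continuousOn hgc
  obtain ⟨L, hL, hL'⟩ := hE.exists_bound htT (max C1 C2)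
  have hlip : ∀ τ ∈ Ico 0 t, LipschitzOnWith L.toNNReal (v τ)
      (Metric.closedBall (0 : E3) (max C1 C2)) := by
    intro τ hτ
    have hτ' := Ico_subset_Icc_self hτ
    refine (convex_closedBall _ _).lipschitzOnWith_of_nnnorm_hasFDerivWithin_le
      (fun x _ => (hE.hasFDerivAt_slice (hT τ hτ') x).hasFDerivWithinAt) fun x hx => ?_
    rw [← NNReal.coe_le_coe, coe_nnnorm, Real.coe_toNNReal _ hL]
    refine ContinuousLinearMap.opNorm_le_bound _ hL fun y => ?_
    refine (ContinuousLinearMap.le_opNorm (velocityDeriv T v (τ, x)) (0, y)).trans ?_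
    rw [Prod.norm_mk, norm_zero, max_eq_right (norm_nonneg _)]
    exact mul_le_mul_of_nonneg_right (hL' τ hτ' x (by simpa using hx)).2 (norm_nonneg _)
  have key := ODE_solution_unique_of_mem_Icc_right (v := v) hlip hgc
    (fun τ hτ => ((hg τ (Ico_subset_Icc_self hτ)).mono_of_mem_nhdsWithin
      (mem_of_superset (Ico_mem_nhdsGE (hτ.2.trans htT)) (Ico_subset_Ico_left hτ.1))))
    (fun τ hτ => by
      rw [mem_closedBall_zero_iff]
      exact (hC2 τ (Ico_subset_Icc_self hτ)).trans (le_max_right _ _))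
    hfc (fun τ hτ => (hf τ (Ico_subset_Icc_self hτ)).hasDerivWithinAt)
    (fun τ hτ => by
      rw [mem_closedBall_zero_iff]
      exact (hC1 τ (Ico_subset_Icc_self hτ)).trans (le_max_left _ _))
    (by simp only [hd.initial, position, H.series_zero_zero])
  exact add_left_cancel (key ⟨ht0, le_rfl⟩)

end energy

/-! ### The series of Taylor coefficients -/

section taylor

variable {γ Θ : ℝ≥0} {v₀ : E3 → E3}

/-- The initial velocity solves the first recurrence relations. -/
lemma coeffs_one (hγ : 0 < γ) (hγ1 : γ < 1) (hΘ : IsSchauderConstant γ Θ)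
    (hv : ContDiff ℝ 1 v₀) (hvp : Periodic3 v₀) (hdiv : ∀ q, divergence v₀ q = 0)
    (hω : ∀ k, MemHolder γ fun q => curl v₀ q k) : coeffs v₀ 1 = v₀ := by
  have hI : Finset.Ioo 0 1 = (∅ : Finset ℕ) := rfl
  refine (coeffs_spec hγ hγ1 hΘ hv hvp hω 1 le_rfl).1.unique le_rfl ⟨hvp, hv, fun q => ?_,
    fun q => ?_, by simp⟩
  · have : curlTerm (coeffs v₀) 1 q = 0 := by simp [curlTerm, hI]
    rw [this]
    simp
  · have e : posTriples 1 = ∅ := Finset.eq_empty_of_forall_notMem fun n hn => by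
      have := posTriples_pos_lt hn 0
      omega
    rw [hdiv, divCubic_eq, e, divQuadratic_eq]
    simp [divPair, hI]

lemma isCauchySeries_coeffs (hγ : 0 < γ) (hγ1 : γ < 1) (hΘ : IsSchauderConstant γ Θ)
    (hv : ContDiff ℝ 1 v₀) (hvp : Periodic3 v₀) (hω : ∀ k, MemHolder γ fun q => curl v₀ q k)
    {r : ℝ≥0} (hr0 : 0 < r)
    (hr : (r : ℝ≥0∞) < ENNReal.ofReal (Qc Θ) / (2 * vecNorm0 γ (curl v₀))) :
    IsCauchySeries v₀ (coeffs v₀) (fun s => (vecNorm1 γ (coeffs v₀ s)).toReal) r := by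
  have hsum := tsum_vecNorm1_ne_top hγ hγ1 hΘ hv hvp hω hr
  have hfin : ∀ s, vecNorm1 γ (coeffs v₀ s) ≠ ⊤ := fun s h => by
    refine ENNReal.ne_top_of_tsum_ne_top hsum s ?_
    rw [h, ENNReal.top_mul (pow_ne_zero _ (by exact_mod_cast hr0.ne'))]
  have hle : ∀ s k {x : ℝ}, ‖x‖ₑ ≤ (⨆ q, ‖comp (coeffs v₀ s) k q‖ₑ) +
      (⨆ i, norm0 γ (pd i (comp (coeffs v₀ s) k))) → |x| ≤ (vecNorm1 γ (coeffs v₀ s)).toReal := by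
    intro s k x hx
    have h1 := hx.trans (le_iSup (fun k => (⨆ q, ‖comp (coeffs v₀ s) k q‖ₑ) +
      ⨆ i, norm0 γ (pd i (comp (coeffs v₀ s) k))) k)
    have h2 := ENNReal.toReal_mono (hfin s) h1
    simpa using h2
  refine ⟨coeffs_zero v₀, fun s hs => (coeffs_spec hγ hγ1 hΘ hv hvp hω s hs).1,
    fun s k q => hle s k ((le_iSup (fun q => ‖comp (coeffs v₀ s) k q‖ₑ) q).trans le_self_add),
    fun s i k q => hle s k (((enorm_le_norm0 γ _ q).trans
      (le_iSup (fun i => norm0 γ (pd i (comp (coeffs v₀ s) k))) i)).trans le_add_self), ?_⟩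
  refine (ENNReal.summable_toReal hsum).congr fun s => ?_
  simp

/-- Up to the critical time the displacement gradient stays below the critical value of the
majorant equation. -/
lemma abs_pd_series_coeffs_le (hγ : 0 < γ) (hγ1 : γ < 1) (hΘ : IsSchauderConstant γ Θ)
    (hv : ContDiff ℝ 1 v₀) (hvp : Periodic3 v₀) (hω : ∀ k, MemHolder γ fun q => curl v₀ q k)
    {M : ℕ → ℝ} {R : ℝ} (H : IsCauchySeries v₀ (coeffs v₀) M R) {t : ℝ≥0} (htR : (t : ℝ) < R)
    (ht : (t : ℝ≥0∞) < ENNReal.ofReal (Qc Θ) / (2 * vecNorm0 γ (curl v₀))) (i k : Fin 3)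
    (q : E3) : |pd i (comp (series (coeffs v₀) 0 t) k) q| ≤ critValue Θ := by
  have h1 : ‖pd i (comp (series (coeffs v₀) 0 t) k) q‖ₑ ≤ ENNReal.ofReal (critValue Θ) := by
    rw [H.pd_series 0 (by rwa [abs_of_nonneg t.coe_nonneg])]
    refine enorm_tsum_le_tsum_enorm.trans (le_trans (ENNReal.tsum_le_tsum fun s => ?_)
      (tsum_gradNorm_le hγ hγ1 hΘ hv hvp hω ht))
    rw [wt_zero, enorm_mul, enorm_pow, mul_comm]
    refine mul_le_mul' ((enorm_le_norm0 γ _ q).trans (norm0_pd_le_gradNorm γ _ i k)) ?_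
    simp
  rwa [Real.enorm_eq_ofReal_abs, ENNReal.ofReal_le_ofReal_iff] at h1
  exact (critValue_pos (by exact_mod_cast hΘ.1)).le

end taylor

end

end EulerLagrange

open EulerLagrange
theorem mainTheorem1 (γ : ℝ≥0) (hγ0 : 0 < γ) (hγ1 : γ < 1) :
    (∃ Θ : ℝ≥0, IsSchauderConstant γ Θ) ∧
    ∀ Θ : ℝ≥0, IsSchauderConstant γ Θ → 0 < Qc Θ ∧
      ∀ v₀ : E3 → E3, Periodic3 v₀ → ContDiff ℝ 1 v₀ → (∀ q, divergence v₀ q = 0) →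
        (∀ k, MemHolder γ (fun q => curl v₀ q k)) →
        ∃ ξ : ℕ → E3 → E3,
          ξ 0 = 0 ∧
          (∀ s, 1 ≤ s → ∀ f, SolvesRecurrence v₀ ξ s f ↔ f = ξ s) ∧
          ENNReal.ofReal (Qc Θ) / (2 * vecNorm0 γ (curl v₀)) ≤ timeRadius γ ξ ∧
          ∀ (T : ℝ) (v : ℝ → E3 → E3) (p : ℝ → E3 → ℝ) (d : ℝ → E3 → E3),
            IsEulerFlow T v p → v 0 = v₀ → IsDisplacement T v d →
            ∀ t ∈ Set.Ico 0 T,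
              ENNReal.ofReal t < ENNReal.ofReal (Qc Θ) / (2 * vecNorm0 γ (curl v₀)) →
              ∀ q, HasSum (fun s : ℕ => t ^ s • ξ s q) (d t q) := by
  refine ⟨exists_isSchauderConstant hγ0 hγ1, fun Θ hΘ => ⟨Qc_pos (by exact_mod_cast hΘ.1), ?_⟩⟩
  intro v₀ hvp hv hdiv hω
  have hsol := fun s hs => (coeffs_spec hγ0 hγ1 hΘ hv hvp hω s hs).1
  refine ⟨coeffs v₀, coeffs_zero v₀, fun s hs f => ⟨fun hf => hf.unique hs (hsol s hs), ?_⟩,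
    le_timeRadius hγ0 hγ1 hΘ hv hvp hω, ?_⟩
  · rintro rfl
    exact hsol s hs
  intro T v p d hE h0 hd t ht htc q
  obtain ⟨r, htr, hr⟩ := ENNReal.lt_iff_exists_nnreal_btwn.1 htc
  have htr' : t.toNNReal < r := ENNReal.coe_lt_coe.1 htr
  have htR : t < r := (Real.toNNReal_lt_iff_lt_coe ht.1).1 htr'
  have H := isCauchySeries_coeffs hγ0 hγ1 hΘ hv hvp hω (bot_le.trans_lt htr') hr
  have hsmall : ∀ τ ∈ Set.Icc 0 t, ∀ i k q,
      |pd i (comp (series (coeffs v₀) 0 τ) k) q| ≤ 1 / 20 := by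
    intro τ hτ i k q
    lift τ to ℝ≥0 using hτ.1
    refine (abs_pd_series_coeffs_le hγ0 hγ1 hΘ hv hvp hω H (hτ.2.trans_lt htR) ?_ i k q).trans
      (critValue_le (by exact_mod_cast hΘ.one_le hγ1))
    refine lt_of_le_of_lt ?_ htc
    rw [← ENNReal.ofReal_coe_nnreal]
    exact ENNReal.ofReal_le_ofReal hτ.2
  rw [displacement_eq_series H (coeffs_one hγ0 hγ1 hΘ hv hvp hdiv hω) hE h0 hd ht.1 ht.2 htR
    hsmall q]
  exact H.hasSum_series (by rwa [abs_of_nonneg ht.1]) q
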